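/- Fix an integer $p\ge 3$, put $\lambda=2\cos(\pi/p)$, $S=\begin{pmatrix}1&\lambda\\0&1\end{pmatrix}$, $T=\begin{pmatrix}0&-1\\1&0\end{pmatrix}$, $U=ST$, and let $G_p=\langle S,T\rangle/\{\pm I\}$ be the Hecke group, acting by Möbius transformations. A real number is a hyperbolic point if it is fixed by some $M\in G_p$ with $|\operatorname{tr}M|>2$; its Hecke-conjugate $\alpha'$ is the other fixed point of the elements of its stabilizer in $G_p$. A set $R$ of hyperbolic points is Hecke-symmetric if $R=R'=\{x':x\in R\}$. For a hyperbolic point $\alpha$ let $M_\alpha=\begin{pmatrix}a&b\\c&d\end{pmatrix}$ be the primitive hyperbolic element of $G_p$ with positive trace that has $\alpha$ as attracting fixed point, and put $Q_\alpha=[c,d-a,-b]$, i.e. $Q_\alpha(z,1)=cz^2+(d-a)z-b$. The group $G_p$ acts on indefinite binary quadratic forms over $\mathbb Z[\lambda]$ by $(Q\circ M)(x,y)=Q(ax+by,cx+dy)$; a class (orbit) $\mathcal A$ is hyperbolic if it contains some $Q_\alpha$. Put $-\mathcal A=\{-Q:Q\in\mathcal A\}$, and let $Z_{\mathcal A}$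 be the set of hyperbolic points $\alpha$ such that $Q_\alpha=[A,B,C]\in\mathcal A$ and $A>0>C$. A rational period function (RPF) of weight $2k$ on $G_p$ is a rational function $q$ over $\mathbb C$ with $q+q|T=0$ and $\sum_{t=0}^{p-1}q|U^t=0$, where $(q|M)(z)=(cz+d)^{-2k}q(Mz)$. Its irreducible systems of (nonzero) poles (ISPs) are the sets $P_{\mathcal A}=Z_{\mathcal A}\cup TZ_{\mathcal A}$, $\mathcal A$ a hyperbolic class, that consist of poles of $q$. Let $q_{k,0}$ denote any function $a_0(1-z^{-2k})$ if $k\ne 1$, and $a_0(1-z^{-2})+b_1z^{-1}$ if $k=1$, with $a_0,b_1\in\mathbb C$. Theorem 2 (corrected). Let $k$ be an odd positive integer and $p\ge3$. Each set $Z_{\mathcal A}$, $\mathcal A$ a hyperbolic class, is finite. If $q$ is an RPF of weight $2k$ on $G_p$ all of whose ISPs are Hecke-symmetric, then $$q(z)=\sum_{\ell=1}^{L}d_\ell\sum_{\alpha\in Z_{\mathcal A_\ell}}Q_\alpha(z,1)^{-k}+c_0\,q_{k,0}(z)\qquad(*)$$ for some $L\ge 0$, constants $d_\ell,c_0\in\mathbb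 C$, a function $q_{k,0}$ as above, and hyperbolic classes $\mathcal A_\ell$ with $-\mathcal A_\ell=\mathcal A_\ell$. Conversely, every function of the form $(*)$ with hyperbolic classes satisfying $-\mathcal A_\ell=\mathcal A_\ell$ is an RPF of weight $2k$ on $G_p$ whose whole set of nonzero poles is Hecke-symmetric. Moreover, a Hecke-symmetric set of nonzero poles does not imply Hecke-symmetric ISPs: for every odd $k$ there are $p\ge3$ and a hyperbolic class $\mathcal A$, with $-\mathcal A$ hyperbolic, such that $\sum_{\alpha\in Z_{\mathcal A}}Q_\alpha(z,1)^{-k}+\sum_{\alpha\in Z_{-\mathcal A}}Q_\alpha(z,1)^{-k}$ is an RPF of weight $2k$ on $G_p$ whose set of nonzero poles is Hecke-symmetric, but which has an ISP that is not Hecke-symmetric. -/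

import Mathlib

noncomputable section

open scoped MatrixGroups

/-! ### The Hecke group `G_p`

It is handled through its preimage in `SL(2, ℝ)`; the quotient by `±I` is recorded by
identifying `M` with `-M` wherever it matters. -/

/-- `λ_p = 2 cos(π / p)`. -/
def heckeLambda (p : ℕ) : ℝ := 2 * Real.cos (Real.pi / p)

/-- `S = (1 λ; 0 1)`. -/
def heckeS (p : ℕ) : SL(2, ℝ) :=
  ⟨!![1, heckeLambda p; 0, 1], by simp [Matrix.det_fin_two]⟩

/-- `T = (0 -1; 1 0)`. -/
def heckeT : SL(2, ℝ) :=
  ⟨!![0, -1; 1, 0], by simp [Matrix.det_fin_two]⟩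

/-- `U = S T`. -/
def heckeU (p : ℕ) : SL(2, ℝ) := heckeS p * heckeT

/-- The Hecke group, as the subgroup of `SL(2, ℝ)` generated by `S` and `T`. -/
def heckeGroup (p : ℕ) : Subgroup SL(2, ℝ) := Subgroup.closure {heckeS p, heckeT}

/-- The trace of a matrix in `SL(2, ℝ)`. -/
def slTrace (M : SL(2, ℝ)) : ℝ := M 0 0 + M 1 1

/-- The real number `x` is fixed by the Möbius transformation of `M`. -/
def Fixes (M : SL(2, ℝ)) (x : ℝ) : Prop :=
  M 0 0 * x + M 0 1 = x * (M 1 0 * x + M 1 1)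

/-- `x` is an attracting fixed point of `M`: the derivative `(c x + d)⁻²` of the Möbius
transformation at the fixed point `x` is less than `1`. -/
def IsAttracting (M : SL(2, ℝ)) (x : ℝ) : Prop :=
  Fixes M x ∧ 1 < |M 1 0 * x + M 1 1|

/-- `x` is a hyperbolic fixed point of `G_p`. -/
def IsHyperbolicPoint (p : ℕ) (x : ℝ) : Prop :=
  ∃ M ∈ heckeGroup p, 2 < |slTrace M| ∧ Fixes M x

/-- `y` is the Hecke-conjugate of the hyperbolic fixed point `x`: the other fixed point of the
elements of the stabilizer of `x` in `G_p`. -/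
def IsHeckeConj (p : ℕ) (x y : ℝ) : Prop :=
  IsHyperbolicPoint p x ∧ y ≠ x ∧ ∀ M ∈ heckeGroup p, Fixes M x → Fixes M y

/-- `R' = {x' : x ∈ R}`, for a set `R` of hyperbolic fixed points inside `ℂ`. -/
def heckeConjSet (p : ℕ) (R : Set ℂ) : Set ℂ :=
  {w | ∃ x y : ℝ, (x : ℂ) ∈ R ∧ IsHeckeConj p x y ∧ w = (y : ℂ)}

/-- A set `R` is Hecke-symmetric if it consists of hyperbolic fixed points of `G_p` and
`R = R'`. (The first condition also follows from the second.) -/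
def HeckeSymmetric (p : ℕ) (R : Set ℂ) : Prop :=
  (∀ w ∈ R, ∃ x : ℝ, IsHyperbolicPoint p x ∧ w = (x : ℂ)) ∧ R = heckeConjSet p R

/-! ### Binary quadratic forms -/

/-- A binary quadratic form `[A, B, C]`, i.e. `A x² + B x y + C y²`, with real coefficients. -/
@[ext]
structure BQF where
  A : ℝ
  B : ℝ
  C : ℝ

namespace BQF

/-- `-Q`. -/
def neg (Q : BQF) : BQF := ⟨-Q.A, -Q.B, -Q.C⟩

/-- The discriminant. -/
def disc (Q : BQF) : ℝ := Q.B ^ 2 - 4 * Q.A * Q.C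

/-- `(Q ∘ M)(x, y) = Q(a x + b y, c x + d y)`. -/
def act (Q : BQF) (M : SL(2, ℝ)) : BQF :=
  ⟨Q.A * M 0 0 ^ 2 + Q.B * M 0 0 * M 1 0 + Q.C * M 1 0 ^ 2,
   2 * Q.A * M 0 0 * M 0 1 + Q.B * (M 0 0 * M 1 1 + M 0 1 * M 1 0) + 2 * Q.C * M 1 0 * M 1 1,
   Q.A * M 0 1 ^ 2 + Q.B * M 0 1 * M 1 1 + Q.C * M 1 1 ^ 2⟩

/-- The rational function `Q(z, 1)`. -/
def toRatFunc (Q : BQF) : RatFunc ℂ :=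
  RatFunc.C (Q.A : ℂ) * RatFunc.X ^ 2 + RatFunc.C (Q.B : ℂ) * RatFunc.X + RatFunc.C (Q.C : ℂ)

/-- The form `[c, d - a, -b]`, whose roots are the fixed points of `M = (a b; c d)`. -/
def ofMatrix (M : SL(2, ℝ)) : BQF := ⟨M 1 0, M 1 1 - M 0 0, -M 0 1⟩

/-- An indefinite form with coefficients in `ℤ[λ_p]`. -/
def IsLambda (p : ℕ) (Q : BQF) : Prop :=
  Q.A ∈ Algebra.adjoin ℤ {heckeLambda p} ∧ Q.B ∈ Algebra.adjoin ℤ {heckeLambda p} ∧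
    Q.C ∈ Algebra.adjoin ℤ {heckeLambda p} ∧ 0 < Q.disc

end BQF

/-- `M` is primitive in `G_p`: in `G_p = heckeGroup p / ±I` it is not a proper power. -/
def IsPrimitiveElt (p : ℕ) (M : SL(2, ℝ)) : Prop :=
  ∀ N ∈ heckeGroup p, ∀ n : ℕ, 2 ≤ n → M ≠ N ^ n ∧ M ≠ -N ^ n

/-- `M = M_α`: the primitive hyperbolic element of `G_p` with positive trace that has `α` as
attracting fixed point. -/
def IsGeneratorAt (p : ℕ) (α : ℝ) (M : SL(2, ℝ)) : Prop :=
  M ∈ heckeGroup p ∧ 2 < slTrace M ∧ IsPrimitiveElt p M ∧ IsAttracting M α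

open Classical in
/-- `M_α`, for a hyperbolic fixed point `α` (the identity for all other `α`). -/
def hyperbolicElt (p : ℕ) (α : ℝ) : SL(2, ℝ) :=
  if h : ∃ M, IsGeneratorAt p α M then h.choose else 1

/-- The form `Q_α` attached to a hyperbolic fixed point `α`. -/
def hyperbolicForm (p : ℕ) (α : ℝ) : BQF := BQF.ofMatrix (hyperbolicElt p α)

/-- A `G_p`-equivalence class of indefinite forms with coefficients in `ℤ[λ_p]`. -/
def IsFormClass (p : ℕ) (𝒜 : Set BQF) : Prop :=
  ∃ Q : BQF, Q.IsLambda p ∧ 𝒜 = {R | ∃ M ∈ heckeGroup p, R = Q.act M}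

/-- A hyperbolic class: one that contains the form of a hyperbolic fixed point. -/
def IsHyperbolicClass (p : ℕ) (𝒜 : Set BQF) : Prop :=
  IsFormClass p 𝒜 ∧ ∃ α : ℝ, IsHyperbolicPoint p α ∧ hyperbolicForm p α ∈ 𝒜

/-- `-𝒜 = {-Q : Q ∈ 𝒜}`. -/
def negClass (𝒜 : Set BQF) : Set BQF := BQF.neg '' 𝒜

/-- `Z_𝒜`: the hyperbolic fixed points `x` for which `Q_x = [A, B, C]` lies in `𝒜` and is simple,
i.e. `A > 0 > C`. -/
def simpleNumbers (p : ℕ) (𝒜 : Set BQF) : Set ℝ :=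
  {x | IsHyperbolicPoint p x ∧ hyperbolicForm p x ∈ 𝒜 ∧
    0 < (hyperbolicForm p x).A ∧ (hyperbolicForm p x).C < 0}

/-- The irreducible system of poles `P_𝒜 = Z_𝒜 ∪ T Z_𝒜` (with `T x = -1 / x`). -/
def poleSystem (p : ℕ) (𝒜 : Set BQF) : Set ℂ :=
  {w | ∃ x ∈ simpleNumbers p 𝒜, w = (x : ℂ) ∨ w = ((-1 / x : ℝ) : ℂ)}

/-! ### Rational period functions -/

/-- The weight `2k` slash operator `(q ∣ M)(z) = (c z + d)^(-2k) q((a z + b) / (c z + d))`. -/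
def slash (k : ℕ) (q : RatFunc ℂ) (M : SL(2, ℝ)) : RatFunc ℂ :=
  let num : RatFunc ℂ := RatFunc.C ((M 0 0 : ℝ) : ℂ) * RatFunc.X + RatFunc.C ((M 0 1 : ℝ) : ℂ)
  let den : RatFunc ℂ := RatFunc.C ((M 1 0 : ℝ) : ℂ) * RatFunc.X + RatFunc.C ((M 1 1 : ℝ) : ℂ)
  (den ^ (2 * k))⁻¹ * RatFunc.eval RatFunc.C (num / den) q

/-- A rational period function of weight `2k` for `G_p`. -/
def IsRPF (p k : ℕ) (q : RatFunc ℂ) : Prop :=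
  q + slash k q heckeT = 0 ∧ ∑ t ∈ Finset.range p, slash k q (heckeU p ^ t) = 0

/-- The nonzero (finite) poles of a rational function. -/
def nonzeroPoles (q : RatFunc ℂ) : Set ℂ := {w | w ≠ 0 ∧ q.denom.IsRoot w}

/-- `P` is one of the (nonzero) irreducible systems of poles of `q`. -/
def IsISPOf (p : ℕ) (q : RatFunc ℂ) (P : Set ℂ) : Prop :=
  ∃ 𝒜, IsHyperbolicClass p 𝒜 ∧ P = poleSystem p 𝒜 ∧ P ⊆ nonzeroPoles q

/-- `r` is one of the functions `q_{k,0}`: `a₀ (1 - z^(-2k))`, plus a term `b₁ z⁻¹` if `2k = 2`. -/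
def IsZeroPoleRPF (k : ℕ) (r : RatFunc ℂ) : Prop :=
  ∃ a₀ b₁ : ℂ, r = RatFunc.C a₀ * (1 - (RatFunc.X ^ (2 * k))⁻¹) +
    if k = 1 then RatFunc.C b₁ * RatFunc.X⁻¹ else 0

/-- `∑_{α ∈ Z_𝒜} Q_α(z, 1)^(-k)`. -/
def classSum (p k : ℕ) (𝒜 : Set BQF) : RatFunc ℂ :=
  ∑ᶠ α ∈ simpleNumbers p 𝒜, ((hyperbolicForm p α).toRatFunc ^ k)⁻¹

/-- `q = ∑_ℓ d_ℓ ∑_{α ∈ Z_{𝒜_ℓ}} Q_α(z, 1)^(-k) + c₀ q_{k,0}` with `-𝒜_ℓ = 𝒜_ℓ` for all `ℓ`. -/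
def HasSymmetricForm (p k : ℕ) (q : RatFunc ℂ) : Prop :=
  ∃ (L : ℕ) (d : Fin L → ℂ) (𝒜 : Fin L → Set BQF) (c₀ : ℂ) (r : RatFunc ℂ),
    (∀ l, IsHyperbolicClass p (𝒜 l) ∧ negClass (𝒜 l) = 𝒜 l) ∧ IsZeroPoleRPF k r ∧
      q = ∑ l, RatFunc.C (d l) * classSum p k (𝒜 l) + RatFunc.C c₀ * r

end

/-!
For `1 ≤ t < p` the matrix `V_t = U ^ t T⁻¹` has nonnegative entries, and the sets `V_t (0, ∞)` are
disjoint. Hence words in the `V_t` act like continued fraction expansions: the simple points, those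
whose form `[A, B, C]` has `A > 0 > C`, are the positive points fixed by a word, the word determines
the stabilizer, and the points of `Z_𝒜` form a single cycle under `x ↦ V_t x` (for the one `t` that
keeps `x` simple). In particular `Z_𝒜` is finite, and `x ↦ T x'` maps it onto `Z_{-𝒜}`.

The two relations of a rational period function combine to `q = ∑ q ∣ V_t`. So if `w` is a pole in
the right half plane, then so is some `V_t w`; by disjointness this is an injection of a finite set
into itself, whence `w` is fixed by a word `W`, hence simple, and the poles are a union of systems
`P_𝒜`. Moreover `q - q ∣ W` is regular at `w`. Since `W` has multiplier `≠ 1` there, the principal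
part of `q` at `w` can only have order `k` and is a multiple of that of `Q_w(z, 1)⁻ᵏ`, which `W`
fixes.

If `P_𝒜` is Hecke-symmetric then `-𝒜 = 𝒜`. For odd `k` the sum of `Q_x(z, 1)⁻ᵏ` over a set of
simple points stable under `x ↦ V_t x` and `x ↦ T x'` is a rational period function. Subtracting
multiples of such sums removes the nonzero poles one system at a time, and without nonzero poles
only `q_{k,0}` remains. For the counterexample, `Z_𝒜 ∪ Z_{-𝒜}` is stable in the same sense for every
class `𝒜`; the class of `√3` on the modular group satisfies `-𝒜 ≠ 𝒜`, because
`m² - 3 n² = -1` has no solution modulo `4`.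
-/

noncomputable section

open scoped MatrixGroups

/-! ### Matrices of determinant one and Möbius transformations -/

namespace SLTwo

variable {R : Type*} [CommRing R] (M N : SL(2, R))

lemma mul_zero_zero : (M * N) 0 0 = M 0 0 * N 0 0 + M 0 1 * N 1 0 := by
  simp [Matrix.mul_apply]

lemma mul_zero_one : (M * N) 0 1 = M 0 0 * N 0 1 + M 0 1 * N 1 1 := by
  simp [Matrix.mul_apply]

lemma mul_one_zero : (M * N) 1 0 = M 1 0 * N 0 0 + M 1 1 * N 1 0 := by
  simp [Matrix.mul_apply]

lemma mul_one_one : (M * N) 1 1 = M 1 0 * N 0 1 + M 1 1 * N 1 1 := by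
  simp [Matrix.mul_apply]

lemma inv_zero_zero : M⁻¹ 0 0 = M 1 1 := by simp [Matrix.adjugate_fin_two]

lemma inv_zero_one : M⁻¹ 0 1 = -M 0 1 := by simp [Matrix.adjugate_fin_two]

lemma inv_one_zero : M⁻¹ 1 0 = -M 1 0 := by simp [Matrix.adjugate_fin_two]

lemma inv_one_one : M⁻¹ 1 1 = M 0 0 := by simp [Matrix.adjugate_fin_two]

lemma neg_entry (i j : Fin 2) : (-M) i j = -M i j := by simp

lemma det_eq : M 0 0 * M 1 1 - M 0 1 * M 1 0 = 1 := by
  rw [← Matrix.det_fin_two, M.det_coe]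

variable {M N} in
lemma ext_entries (h00 : M 0 0 = N 0 0) (h01 : M 0 1 = N 0 1) (h10 : M 1 0 = N 1 0)
    (h11 : M 1 1 = N 1 1) : M = N := by
  ext i j
  fin_cases i <;> fin_cases j <;> assumption

end SLTwo

open SLTwo

/-- Equality up to sign. On `SL(2, ℝ)` this is equality of Möbius transformations, that is,
equality in `SL(2, ℝ) / ±I`. -/
def SignEq {G : Type*} [Neg G] (M N : G) : Prop := M = N ∨ M = -N

namespace SignEq

variable {G : Type*}

lemma refl [Neg G] (M : G) : SignEq M M := Or.inl rfl

lemma neg_self [Neg G] (M : G) : SignEq (-M) M := Or.inr rfl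

variable {M N P M' N' : G}

lemma symm [InvolutiveNeg G] : SignEq M N → SignEq N M
  | .inl h => .inl h.symm
  | .inr h => .inr (neg_eq_iff_eq_neg.mp h.symm)

lemma trans [InvolutiveNeg G] (h : SignEq M N) (h' : SignEq N P) : SignEq M P := by
  rcases h with rfl | rfl <;> rcases h' with rfl | rfl <;> simp [SignEq]

lemma mul [Mul G] [HasDistribNeg G] (h : SignEq M N) (h' : SignEq M' N') :
    SignEq (M * M') (N * N') := by
  rcases h with rfl | rfl <;> rcases h' with rfl | rfl <;> simp [SignEq]

end SignEq

section Moebius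

variable {R K : Type*} [CommRing R] [Field K] [Algebra R K]

/-- The numerator `a x + b` of the Möbius transformation of `M = (a b; c d)` at `x`. -/
def mobNum (M : SL(2, R)) (x : K) : K := algebraMap R K (M 0 0) * x + algebraMap R K (M 0 1)

/-- The denominator `c x + d` of the Möbius transformation of `M = (a b; c d)` at `x`. -/
def mobDen (M : SL(2, R)) (x : K) : K := algebraMap R K (M 1 0) * x + algebraMap R K (M 1 1)

/-- The Möbius transformation of `M` at a finite point `x`; it takes the junk value `0` where
the denominator vanishes. The entries of `M` lie in a ring `R` below `K`, so that the Hecke group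
acts on real and on complex numbers alike. -/
def mob (M : SL(2, R)) (x : K) : K := mobNum M x / mobDen M x

lemma algebraMap_det (M : SL(2, R)) :
    algebraMap R K (M 0 0) * algebraMap R K (M 1 1) -
      algebraMap R K (M 0 1) * algebraMap R K (M 1 0) = 1 := by
  rw [← map_mul, ← map_mul, ← map_sub, det_eq, map_one]

section

variable (M N : SL(2, R)) {x y : K}

lemma mobDen_mul (h : mobDen N x ≠ 0) :
    mobDen (M * N) x = mobDen M (mob N x) * mobDen N x := by
  simp only [mob, mobDen, mobNum, mul_one_zero, mul_one_one, map_add, map_mul] at h ⊢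
  field_simp
  ring

lemma mobNum_mul (h : mobDen N x ≠ 0) :
    mobNum (M * N) x = mobNum M (mob N x) * mobDen N x := by
  simp only [mob, mobDen, mobNum, mul_zero_zero, mul_zero_one, map_add, map_mul] at h ⊢
  field_simp
  ring

lemma mob_mul (h : mobDen N x ≠ 0) : mob (M * N) x = mob M (mob N x) := by
  rw [mob, mobDen_mul M N h, mobNum_mul M N h, mul_div_mul_right _ _ h, ← mob]

@[simp] lemma mobDen_one (x : K) : mobDen (1 : SL(2, R)) x = 1 := by simp [mobDen]

@[simp] lemma mobNum_one (x : K) : mobNum (1 : SL(2, R)) x = x := by simp [mobNum]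

@[simp] lemma mob_one (x : K) : mob (1 : SL(2, R)) x = x := by simp [mob]

lemma mobDen_neg (x : K) : mobDen (-M) x = -mobDen M x := by
  simp only [mobDen, neg_entry, map_neg]
  ring

lemma mobNum_neg (x : K) : mobNum (-M) x = -mobNum M x := by
  simp only [mobNum, neg_entry, map_neg]
  ring

@[simp] lemma mob_neg (x : K) : mob (-M) x = mob M x := by
  simp [mob, mobDen_neg, mobNum_neg, neg_div_neg_eq]

lemma mobDen_inv_mob (h : mobDen M x ≠ 0) : mobDen M⁻¹ (mob M x) * mobDen M x = 1 := by
  rw [← mobDen_mul _ _ h, inv_mul_cancel, mobDen_one]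

lemma mobDen_inv_mob_ne (h : mobDen M x ≠ 0) : mobDen M⁻¹ (mob M x) ≠ 0 :=
  left_ne_zero_of_mul_eq_one (mobDen_inv_mob M h)

lemma mob_inv_mob (h : mobDen M x ≠ 0) : mob M⁻¹ (mob M x) = x := by
  rw [← mob_mul _ _ h, inv_mul_cancel, mob_one]

lemma mob_injective (hx : mobDen M x ≠ 0) (hy : mobDen M y ≠ 0) (h : mob M x = mob M y) :
    x = y := by
  rw [← mob_inv_mob M hx, h, mob_inv_mob M hy]

end

lemma SignEq.mob_eq {M N : SL(2, R)} (h : SignEq M N) (x : K) : mob M x = mob N x := by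
  rcases h with rfl | rfl <;> simp

end Moebius

section HeckeT

variable {K : Type*} [Field K] [Algebra ℝ K] (x : K)

lemma heckeT_mul_self : heckeT * heckeT = -1 := by
  apply ext_entries <;>
    simp only [mul_zero_zero, mul_zero_one, mul_one_zero, mul_one_one] <;> simp [heckeT]

lemma heckeT_inv : heckeT⁻¹ = -heckeT := by
  rw [inv_eq_iff_mul_eq_one, mul_neg, heckeT_mul_self, neg_neg]

lemma mob_heckeT : mob heckeT x = -1 / x := by simp [mob, mobDen, mobNum, heckeT]

lemma mobDen_heckeT : mobDen heckeT x = x := by simp [mobDen, heckeT]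

lemma mob_heckeT_inv : mob heckeT⁻¹ x = -1 / x := by rw [heckeT_inv, mob_neg, mob_heckeT]

lemma mobDen_heckeT_inv : mobDen heckeT⁻¹ x = -x := by
  rw [heckeT_inv, mobDen_neg, mobDen_heckeT]

end HeckeT

section Real

variable (M : SL(2, ℝ)) (x : ℝ)

lemma mobDen_ofReal : mobDen M (x : ℂ) = (mobDen M x : ℝ) := by simp [mobDen]

lemma mob_ofReal : mob M (x : ℂ) = (mob M x : ℝ) := by simp [mob, mobNum, mobDen]

lemma mobDen_real : mobDen M x = M 1 0 * x + M 1 1 := rfl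

lemma mobNum_real : mobNum M x = M 0 0 * x + M 0 1 := rfl

lemma slTrace_neg : slTrace (-M) = -slTrace M := by
  simp only [slTrace, neg_entry]
  ring

lemma slTrace_inv : slTrace M⁻¹ = slTrace M := by
  simp only [slTrace, inv_zero_zero, inv_one_one]
  ring

lemma slTrace_conj (N : SL(2, ℝ)) : slTrace (N * M * N⁻¹) = slTrace M := by
  simp only [slTrace, mul_zero_zero, mul_zero_one, mul_one_zero, mul_one_one, inv_zero_zero,
    inv_zero_one, inv_one_zero, inv_one_one]
  linear_combination (M 0 0 + M 1 1) * det_eq N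

end Real

/-! ### Fixed points -/

section Fixes

variable {M N : SL(2, ℝ)} {x : ℝ}

lemma SignEq.abs_slTrace (h : SignEq M N) : |slTrace M| = |slTrace N| := by
  rcases h with rfl | rfl
  · rfl
  · rw [slTrace_neg, abs_neg]

lemma Fixes.mobDen_ne (h : Fixes M x) : mobDen M x ≠ 0 := by
  intro hden
  have hnum : mobNum M x = 0 := by rw [mobNum_real, h, ← mobDen_real, hden, mul_zero]
  rw [mobDen_real] at hden
  rw [mobNum_real] at hnum
  exact one_ne_zero (by linear_combination -det_eq M + M 0 0 * hden - M 1 0 * hnum)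

lemma fixes_iff_mob_eq (hd : mobDen M x ≠ 0) : Fixes M x ↔ mob M x = x := by
  rw [mob, div_eq_iff hd, mobNum_real, mobDen_real, Fixes]

lemma Fixes.mob_eq (h : Fixes M x) : mob M x = x := (fixes_iff_mob_eq h.mobDen_ne).mp h

lemma fixes_of_mob_eq (hd : mobDen M x ≠ 0) (h : mob M x = x) : Fixes M x :=
  (fixes_iff_mob_eq hd).mpr h

lemma mobDen_mul_of_fixes (M : SL(2, ℝ)) (hN : Fixes N x) :
    mobDen (M * N) x = mobDen M x * mobDen N x := by
  rw [mobDen_mul _ _ hN.mobDen_ne, hN.mob_eq]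

/-- The stabilizer of a real number in `SL(2, ℝ)`. -/
def fixer (x : ℝ) : Subgroup SL(2, ℝ) where
  carrier := {M | Fixes M x}
  one_mem' := by simp [Fixes]
  mul_mem' {M N} (hM : Fixes M x) (hN : Fixes N x) := by
    refine fixes_of_mob_eq ?_ ?_
    · rw [mobDen_mul_of_fixes M hN]
      exact mul_ne_zero hM.mobDen_ne hN.mobDen_ne
    · rw [mob_mul _ _ hN.mobDen_ne, hN.mob_eq, hM.mob_eq]
  inv_mem' {M} (hM : Fixes M x) := by
    have hd := mobDen_inv_mob_ne M hM.mobDen_ne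
    have hx := mob_inv_mob M hM.mobDen_ne
    rw [hM.mob_eq] at hd hx
    exact fixes_of_mob_eq hd hx

lemma SignEq.fixes (h : SignEq M N) (hN : Fixes N x) : Fixes M x := by
  rcases h with rfl | rfl
  · exact hN
  · simp only [Fixes, neg_entry] at hN ⊢
    linear_combination -hN

lemma Fixes.conj (h : Fixes M x) (hN : mobDen N x ≠ 0) : Fixes (N * M * N⁻¹) (mob N x) := by
  have hd := mobDen_inv_mob_ne N hN
  have hx := mob_inv_mob N hN
  refine fixes_of_mob_eq ?_ ?_
  · rw [mobDen_mul _ _ hd, hx, mobDen_mul_of_fixes N h]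
    exact mul_ne_zero (mul_ne_zero hN h.mobDen_ne) hd
  · rw [mob_mul _ _ hd, hx, mob_mul _ _ h.mobDen_ne, h.mob_eq]

end Fixes

/-! ### Matrices with nonnegative entries -/

namespace SLTwo

/-- The matrices of determinant one with nonnegative off-diagonal entries and with diagonal
entries at least `1`. They form a monoid, on which both off-diagonal entries are superadditive; it
serves to bound the words in the generators of the Hecke group away from the identity. -/
def nonnegMonoid (R : Type*) [CommRing R] [LinearOrder R] [IsStrictOrderedRing R] :
    Submonoid SL(2, R) where
  carrier := {M | 1 ≤ M 0 0 ∧ 0 ≤ M 0 1 ∧ 0 ≤ M 1 0 ∧ 1 ≤ M 1 1}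
  one_mem' := by simp
  mul_mem' {M N} := by
    rintro ⟨ha, hb, hc, hd⟩ ⟨ha', hb', hc', hd'⟩
    simp only [Set.mem_ofPred_eq, mul_zero_zero, mul_zero_one, mul_one_zero, mul_one_one]
    refine ⟨?_, by positivity, by positivity, ?_⟩
    · linarith [one_le_mul_of_one_le_of_one_le ha ha', mul_nonneg hb hc']
    · linarith [one_le_mul_of_one_le_of_one_le hd hd', mul_nonneg hc hb']

section

variable {R : Type*} [CommRing R] [LinearOrder R] [IsStrictOrderedRing R] {M N : SL(2, R)}

lemma mem_nonnegMonoid :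
    M ∈ nonnegMonoid R ↔ 1 ≤ M 0 0 ∧ 0 ≤ M 0 1 ∧ 0 ≤ M 1 0 ∧ 1 ≤ M 1 1 := Iff.rfl

lemma add_le_mul_zero_one (hM : M ∈ nonnegMonoid R) (hN : N ∈ nonnegMonoid R) :
    M 0 1 + N 0 1 ≤ (M * N) 0 1 := by
  rw [mul_zero_one]
  linarith [le_mul_of_one_le_left hN.2.1 hM.1, le_mul_of_one_le_right hM.2.1 hN.2.2.2]

lemma add_le_mul_one_zero (hM : M ∈ nonnegMonoid R) (hN : N ∈ nonnegMonoid R) :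
    M 1 0 + N 1 0 ≤ (M * N) 1 0 := by
  rw [mul_one_zero]
  linarith [le_mul_of_one_le_left hN.2.2.1 hM.2.2.2, le_mul_of_one_le_right hM.2.2.1 hN.1]

lemma diag_eq_one (hM : M ∈ nonnegMonoid R) (h : M 0 1 * M 1 0 = 0) :
    M 0 0 = 1 ∧ M 1 1 = 1 := by
  obtain ⟨ha, -, -, hd⟩ := hM
  have had : M 0 0 * M 1 1 = 1 := by linear_combination det_eq M + h
  constructor
  · nlinarith
  · nlinarith

end

end SLTwo

/-- The closed right half plane without `0`. -/
def RightHalf (x : ℂ) : Prop := 0 ≤ x.re ∧ x ≠ 0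

lemma rightHalf_ofReal {x : ℝ} : RightHalf (x : ℂ) ↔ 0 < x := by
  simp only [RightHalf, Complex.ofReal_re, ne_eq, Complex.ofReal_eq_zero]
  rw [lt_iff_le_and_ne, ne_comm]

lemma rightHalf_of_re_pos {x : ℂ} (hx : 0 < x.re) : RightHalf x :=
  ⟨hx.le, by rintro rfl; simp at hx⟩

section NonnegMonoid

variable {M : SL(2, ℝ)}

lemma mobDen_ne_of_mem_nonnegMonoid (hM : M ∈ nonnegMonoid ℝ) {x : ℂ} (hx : 0 ≤ x.re) :
    mobDen M x ≠ 0 := by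
  obtain ⟨-, -, hc, hd⟩ := hM
  intro h
  have hre : M 1 0 * x.re + M 1 1 = 0 := by simpa [mobDen] using congrArg Complex.re h
  linarith [mul_nonneg hc hx]

lemma mob_re_pos_of_mem_nonnegMonoid (hM : M ∈ nonnegMonoid ℝ) (h0 : 0 < M 0 1 + M 1 0) {x : ℂ}
    (hx : RightHalf x) : 0 < (mob M x).re := by
  have hden := mobDen_ne_of_mem_nonnegMonoid hM hx.1
  obtain ⟨ha, hb, hc, hd⟩ := hM
  have hre := hx.1
  have hn : 0 < x.re * x.re + x.im * x.im := Complex.normSq_pos.mpr hx.2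
  have hsum : 0 < M 0 0 * M 1 0 * (x.re * x.re + x.im * x.im) + M 0 1 * M 1 1 := by
    rcases hb.eq_or_lt with hb | hb
    · have hc : 0 < M 1 0 := by linarith
      rw [← hb]
      positivity
    · positivity
  have hmid : 0 ≤ (M 0 0 * M 1 1 + M 0 1 * M 1 0) * x.re := by positivity
  rw [mob, Complex.div_re, ← add_div]
  refine div_pos ?_ (Complex.normSq_pos.mpr hden)
  simp only [mobNum, mobDen, Complex.coe_algebraMap, Complex.add_re, Complex.add_im,
    Complex.mul_re, Complex.mul_im, Complex.ofReal_re, Complex.ofReal_im, zero_mul, sub_zero,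
    add_zero]
  linarith

lemma im_eq_zero_of_mob_eq (hM : M ∈ nonnegMonoid ℝ) (h0 : 0 < M 0 1 + M 1 0) {x : ℂ}
    (hx : RightHalf x) (h : mob M x = x) : x.im = 0 := by
  rw [mob, div_eq_iff (mobDen_ne_of_mem_nonnegMonoid hM hx.1)] at h
  obtain ⟨-, hb, hc, -⟩ := hM
  by_contra him
  have him' := congrArg Complex.im h
  have hre' := congrArg Complex.re h
  simp only [mobNum, mobDen, Complex.coe_algebraMap, Complex.add_re, Complex.add_im,
    Complex.mul_re, Complex.mul_im, Complex.ofReal_re, Complex.ofReal_im, zero_mul, sub_zero,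
    add_zero] at him' hre'
  have htr : M 0 0 - 2 * M 1 0 * x.re - M 1 1 = 0 :=
    (mul_eq_zero.mp (by linear_combination him' :
      x.im * (M 0 0 - 2 * M 1 0 * x.re - M 1 1) = 0)).resolve_left him
  have hn : 0 < x.re * x.re + x.im * x.im := Complex.normSq_pos.mpr hx.2
  have hbc : M 0 1 + M 1 0 * (x.re * x.re + x.im * x.im) = 0 := by
    linear_combination hre' - x.re * htr
  nlinarith [mul_nonneg hc hn.le]

lemma off_diag_pos_of_fixes (hM : M ∈ nonnegMonoid ℝ) (h0 : 0 < M 0 1 + M 1 0) {x : ℝ}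
    (hx : 0 < x) (h : Fixes M x) : 0 < M 0 1 ∧ 0 < M 1 0 := by
  rw [Fixes] at h
  refine ⟨hM.2.1.lt_of_ne' fun hb ↦ ?_, hM.2.2.1.lt_of_ne' fun hc ↦ ?_⟩
  · obtain ⟨ha, hd⟩ := diag_eq_one hM (by rw [hb, zero_mul])
    rw [hb, zero_add] at h0
    rw [ha, hb, hd] at h
    linarith [mul_pos h0 (mul_pos hx hx)]
  · obtain ⟨ha, hd⟩ := diag_eq_one hM (by rw [hc, mul_zero])
    rw [ha, hc, hd] at h
    linarith

variable {x : ℝ}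

lemma mobDen_pos_of_mem_nonnegMonoid (hM : M ∈ nonnegMonoid ℝ) (hx : 0 ≤ x) :
    0 < mobDen M x := by
  obtain ⟨-, -, hc, hd⟩ := hM
  rw [mobDen_real]
  positivity

lemma mob_pos_of_mem_nonnegMonoid (hM : M ∈ nonnegMonoid ℝ) (hx : 0 < x) : 0 < mob M x := by
  refine div_pos ?_ (mobDen_pos_of_mem_nonnegMonoid hM hx.le)
  obtain ⟨ha, hb, -, -⟩ := hM
  rw [mobNum_real]
  positivity

lemma mobDen_inv_pos_of_mem_nonnegMonoid (hM : M ∈ nonnegMonoid ℝ) (hx : x < 0) :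
    0 < mobDen M⁻¹ x := by
  obtain ⟨ha, -, hc, -⟩ := hM
  rw [mobDen_real, inv_one_zero, inv_one_one]
  nlinarith

lemma mob_inv_neg_of_mem_nonnegMonoid (hM : M ∈ nonnegMonoid ℝ) (hx : x < 0) :
    mob M⁻¹ x < 0 := by
  refine div_neg_of_neg_of_pos ?_ (mobDen_inv_pos_of_mem_nonnegMonoid hM hx)
  obtain ⟨-, hb, -, hd⟩ := hM
  rw [mobNum_real, inv_zero_zero, inv_zero_one]
  nlinarith

end NonnegMonoid

/-! ### Powers of `U` and the positive words of the Hecke group -/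

/-- The ratio `sin (t π / p) / sin (π / p)`: the entries of `U ^ t` are such ratios up to sign. -/
def sinRatio (p : ℕ) (t : ℝ) : ℝ := Real.sin (t * (Real.pi / p)) / Real.sin (Real.pi / p)

section

variable {p : ℕ}

lemma sin_pi_div_pos (hp : 3 ≤ p) : 0 < Real.sin (Real.pi / p) := by
  have hp' : (3 : ℝ) ≤ p := by exact_mod_cast hp
  refine Real.sin_pos_of_pos_of_lt_pi (by positivity) ?_
  rw [div_lt_iff₀ (by linarith)]
  nlinarith [Real.pi_pos]

lemma heckeLambda_pos (hp : 3 ≤ p) : 0 < heckeLambda p := by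
  have hp' : (3 : ℝ) ≤ p := by exact_mod_cast hp
  refine mul_pos two_pos (Real.cos_pos_of_mem_Ioo ⟨?_, ?_⟩)
  · have : 0 < Real.pi / p := by positivity
    linarith [Real.pi_pos]
  · rw [div_lt_div_iff₀ (by linarith) two_pos]
    nlinarith [Real.pi_pos]

@[simp] lemma sinRatio_zero : sinRatio p 0 = 0 := by simp [sinRatio]

lemma sinRatio_one (hp : 3 ≤ p) : sinRatio p 1 = 1 := by
  simp [sinRatio, (sin_pi_div_pos hp).ne']

lemma sinRatio_self (hp : 3 ≤ p) : sinRatio p p = 0 := by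
  have : (p : ℝ) ≠ 0 := by positivity
  simp [sinRatio, mul_div_cancel₀, this]

lemma sinRatio_sub_one (hp : 3 ≤ p) : sinRatio p (p - 1) = 1 := by
  have : (p : ℝ) ≠ 0 := by positivity
  rw [sinRatio, sub_mul, mul_div_cancel₀ _ this, one_mul, Real.sin_pi_sub,
    div_self (sin_pi_div_pos hp).ne']

lemma sinRatio_neg_one (hp : 3 ≤ p) : sinRatio p (-1) = -1 := by
  rw [sinRatio, neg_one_mul, Real.sin_neg, neg_div, div_self (sin_pi_div_pos hp).ne']

lemma sinRatio_add_one (t : ℝ) :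
    sinRatio p (t + 1) = heckeLambda p * sinRatio p t - sinRatio p (t - 1) := by
  simp only [sinRatio, heckeLambda, add_mul, sub_mul, one_mul, Real.sin_add, Real.sin_sub]
  ring

lemma sinRatio_pos (hp : 3 ≤ p) {t : ℝ} (h0 : 0 < t) (h1 : t < p) : 0 < sinRatio p t := by
  have hp' : (3 : ℝ) ≤ p := by exact_mod_cast hp
  refine div_pos (Real.sin_pos_of_pos_of_lt_pi (by positivity) ?_) (sin_pi_div_pos hp)
  rw [← mul_div_assoc, div_lt_iff₀ (by linarith)]
  nlinarith [Real.pi_pos]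

lemma sinRatio_nonneg (hp : 3 ≤ p) {t : ℝ} (h0 : 0 ≤ t) (h1 : t ≤ p) : 0 ≤ sinRatio p t := by
  rcases h0.eq_or_lt with rfl | h0
  · simp
  rcases h1.eq_or_lt with rfl | h1
  · rw [sinRatio_self hp]
  · exact (sinRatio_pos hp h0 h1).le

lemma heckeU_entries (p : ℕ) : heckeU p 0 0 = heckeLambda p ∧ heckeU p 0 1 = -1 ∧
    heckeU p 1 0 = 1 ∧ heckeU p 1 1 = 0 := by
  simp only [heckeU, mul_zero_zero, mul_zero_one, mul_one_zero, mul_one_one]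
  simp [heckeS, heckeT]

lemma heckeU_pow_entries (hp : 3 ≤ p) (t : ℕ) :
    (heckeU p ^ t) 0 0 = sinRatio p (t + 1) ∧ (heckeU p ^ t) 0 1 = -sinRatio p t ∧
    (heckeU p ^ t) 1 0 = sinRatio p t ∧ (heckeU p ^ t) 1 1 = -sinRatio p (t - 1) := by
  induction t with
  | zero => simp [sinRatio_one hp, sinRatio_neg_one hp]
  | succ t ih =>
    obtain ⟨u00, u01, u10, u11⟩ := heckeU_entries p
    obtain ⟨h00, h01, h10, h11⟩ := ih
    have ht := sinRatio_add_one (p := p) t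
    have ht' := sinRatio_add_one (p := p) (t + 1)
    rw [add_sub_cancel_right] at ht'
    rw [pow_succ]
    simp only [mul_zero_zero, mul_zero_one, mul_one_zero, mul_one_one, u00, u01, u10, u11, h00,
      h01, h10, h11]
    push_cast
    rw [ht', add_sub_cancel_right]
    exact ⟨by ring, by ring, by rw [ht]; ring, by ring⟩

lemma heckeU_pow_self (hp : 3 ≤ p) : heckeU p ^ p = -1 := by
  obtain ⟨h00, h01, h10, h11⟩ := heckeU_pow_entries hp p
  have h := sinRatio_add_one (p := p) p
  rw [sinRatio_self hp, sinRatio_sub_one hp] at h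
  rw [sinRatio_self hp] at h01 h10
  rw [sinRatio_sub_one hp] at h11
  apply ext_entries <;> rw [neg_entry] <;> simp [*]

/-- The matrix `V_t = U ^ t T⁻¹`. For `1 ≤ t < p` its entries are nonnegative, and these `p - 1`
matrices freely generate a monoid that governs the dynamics of the Hecke group on `(0, ∞)`. -/
def heckeV (p t : ℕ) : SL(2, ℝ) := heckeU p ^ t * heckeT⁻¹

lemma heckeV_entries (hp : 3 ≤ p) (t : ℕ) :
    heckeV p t 0 0 = sinRatio p t ∧ heckeV p t 0 1 = sinRatio p (t + 1) ∧
    heckeV p t 1 0 = sinRatio p (t - 1) ∧ heckeV p t 1 1 = sinRatio p t := by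
  obtain ⟨h00, h01, h10, h11⟩ := heckeU_pow_entries hp t
  simp only [heckeV, mul_zero_zero, mul_zero_one, mul_one_zero, mul_one_one, inv_zero_zero,
    inv_zero_one, inv_one_zero, inv_one_one, h00, h01, h10, h11]
  simp [heckeT]

lemma sinRatio_det (hp : 3 ≤ p) (t : ℕ) :
    sinRatio p t * sinRatio p t - sinRatio p (t + 1) * sinRatio p (t - 1) = 1 := by
  obtain ⟨h00, h01, h10, h11⟩ := heckeV_entries hp t
  have hdet := det_eq (heckeV p t)
  rwa [h00, h01, h10, h11] at hdet

lemma heckeU_pow_mul_heckeV (p t j : ℕ) : heckeU p ^ t * heckeV p j = heckeV p (t + j) := by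
  rw [heckeV, heckeV, pow_add, mul_assoc]

lemma heckeV_mem_nonnegMonoid (hp : 3 ≤ p) {t : ℕ} (ht : 1 ≤ t ∧ t < p) :
    heckeV p t ∈ nonnegMonoid ℝ := by
  have h1 : (1 : ℝ) ≤ t := by exact_mod_cast ht.1
  have h2 : (t : ℝ) + 1 ≤ p := by exact_mod_cast ht.2
  have hpos : 0 < sinRatio p t := sinRatio_pos hp (by linarith) (by linarith)
  have hnext : 0 ≤ sinRatio p (t + 1) := sinRatio_nonneg hp (by linarith) (by linarith)
  have hprev : 0 ≤ sinRatio p (t - 1) := sinRatio_nonneg hp (by linarith) (by linarith)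
  have hone : 1 ≤ sinRatio p t := by nlinarith [sinRatio_det hp t, mul_nonneg hnext hprev]
  obtain ⟨h00, h01, h10, h11⟩ := heckeV_entries hp t
  rw [mem_nonnegMonoid, h00, h01, h10, h11]
  exact ⟨hone, hnext, hprev, hone⟩

lemma heckeV_off_diag_pos (hp : 3 ≤ p) {t : ℕ} (ht : 1 ≤ t ∧ t < p) :
    0 < heckeV p t 0 1 + heckeV p t 1 0 := by
  have hdiag := (heckeV_mem_nonnegMonoid hp ht).1
  obtain ⟨h00, h01, h10, -⟩ := heckeV_entries hp t
  rw [h00] at hdiag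
  rw [h01, h10, sinRatio_add_one, sub_add_cancel]
  exact mul_pos (heckeLambda_pos hp) (by linarith)

/-- The product `V_{t₁} ⋯ V_{tₙ}` of the word `[t₁, …, tₙ]`. -/
def wordProd (p : ℕ) (l : List ℕ) : SL(2, ℝ) := (l.map (heckeV p)).prod

@[simp] lemma wordProd_nil : wordProd p [] = 1 := rfl

@[simp] lemma wordProd_cons (t : ℕ) (l : List ℕ) :
    wordProd p (t :: l) = heckeV p t * wordProd p l := by
  simp [wordProd]

lemma wordProd_singleton (t : ℕ) : wordProd p [t] = heckeV p t := by simp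

lemma wordProd_append (l l' : List ℕ) :
    wordProd p (l ++ l') = wordProd p l * wordProd p l' := by
  simp [wordProd]

/-- A word is admissible if its letters are between `1` and `p - 1`, so that every `V_t` in its
product has nonnegative entries. -/
def Admissible (p : ℕ) (l : List ℕ) : Prop := ∀ t ∈ l, 1 ≤ t ∧ t < p

lemma admissible_nil : Admissible p [] := by simp [Admissible]

lemma admissible_cons {t : ℕ} {l : List ℕ} :
    Admissible p (t :: l) ↔ (1 ≤ t ∧ t < p) ∧ Admissible p l := by
  simp [Admissible]

lemma admissible_singleton {t : ℕ} : Admissible p [t] ↔ 1 ≤ t ∧ t < p := by simp [Admissible]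

lemma admissible_append {l l' : List ℕ} :
    Admissible p (l ++ l') ↔ Admissible p l ∧ Admissible p l' := by
  simp only [Admissible, List.mem_append, or_imp, forall_and]
  tauto

lemma heckeT_mem : heckeT ∈ heckeGroup p := Subgroup.subset_closure (by simp)

lemma heckeS_mem : heckeS p ∈ heckeGroup p := Subgroup.subset_closure (by simp)

lemma heckeU_mem : heckeU p ∈ heckeGroup p := mul_mem heckeS_mem heckeT_mem

lemma heckeV_mem (t : ℕ) : heckeV p t ∈ heckeGroup p :=
  mul_mem (pow_mem heckeU_mem _) (inv_mem heckeT_mem)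

lemma wordProd_mem (l : List ℕ) : wordProd p l ∈ heckeGroup p := by
  induction l with
  | nil => exact one_mem _
  | cons t l ih => rw [wordProd_cons]; exact mul_mem (heckeV_mem t) ih

lemma wordProd_mem_nonnegMonoid (hp : 3 ≤ p) {l : List ℕ} (hl : Admissible p l) :
    wordProd p l ∈ nonnegMonoid ℝ := by
  induction l with
  | nil => exact one_mem _
  | cons t l ih =>
    rw [admissible_cons] at hl
    rw [wordProd_cons]
    exact mul_mem (heckeV_mem_nonnegMonoid hp hl.1) (ih hl.2)

lemma wordProd_off_diag_pos (hp : 3 ≤ p) {l : List ℕ} (hl : Admissible p l) (hne : l ≠ []) :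
    0 < wordProd p l 0 1 + wordProd p l 1 0 := by
  obtain ⟨t, l, rfl⟩ := List.exists_cons_of_ne_nil hne
  rw [admissible_cons] at hl
  have hV := heckeV_mem_nonnegMonoid hp hl.1
  have hW := wordProd_mem_nonnegMonoid hp hl.2
  rw [wordProd_cons]
  linarith [add_le_mul_zero_one hV hW, add_le_mul_one_zero hV hW, heckeV_off_diag_pos hp hl.1,
    hW.2.1, hW.2.2.1]

/-! ### Action on the closed right half plane -/

lemma mobDen_wordProd_ne (hp : 3 ≤ p) {l : List ℕ} (hl : Admissible p l) {x : ℂ}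
    (hx : 0 ≤ x.re) : mobDen (wordProd p l) x ≠ 0 :=
  mobDen_ne_of_mem_nonnegMonoid (wordProd_mem_nonnegMonoid hp hl) hx

lemma mobDen_heckeV_ne (hp : 3 ≤ p) {t : ℕ} (ht : 1 ≤ t ∧ t < p) {x : ℂ}
    (hx : 0 ≤ x.re) : mobDen (heckeV p t) x ≠ 0 :=
  mobDen_ne_of_mem_nonnegMonoid (heckeV_mem_nonnegMonoid hp ht) hx

lemma mob_heckeV_re_pos (hp : 3 ≤ p) {t : ℕ} (ht : 1 ≤ t ∧ t < p) {x : ℂ} (hx : RightHalf x) :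
    0 < (mob (heckeV p t) x).re :=
  mob_re_pos_of_mem_nonnegMonoid (heckeV_mem_nonnegMonoid hp ht) (heckeV_off_diag_pos hp ht) hx

lemma RightHalf.mob_heckeV (hp : 3 ≤ p) {t : ℕ} (ht : 1 ≤ t ∧ t < p) {x : ℂ}
    (hx : RightHalf x) : RightHalf (mob (heckeV p t) x) :=
  rightHalf_of_re_pos (mob_heckeV_re_pos hp ht hx)

-- Cancelling `U ^ s` would give `-1 / x = mob (V_{t - s}) y`, whose real parts have opposite signs.
lemma mob_heckeV_ne_of_lt (hp : 3 ≤ p) {s t : ℕ} (hs : 1 ≤ s) (hst : s < t) (ht : t < p) {x y : ℂ}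
    (hx : RightHalf x) (hy : RightHalf y) : mob (heckeV p s) x ≠ mob (heckeV p t) y := by
  intro h
  obtain ⟨j, hj, rfl⟩ : ∃ j, 1 ≤ j ∧ t = s + j := ⟨t - s, by omega, by omega⟩
  have hj' : 1 ≤ j ∧ j < p := by omega
  have hTx : mobDen heckeT⁻¹ x ≠ 0 := by rw [mobDen_heckeT_inv]; exact neg_ne_zero.mpr hx.2
  have hVy := mobDen_heckeV_ne hp hj' hy.1
  have hds : mobDen (heckeV p s) x ≠ 0 := mobDen_heckeV_ne hp (by omega) hx.1
  have hdt : mobDen (heckeV p (s + j)) y ≠ 0 := mobDen_heckeV_ne hp (by omega) hy.1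
  rw [← heckeU_pow_mul_heckeV] at h hdt
  rw [heckeV, mobDen_mul _ _ hTx] at hds
  rw [mobDen_mul _ _ hVy] at hdt
  rw [mob_mul _ _ hVy, heckeV, mob_mul _ _ hTx] at h
  have hcancel : mob heckeT⁻¹ x = mob (heckeV p j) y :=
    mob_injective _ (left_ne_zero_of_mul hds) (left_ne_zero_of_mul hdt) h
  have hpos := mob_heckeV_re_pos hp hj' hy
  rw [← hcancel, mob_heckeT_inv, neg_div, one_div, Complex.neg_re, Complex.inv_re] at hpos
  linarith [div_nonneg hx.1 (Complex.normSq_nonneg x)]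

lemma heckeV_unique (hp : 3 ≤ p) {s t : ℕ} (hs : 1 ≤ s ∧ s < p) (ht : 1 ≤ t ∧ t < p)
    {x y : ℂ} (hx : RightHalf x) (hy : RightHalf y)
    (h : mob (heckeV p s) x = mob (heckeV p t) y) : s = t ∧ x = y := by
  rcases lt_trichotomy s t with hst | rfl | hst
  · exact absurd h (mob_heckeV_ne_of_lt hp hs.1 hst ht.2 hx hy)
  · exact ⟨rfl, mob_injective _ (mobDen_heckeV_ne hp hs hx.1) (mobDen_heckeV_ne hp ht hy.1) h⟩
  · exact absurd h.symm (mob_heckeV_ne_of_lt hp ht.1 hst hs.2 hy hx)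

lemma exists_real_of_mob_wordProd_eq (hp : 3 ≤ p) {l : List ℕ} (hl : Admissible p l)
    (hne : l ≠ []) {x : ℂ} (hx : RightHalf x) (h : mob (wordProd p l) x = x) :
    ∃ r : ℝ, 0 < r ∧ x = r := by
  have him := im_eq_zero_of_mob_eq (wordProd_mem_nonnegMonoid hp hl)
    (wordProd_off_diag_pos hp hl hne) hx h
  have hxr : x = (x.re : ℂ) := Complex.ext rfl him
  exact ⟨x.re, rightHalf_ofReal.mp (hxr ▸ hx), hxr⟩

/-! ### Action on the real line -/

lemma mobDen_wordProd_pos (hp : 3 ≤ p) {l : List ℕ} (hl : Admissible p l) {x : ℝ}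
    (hx : 0 ≤ x) : 0 < mobDen (wordProd p l) x :=
  mobDen_pos_of_mem_nonnegMonoid (wordProd_mem_nonnegMonoid hp hl) hx

lemma mob_wordProd_pos (hp : 3 ≤ p) {l : List ℕ} (hl : Admissible p l) {x : ℝ}
    (hx : 0 < x) : 0 < mob (wordProd p l) x :=
  mob_pos_of_mem_nonnegMonoid (wordProd_mem_nonnegMonoid hp hl) hx

lemma mob_wordProd_cons (hp : 3 ≤ p) {t : ℕ} {l : List ℕ} (hl : Admissible p l) {x : ℝ}
    (hx : 0 ≤ x) :
    mob (wordProd p (t :: l)) x = mob (heckeV p t) (mob (wordProd p l) x) := by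
  rw [wordProd_cons, mob_mul _ _ (mobDen_wordProd_pos hp hl hx).ne']

lemma mob_wordProd_append (hp : 3 ≤ p) {l l' : List ℕ} (hl' : Admissible p l') {x : ℝ}
    (hx : 0 ≤ x) :
    mob (wordProd p (l ++ l')) x = mob (wordProd p l) (mob (wordProd p l') x) := by
  rw [wordProd_append, mob_mul _ _ (mobDen_wordProd_pos hp hl' hx).ne']

lemma heckeV_unique_real (hp : 3 ≤ p) {s t : ℕ} (hs : 1 ≤ s ∧ s < p) (ht : 1 ≤ t ∧ t < p)
    {x y : ℝ} (hx : 0 < x) (hy : 0 < y)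
    (h : mob (heckeV p s) x = mob (heckeV p t) y) : s = t ∧ x = y := by
  have hst := heckeV_unique hp hs ht (rightHalf_ofReal.mpr hx) (rightHalf_ofReal.mpr hy)
    (by rw [mob_ofReal, mob_ofReal, h])
  exact ⟨hst.1, by exact_mod_cast hst.2⟩

lemma wordProd_prefix (hp : 3 ≤ p) {l l' : List ℕ} (hl : Admissible p l)
    (hl' : Admissible p l') {x y : ℝ} (hx : 0 < x) (hy : 0 < y)
    (h : mob (wordProd p l) x = mob (wordProd p l') y) (hlen : l.length ≤ l'.length) :
    ∃ r, Admissible p r ∧ l' = l ++ r ∧ x = mob (wordProd p r) y := by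
  induction l generalizing l' with
  | nil => exact ⟨l', hl', rfl, by simpa using h⟩
  | cons t l ih =>
    cases l' with
    | nil => simp at hlen
    | cons s l' =>
      rw [admissible_cons] at hl hl'
      rw [mob_wordProd_cons hp hl.2 hx.le, mob_wordProd_cons hp hl'.2 hy.le] at h
      obtain ⟨rfl, h'⟩ := heckeV_unique_real hp hl.1 hl'.1 (mob_wordProd_pos hp hl.2 hx)
        (mob_wordProd_pos hp hl'.2 hy) h
      obtain ⟨r, hr, rfl, hxy⟩ := ih hl.2 hl'.2 h' (by simpa using hlen)
      exact ⟨r, hr, rfl, hxy⟩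

lemma exists_sinRatio_crossing (hp : 3 ≤ p) {x : ℝ} (hx : 0 ≤ x) :
    ∃ t : ℕ, t + 1 < p ∧ sinRatio p t * x < sinRatio p (t + 1) ∧
      sinRatio p (t + 1 + 1) ≤ sinRatio p (t + 1) * x := by
  obtain ⟨t, hlt, hle⟩ := Nat.exists_not_and_succ_of_not_zero_of_exists
    (p := fun t ↦ p ≤ t + 1 ∨ sinRatio p (t + 1) ≤ sinRatio p t * x)
    (by
      push Not
      exact ⟨by omega, by simp [sinRatio_one hp]⟩)
    ⟨p, Or.inl (Nat.le_succ p)⟩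
  push Not at hlt
  refine ⟨t, hlt.1, hlt.2, ?_⟩
  rcases hle with hle | hle
  · have ht : (t : ℝ) + 1 = p - 1 := by
      rw [eq_sub_iff_add_eq]
      exact_mod_cast (le_antisymm hlt.1 hle : t + 1 + 1 = p)
    rwa [ht, sub_add_cancel, sinRatio_self hp, sinRatio_sub_one hp, one_mul]
  · exact_mod_cast hle

lemma exists_heckeV_preimage (hp : 3 ≤ p) {x : ℝ} (hx : 0 ≤ x) :
    ∃ t, (1 ≤ t ∧ t < p) ∧ ∃ z : ℝ, 0 ≤ z ∧ x = mob (heckeV p t) z := by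
  obtain ⟨t, htp, hlt, hle⟩ := exists_sinRatio_crossing hp hx
  obtain ⟨h00, h01, h10, h11⟩ := heckeV_entries hp (t + 1)
  push_cast at h00 h01 h10 h11
  rw [add_sub_cancel_right] at h10
  have hden : 0 < mobDen (heckeV p (t + 1))⁻¹ x := by
    rw [mobDen_real, inv_one_zero, inv_one_one, h00, h10]
    linarith
  have hnum : 0 ≤ mobNum (heckeV p (t + 1))⁻¹ x := by
    rw [mobNum_real, inv_zero_zero, inv_zero_one, h01, h11]
    linarith
  have hx' := mob_inv_mob _ hden.ne'
  rw [inv_inv] at hx'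
  exact ⟨t + 1, ⟨by omega, htp⟩, _, div_nonneg hnum hden.le, hx'.symm⟩

lemma mobDen_wordProd_inv_ne (hp : 3 ≤ p) {l : List ℕ} (hl : Admissible p l) {x : ℝ}
    (hx : x < 0) : mobDen (wordProd p l)⁻¹ x ≠ 0 :=
  (mobDen_inv_pos_of_mem_nonnegMonoid (wordProd_mem_nonnegMonoid hp hl) hx).ne'

lemma mob_wordProd_inv_neg (hp : 3 ≤ p) {l : List ℕ} (hl : Admissible p l) {x : ℝ}
    (hx : x < 0) : mob (wordProd p l)⁻¹ x < 0 :=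
  mob_inv_neg_of_mem_nonnegMonoid (wordProd_mem_nonnegMonoid hp hl) hx

lemma heckeV_neg_not_lt (hp : 3 ≤ p) {s t : ℕ} (hst : s < t) (ht : t < p) {x : ℝ}
    (h : mob (heckeV p s) x < 0) (h' : mob (heckeV p t) x < 0) : False := by
  obtain ⟨j, hj, rfl⟩ : ∃ j, 1 ≤ j ∧ t = s + j := ⟨t - s, by omega, by omega⟩
  have hd : mobDen (heckeV p s) x ≠ 0 := by
    intro h0
    simp [mob, h0] at h
  have hT : mobDen heckeT (mob (heckeV p s) x) ≠ 0 := by rw [mobDen_heckeT]; exact h.ne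
  have hpos : 0 < mob heckeT (mob (heckeV p s) x) := by
    rw [mob_heckeT]
    exact div_pos_of_neg_of_neg (by norm_num) h
  have hfactor : heckeV p (s + j) = heckeV p j * heckeT * heckeV p s := by
    rw [heckeV, heckeV, heckeV, inv_mul_cancel_right, ← mul_assoc, ← pow_add, add_comm]
  have hpos' := mob_pos_of_mem_nonnegMonoid
    (heckeV_mem_nonnegMonoid hp (t := j) (by omega)) hpos
  rw [← mob_mul _ _ hT, ← mob_mul _ _ hd, ← hfactor] at hpos'
  exact lt_asymm hpos' h'

lemma heckeV_unique_neg (hp : 3 ≤ p) {s t : ℕ} (hs : s < p) (ht : t < p) {x : ℝ}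
    (h : mob (heckeV p s) x < 0) (h' : mob (heckeV p t) x < 0) : s = t := by
  rcases lt_trichotomy s t with hst | hst | hst
  · exact (heckeV_neg_not_lt hp hst ht h h').elim
  · exact hst
  · exact (heckeV_neg_not_lt hp hst hs h' h).elim

end

section

variable {p : ℕ}

/-! ### Elements of the Hecke group in terms of words -/

/-- `M = ± P₁ P₂⁻¹` or `M = ± T P₁ P₂⁻¹` with words `P₁`, `P₂` such that `P₂⁻¹ x` is
nonnegative. Every element of the Hecke group has this form at each `x ≥ 0`; the condition on
`P₂⁻¹ x` is what ties the factorization to the point `x`. -/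
def WordForm (p : ℕ) (x : ℝ) (M : SL(2, ℝ)) : Prop :=
  ∃ l₁ l₂ : List ℕ, ∃ z : ℝ, Admissible p l₁ ∧ Admissible p l₂ ∧ 0 ≤ z ∧
    x = mob (wordProd p l₂) z ∧
    (SignEq M (wordProd p l₁ * (wordProd p l₂)⁻¹) ∨
      SignEq M (heckeT * (wordProd p l₁ * (wordProd p l₂)⁻¹)))

namespace WordForm

lemma one {x : ℝ} (hx : 0 ≤ x) : WordForm p x 1 :=
  ⟨[], [], x, admissible_nil, admissible_nil, hx, by simp, Or.inl (by simpa using .refl 1)⟩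

lemma of_signEq {x : ℝ} {M N : SL(2, ℝ)} (h : WordForm p x M) (hN : SignEq N M) :
    WordForm p x N := by
  obtain ⟨l₁, l₂, z, h₁, h₂, hz, hx, h | h⟩ := h
  · exact ⟨l₁, l₂, z, h₁, h₂, hz, hx, Or.inl (hN.trans h)⟩
  · exact ⟨l₁, l₂, z, h₁, h₂, hz, hx, Or.inr (hN.trans h)⟩

lemma heckeT_mul {x : ℝ} {M : SL(2, ℝ)} (h : WordForm p x M) : WordForm p x (heckeT * M) := by
  obtain ⟨l₁, l₂, z, h₁, h₂, hz, hx, h | h⟩ := h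
  · exact ⟨l₁, l₂, z, h₁, h₂, hz, hx, Or.inr ((SignEq.refl _).mul h)⟩
  · refine ⟨l₁, l₂, z, h₁, h₂, hz, hx, Or.inl (((SignEq.refl _).mul h).trans ?_)⟩
    rw [← mul_assoc, heckeT_mul_self, neg_one_mul]
    exact SignEq.neg_self _

lemma heckeU_mul_of_cons (hp : 3 ≤ p) {x z : ℝ} {M : SL(2, ℝ)} {t : ℕ} {l₁ l₂ : List ℕ}
    (h₁ : Admissible p (t :: l₁)) (h₂ : Admissible p l₂) (hz : 0 ≤ z)
    (hx : x = mob (wordProd p l₂) z)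
    (h : SignEq M (wordProd p (t :: l₁) * (wordProd p l₂)⁻¹)) :
    WordForm p x (heckeU p * M) := by
  rw [admissible_cons] at h₁
  have e : heckeU p * (wordProd p (t :: l₁) * (wordProd p l₂)⁻¹) =
      heckeV p (1 + t) * (wordProd p l₁ * (wordProd p l₂)⁻¹) := by
    rw [← heckeU_pow_mul_heckeV, wordProd_cons, pow_one]
    simp only [mul_assoc]
  have h' := (SignEq.refl (heckeU p)).mul h
  rw [e] at h'
  by_cases ht : 1 + t < p
  · refine ⟨(1 + t) :: l₁, l₂, z, admissible_cons.mpr ⟨⟨by omega, ht⟩, h₁.2⟩, h₂, hz, hx,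
      Or.inl ?_⟩
    rw [wordProd_cons, mul_assoc]; exact h'
  · have ht' : 1 + t = p := by omega
    refine ⟨l₁, l₂, z, h₁.2, h₂, hz, hx, Or.inr ?_⟩
    rwa [ht', heckeV, heckeU_pow_self hp, heckeT_inv, neg_mul_neg, one_mul] at h'

lemma heckeU_mul (hp : 3 ≤ p) {x : ℝ} {M : SL(2, ℝ)} (h : WordForm p x M) :
    WordForm p x (heckeU p * M) := by
  obtain ⟨l₁, l₂, z, h₁, h₂, hz, hx, h | h⟩ := h
  · cases l₁ with
    | cons t l₁ => exact heckeU_mul_of_cons hp h₁ h₂ hz hx h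
    | nil =>
      obtain ⟨t, ht, y, hy, rfl⟩ := exists_heckeV_preimage hp hz
      have hsing := admissible_singleton.mpr ht
      refine heckeU_mul_of_cons hp (l₁ := []) (l₂ := l₂ ++ [t]) (z := y) hsing
        (admissible_append.mpr ⟨h₂, hsing⟩) hy ?_ ?_
      · rw [mob_wordProd_append hp hsing hy, wordProd_singleton, hx]
      · rw [wordProd_append, mul_inv_rev, mul_inv_cancel_left]
        simpa using h
  · refine ⟨1 :: l₁, l₂, z, admissible_cons.mpr ⟨⟨le_rfl, by omega⟩, h₁⟩, h₂, hz, hx,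
      Or.inl (((SignEq.refl _).mul h).trans ?_)⟩
    rw [wordProd_cons, heckeV, heckeT_inv, pow_one, mul_neg, neg_mul, neg_mul]
    simp only [mul_assoc]
    exact (SignEq.neg_self _).symm

lemma heckeU_pow_mul (hp : 3 ≤ p) {x : ℝ} {M : SL(2, ℝ)} (h : WordForm p x M) (n : ℕ) :
    WordForm p x (heckeU p ^ n * M) := by
  induction n with
  | zero => simpa using h
  | succ n ih =>
    rw [pow_succ', mul_assoc]
    exact ih.heckeU_mul hp

end WordForm

lemma heckeU_inv (hp : 3 ≤ p) : (heckeU p)⁻¹ = -heckeU p ^ (p - 1) := by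
  rw [inv_eq_iff_mul_eq_one, mul_neg, ← pow_succ', Nat.sub_add_cancel (by omega),
    heckeU_pow_self hp, neg_neg]

lemma heckeS_eq (p : ℕ) : heckeS p = -(heckeU p * heckeT) := by
  rw [heckeU, mul_assoc, heckeT_mul_self, mul_neg_one, neg_neg]

lemma heckeS_inv (hp : 3 ≤ p) : (heckeS p)⁻¹ = -(heckeT * heckeU p ^ (p - 1)) := by
  rw [heckeS_eq, inv_neg, mul_inv_rev, heckeU_inv hp, heckeT_inv, neg_mul_neg]

lemma wordForm_of_mem (hp : 3 ≤ p) {x : ℝ} (hx : 0 ≤ x) {M : SL(2, ℝ)}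
    (hM : M ∈ heckeGroup p) : WordForm p x M := by
  induction hM using Subgroup.closure_induction_left with
  | one => exact WordForm.one hx
  | mul_left A hA B _ ih =>
    rcases hA with rfl | rfl
    · refine (ih.heckeT_mul.heckeU_mul hp).of_signEq ?_
      rw [heckeS_eq, neg_mul, mul_assoc]
      exact SignEq.neg_self _
    · exact ih.heckeT_mul
  | inv_mul_cancel A hA B _ ih =>
    rcases hA with rfl | rfl
    · refine (ih.heckeU_pow_mul hp (p - 1)).heckeT_mul.of_signEq ?_
      rw [heckeS_inv hp, neg_mul, mul_assoc]
      exact SignEq.neg_self _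
    · refine ih.heckeT_mul.of_signEq ?_
      rw [heckeT_inv, neg_mul]
      exact SignEq.neg_self _

/-! ### Hyperbolic elements and hyperbolic points -/

lemma SignEq.entry_eq_zero {M N : SL(2, ℝ)} (h : SignEq M N) {i j : Fin 2} (h0 : M i j = 0) :
    N i j = 0 := by
  rcases h with rfl | rfl
  · exact h0
  · rwa [neg_entry, neg_eq_zero] at h0

lemma zero_one_eq_zero_of_mob_eq_zero {M : SL(2, ℝ)} (hM : M ∈ nonnegMonoid ℝ) {z : ℝ}
    (hz : 0 ≤ z) (h : mob M z = 0) : M 0 1 = 0 := by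
  have hnum : mobNum M z = 0 :=
    (div_eq_zero_iff.mp h).resolve_right (mobDen_pos_of_mem_nonnegMonoid hM hz).ne'
  obtain ⟨ha, hb, -, -⟩ := hM
  rw [mobNum_real] at hnum
  nlinarith

lemma abs_slTrace_of_zero_one_eq_zero (hp : 3 ≤ p) {M : SL(2, ℝ)} (hM : M ∈ heckeGroup p)
    (h0 : M 0 1 = 0) : |slTrace M| = 2 := by
  obtain ⟨l₁, l₂, z, h₁, h₂, hz, hx, h⟩ := wordForm_of_mem hp le_rfl hM
  have hM₁ := wordProd_mem_nonnegMonoid hp h₁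
  have hM₂ := wordProd_mem_nonnegMonoid hp h₂
  have hb₂ : wordProd p l₂ 0 1 = 0 := zero_one_eq_zero_of_mob_eq_zero hM₂ hz hx.symm
  obtain ⟨ha₂, hd₂⟩ := diag_eq_one hM₂ (by rw [hb₂, zero_mul])
  rcases h with h | h <;> have h01 := h.entry_eq_zero h0
  · rw [mul_zero_one, inv_zero_one, inv_one_one, hb₂, ha₂, neg_zero, mul_zero, zero_add,
      mul_one] at h01
    obtain ⟨ha₁, hd₁⟩ := diag_eq_one hM₁ (by rw [h01, zero_mul])
    rw [h.abs_slTrace, slTrace, mul_zero_zero, mul_one_one, inv_zero_zero, inv_zero_one,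
      inv_one_zero, inv_one_one, ha₁, hd₁, ha₂, hd₂, h01, hb₂]
    norm_num
  · rw [mul_zero_one, mul_zero_one, mul_one_one, inv_zero_one, inv_one_one, hb₂, ha₂] at h01
    simp only [heckeT, Matrix.SpecialLinearGroup.coe_mk, Matrix.of_apply, Matrix.cons_val_zero,
      Matrix.cons_val_one] at h01
    linarith [hM₁.2.2.2]

lemma zero_one_ne_zero (hp : 3 ≤ p) {M : SL(2, ℝ)} (hM : M ∈ heckeGroup p)
    (h : 2 < |slTrace M|) : M 0 1 ≠ 0 := fun h0 ↦
  h.ne' (abs_slTrace_of_zero_one_eq_zero hp hM h0)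

lemma one_zero_ne_zero (hp : 3 ≤ p) {M : SL(2, ℝ)} (hM : M ∈ heckeGroup p)
    (h : 2 < |slTrace M|) : M 1 0 ≠ 0 := by
  intro h0
  refine zero_one_ne_zero hp (mul_mem (mul_mem heckeT_mem hM) (inv_mem heckeT_mem))
    (by rwa [slTrace_conj]) ?_
  simp only [mul_zero_zero, mul_zero_one, inv_zero_one, inv_one_one, h0]
  simp [heckeT]

namespace IsHyperbolicPoint

lemma mobDen_ne (hp : 3 ≤ p) {x : ℝ} (hx : IsHyperbolicPoint p x) {N : SL(2, ℝ)}
    (hN : N ∈ heckeGroup p) : mobDen N x ≠ 0 := by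
  obtain ⟨M, hM, htr, hfix⟩ := hx
  intro h0
  refine one_zero_ne_zero hp (mul_mem (mul_mem hN hM) (inv_mem hN)) (by rwa [slTrace_conj]) ?_
  rw [mobDen_real] at h0
  rw [Fixes] at hfix
  simp only [mul_one_zero, mul_one_one, inv_zero_zero, inv_one_zero]
  have h1 : N 1 1 = -N 1 0 * x := by linarith
  rw [h1]
  linear_combination -N 1 0 ^ 2 * hfix

lemma mob (hp : 3 ≤ p) {x : ℝ} (hx : IsHyperbolicPoint p x) {N : SL(2, ℝ)}
    (hN : N ∈ heckeGroup p) : IsHyperbolicPoint p (mob N x) := by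
  have hd := hx.mobDen_ne hp hN
  obtain ⟨M, hM, htr, hfix⟩ := hx
  exact ⟨_, mul_mem (mul_mem hN hM) (inv_mem hN), by rwa [slTrace_conj], hfix.conj hd⟩

lemma ne_zero (hp : 3 ≤ p) {x : ℝ} (hx : IsHyperbolicPoint p x) : x ≠ 0 := by
  rintro rfl
  obtain ⟨M, hM, htr, hfix⟩ := hx
  exact zero_one_ne_zero hp hM htr (by simpa [Fixes] using hfix)

end IsHyperbolicPoint

end

section

variable {M N : SL(2, ℝ)} {x : ℝ}

lemma two_lt_slTrace_of_mem_nonnegMonoid (hM : M ∈ nonnegMonoid ℝ) (hb : 0 < M 0 1)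
    (hc : 0 < M 1 0) : 2 < slTrace M := by
  obtain ⟨ha, -, -, hd⟩ := hM
  rw [slTrace]
  nlinarith [det_eq M, mul_pos hb hc, sq_nonneg (M 0 0 - M 1 1), add_le_add ha hd]

lemma isAttracting_of_mem_nonnegMonoid (hM : M ∈ nonnegMonoid ℝ) (hc : 0 < M 1 0) (hx : 0 < x)
    (hfix : Fixes M x) : IsAttracting M x :=
  ⟨hfix, lt_of_lt_of_le (by linarith [mul_pos hc hx, hM.2.2.2]) (le_abs_self _)⟩

lemma SignEq.abs_mobDen (h : SignEq M N) (x : ℝ) : |mobDen M x| = |mobDen N x| := by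
  rcases h with rfl | rfl
  · rfl
  · rw [mobDen_neg, abs_neg]

lemma SignEq.mul_comm_of_pow {n : ℕ} (h : SignEq M (N ^ n)) : M * N = N * M := by
  have hcomm := ((Commute.refl N).pow_left n).eq
  rcases h with rfl | rfl
  · exact hcomm
  · rw [neg_mul, mul_neg, hcomm]

lemma SignEq.eq_of_two_lt_slTrace (h : SignEq M N) (hM : 2 < slTrace M) (hN : 2 < slTrace N) :
    M = N := by
  rcases h with h | h
  · exact h
  · rw [h, slTrace_neg] at hM
    linarith

lemma SignEq.conj (h : SignEq M N) (K : SL(2, ℝ)) : SignEq (K * M * K⁻¹) (K * N * K⁻¹) :=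
  ((SignEq.refl K).mul h).mul (SignEq.refl K⁻¹)

lemma Fixes.pow (h : Fixes M x) (n : ℕ) : Fixes (M ^ n) x := (fixer x).pow_mem h n

lemma Fixes.zpow (h : Fixes M x) (j : ℤ) : Fixes (M ^ j) x := (fixer x).zpow_mem h j

lemma fixes_of_commute (hM : Fixes M x) (hc : M 1 0 ≠ 0) (h : M * N = N * M) : Fixes N x := by
  have h00 := congrArg (fun A : SL(2, ℝ) ↦ A 0 0) h
  have h10 := congrArg (fun A : SL(2, ℝ) ↦ A 1 0) h
  simp only [mul_zero_zero, mul_one_zero] at h00 h10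
  rw [Fixes] at hM ⊢
  apply mul_left_cancel₀ hc
  linear_combination N 1 0 * hM + x * h10 - h00

lemma mobDen_pow_of_fixes (hM : Fixes M x) (n : ℕ) : mobDen (M ^ n) x = mobDen M x ^ n := by
  induction n with
  | zero => simp
  | succ n ih => rw [pow_succ, mobDen_mul_of_fixes _ hM, ih, pow_succ]

lemma mobDen_inv_of_fixes (hM : Fixes M x) : mobDen M⁻¹ x = (mobDen M x)⁻¹ := by
  have h := mobDen_inv_mob M hM.mobDen_ne
  rw [hM.mob_eq] at h
  exact eq_inv_of_mul_eq_one_left h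

lemma mobDen_zpow_of_fixes (hM : Fixes M x) (j : ℤ) : mobDen (M ^ j) x = mobDen M x ^ j := by
  cases j with
  | ofNat n => simpa using mobDen_pow_of_fixes hM n
  | negSucc n =>
    rw [zpow_negSucc, mobDen_inv_of_fixes (hM.pow _), mobDen_pow_of_fixes hM, zpow_negSucc]

lemma IsAttracting.one_lt (h : IsAttracting M x) : 1 < |mobDen M x| := h.2

lemma IsAttracting.conj (h : IsAttracting M x) (hN : mobDen N x ≠ 0) :
    IsAttracting (N * M * N⁻¹) (mob N x) := by
  refine ⟨h.1.conj hN, ?_⟩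
  have hden : mobDen (N * M * N⁻¹) (mob N x) = mobDen M x := by
    rw [mobDen_mul _ _ (mobDen_inv_mob_ne N hN), mob_inv_mob _ hN, mobDen_mul_of_fixes _ h.1]
    linear_combination mobDen M x * mobDen_inv_mob N hN
  rw [← mobDen_real, hden]
  exact h.one_lt

end

section

variable {p : ℕ} {x : ℝ} {M N : SL(2, ℝ)}

/-! ### Periodic points -/

/-- The positive numbers fixed by a nonempty admissible word: every hyperbolic point is equivalent
to such a number, and its stabilizer can be read off from the word. -/
def IsPeriodic (p : ℕ) (x : ℝ) : Prop :=
  0 < x ∧ ∃ l, Admissible p l ∧ l ≠ [] ∧ mob (wordProd p l) x = x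

lemma fixes_wordProd (hp : 3 ≤ p) {l : List ℕ} (hl : Admissible p l) (hx : 0 < x)
    (h : mob (wordProd p l) x = x) : Fixes (wordProd p l) x :=
  fixes_of_mob_eq (mobDen_wordProd_pos hp hl hx.le).ne' h

lemma wordProd_off_diag_pos_of_mob_eq (hp : 3 ≤ p) {l : List ℕ} (hl : Admissible p l)
    (hne : l ≠ []) (hx : 0 < x) (h : mob (wordProd p l) x = x) :
    0 < wordProd p l 0 1 ∧ 0 < wordProd p l 1 0 :=
  off_diag_pos_of_fixes (wordProd_mem_nonnegMonoid hp hl) (wordProd_off_diag_pos hp hl hne) hx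
    (fixes_wordProd hp hl hx h)

lemma two_lt_slTrace_wordProd (hp : 3 ≤ p) {l : List ℕ} (hl : Admissible p l) (hne : l ≠ [])
    (hx : 0 < x) (h : mob (wordProd p l) x = x) : 2 < slTrace (wordProd p l) := by
  obtain ⟨hb, hc⟩ := wordProd_off_diag_pos_of_mob_eq hp hl hne hx h
  exact two_lt_slTrace_of_mem_nonnegMonoid (wordProd_mem_nonnegMonoid hp hl) hb hc

lemma isAttracting_wordProd (hp : 3 ≤ p) {l : List ℕ} (hl : Admissible p l) (hne : l ≠ [])
    (hx : 0 < x) (h : mob (wordProd p l) x = x) : IsAttracting (wordProd p l) x :=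
  isAttracting_of_mem_nonnegMonoid (wordProd_mem_nonnegMonoid hp hl)
    (wordProd_off_diag_pos_of_mob_eq hp hl hne hx h).2 hx (fixes_wordProd hp hl hx h)

lemma IsPeriodic.isHyperbolicPoint (hp : 3 ≤ p) (h : IsPeriodic p x) :
    IsHyperbolicPoint p x := by
  obtain ⟨hx, l, hl, hne, h⟩ := h
  exact ⟨_, wordProd_mem l, (two_lt_slTrace_wordProd hp hl hne hx h).trans_le (le_abs_self _),
    fixes_wordProd hp hl hx h⟩

-- The second shape `± T P₁ P₂⁻¹` of a `WordForm` maps `x` to a negative number.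
lemma exists_wordProd_of_pos (hp : 3 ≤ p) (hx : IsHyperbolicPoint p x)
    (h0 : 0 < x) (hM : M ∈ heckeGroup p) (hpos : 0 < mob M x) :
    ∃ l₁ l₂ : List ℕ, ∃ z : ℝ, Admissible p l₁ ∧ Admissible p l₂ ∧ 0 < z ∧
      mob (wordProd p l₁) z = mob M x ∧ mob (wordProd p l₂) z = x ∧
      SignEq M (wordProd p l₁ * (wordProd p l₂)⁻¹) := by
  obtain ⟨l₁, l₂, z, h₁, h₂, hz, hxz, h⟩ := wordForm_of_mem hp h0.le hM
  have hd₂ := (mobDen_wordProd_pos hp h₂ hz).ne'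
  have hz0 : z ≠ 0 := by
    rw [← mob_inv_mob _ hd₂, ← hxz]
    exact (hx.mob hp (inv_mem (wordProd_mem l₂))).ne_zero hp
  have hz' : 0 < z := hz.lt_of_ne' hz0
  have hval : mob (wordProd p l₁ * (wordProd p l₂)⁻¹) x = mob (wordProd p l₁) z := by
    rw [hxz, mob_mul _ _ (mobDen_inv_mob_ne _ hd₂), mob_inv_mob _ hd₂]
  rcases h with h | h
  · exact ⟨l₁, l₂, z, h₁, h₂, hz', by rw [h.mob_eq, hval], hxz.symm, h⟩
  · rw [h.mob_eq, mob_mul _ _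
      (hx.mobDen_ne hp (mul_mem (wordProd_mem _) (inv_mem (wordProd_mem _)))), hval,
      mob_heckeT] at hpos
    linarith [div_neg_of_neg_of_pos neg_one_lt_zero (mob_wordProd_pos hp h₁ hz')]

lemma exists_wordProd_of_fixes (hp : 3 ≤ p) (hx : IsHyperbolicPoint p x)
    (h0 : 0 < x) (hM : M ∈ heckeGroup p) (hfix : Fixes M x) :
    ∃ l₁ l₂ : List ℕ, ∃ z : ℝ, Admissible p l₁ ∧ Admissible p l₂ ∧ 0 < z ∧
      mob (wordProd p l₁) z = x ∧ mob (wordProd p l₂) z = x ∧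
      SignEq M (wordProd p l₁ * (wordProd p l₂)⁻¹) := by
  simpa only [hfix.mob_eq] using exists_wordProd_of_pos hp hx h0 hM (hfix.mob_eq.symm ▸ h0)

lemma isPeriodic_of_mob_append_eq {l r : List ℕ} {z : ℝ} (hr : Admissible p r) (hz : 0 < z)
    (hzr : z = mob (wordProd p r) z)
    (hne : 2 < |slTrace (wordProd p (l ++ r) * (wordProd p l)⁻¹)|) : IsPeriodic p z := by
  refine ⟨hz, r, hr, ?_, hzr.symm⟩
  rintro rfl
  norm_num [slTrace] at hne

lemma exists_periodic_of_pos (hp : 3 ≤ p) (hx : IsHyperbolicPoint p x) (h0 : 0 < x) :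
    ∃ l z, Admissible p l ∧ IsPeriodic p z ∧ x = mob (wordProd p l) z := by
  obtain ⟨M, hM, htr, hfix⟩ := id hx
  obtain ⟨l₁, l₂, z, h₁, h₂, hz, hx₁, hx₂, h⟩ := exists_wordProd_of_fixes hp hx h0 hM hfix
  refine ⟨l₂, z, h₂, ?_, hx₂.symm⟩
  rw [h.abs_slTrace] at htr
  rcases le_total l₁.length l₂.length with hlen | hlen
  · obtain ⟨r, hr, rfl, hzr⟩ := wordProd_prefix hp h₁ h₂ hz hz (hx₁.trans hx₂.symm) hlen
    refine isPeriodic_of_mob_append_eq (l := l₁) hr hz hzr ?_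
    rwa [← slTrace_inv, mul_inv_rev, inv_inv] at htr
  · obtain ⟨r, hr, rfl, hzr⟩ := wordProd_prefix hp h₂ h₁ hz hz (hx₂.trans hx₁.symm) hlen
    exact isPeriodic_of_mob_append_eq hr hz hzr htr

lemma neg_one_div_neg_one_div (x : ℝ) : -1 / (-1 / x) = x := by
  rw [neg_div, neg_div, one_div, one_div, inv_neg, inv_inv, neg_neg]

lemma exists_periodic (hp : 3 ≤ p) (hx : IsHyperbolicPoint p x) :
    ∃ N ∈ heckeGroup p, ∃ z, IsPeriodic p z ∧ x = mob N z := by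
  rcases lt_or_gt_of_ne (hx.ne_zero hp) with h | h
  · have hT := hx.mob hp heckeT_mem
    rw [mob_heckeT] at hT
    obtain ⟨l, z, hl, hz, hxz⟩ := exists_periodic_of_pos hp hT
      (div_pos_of_neg_of_neg (by norm_num) h)
    refine ⟨heckeT * wordProd p l, mul_mem heckeT_mem (wordProd_mem l), z, hz, ?_⟩
    rw [mob_mul _ _ (mobDen_wordProd_pos hp hl hz.1.le).ne', ← hxz, mob_heckeT,
      neg_one_div_neg_one_div]
  · obtain ⟨l, z, -, hz, hxz⟩ := exists_periodic_of_pos hp hx h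
    exact ⟨_, wordProd_mem l, z, hz, hxz⟩

/-! ### Stabilizers -/

lemma wordProd_replicate (l : List ℕ) (n : ℕ) :
    wordProd p (List.replicate n l).flatten = wordProd p l ^ n := by
  induction n with
  | zero => simp
  | succ n ih => rw [List.replicate_succ, List.flatten_cons, wordProd_append, ih, pow_succ']

lemma admissible_replicate {l : List ℕ} (hl : Admissible p l) (n : ℕ) :
    Admissible p (List.replicate n l).flatten := by
  induction n with
  | zero => simpa using admissible_nil
  | succ n ih =>
    rw [List.replicate_succ, List.flatten_cons]
    exact admissible_append.mpr ⟨hl, ih⟩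

lemma exists_shortest_word (hp : 3 ≤ p) (h : IsPeriodic p x) :
    ∃ g, Admissible p g ∧ g ≠ [] ∧ mob (wordProd p g) x = x ∧
      ∀ l, Admissible p l → mob (wordProd p l) x = x →
        ∃ n : ℕ, wordProd p l = wordProd p g ^ n := by
  classical
  obtain ⟨hx, hex⟩ := h
  have hex' : ∃ n : ℕ, ∃ l, Admissible p l ∧ l ≠ [] ∧ mob (wordProd p l) x = x ∧ l.length = n := by
    obtain ⟨l, hl, hne, hfix⟩ := hex
    exact ⟨_, l, hl, hne, hfix, rfl⟩
  obtain ⟨g, hg, hne, hfix, hlen⟩ := Nat.find_spec hex'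
  refine ⟨g, hg, hne, hfix, fun l ↦ ?_⟩
  induction hn : l.length using Nat.strong_induction_on generalizing l with
  | _ n ih =>
    intro hl hlx
    rcases eq_or_ne l [] with rfl | hl0
    · exact ⟨0, by simp⟩
    have hle : g.length ≤ l.length := by
      rw [hlen]
      exact Nat.find_min' hex' ⟨l, hl, hl0, hlx, rfl⟩
    obtain ⟨r, hr, rfl, hxr⟩ := wordProd_prefix hp hg hl hx hx (hfix.trans hlx.symm) hle
    have hgl : 0 < g.length := List.length_pos_iff.mpr hne
    rw [List.length_append] at hn
    obtain ⟨n, hn⟩ := ih r.length (by omega) r rfl hr hxr.symm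
    exact ⟨n + 1, by rw [wordProd_append, hn, pow_succ']⟩

lemma exists_append_eq_replicate (hp : 3 ≤ p) {z : ℝ} {l g : List ℕ} (hl : Admissible p l)
    (hz : 0 < z) (hlz : mob (wordProd p l) z = x) (hx : 0 < x) (hg : Admissible p g) (hne : g ≠ [])
    (hfix : Fixes (wordProd p g) x) :
    ∃ r, Admissible p r ∧ (List.replicate l.length g).flatten = l ++ r ∧
      z = mob (wordProd p r) x := by
  refine wordProd_prefix hp hl (admissible_replicate hg _) hz hx ?_ ?_
  · rw [hlz, wordProd_replicate, (hfix.pow _).mob_eq]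
  · have hpos : 1 ≤ g.length := List.length_pos_iff.mpr hne
    simp only [List.length_flatten, List.map_replicate, List.sum_replicate, smul_eq_mul]
    exact Nat.le_mul_of_pos_right _ hpos

lemma stabilizer_of_periodic (hp : 3 ≤ p) (hx : 0 < x) {g : List ℕ}
    (hg : Admissible p g) (hne : g ≠ []) (hfix : mob (wordProd p g) x = x)
    (hgen : ∀ l, Admissible p l → mob (wordProd p l) x = x →
        ∃ n : ℕ, wordProd p l = wordProd p g ^ n)
    (hM : M ∈ heckeGroup p) (hMx : Fixes M x) :
    ∃ j : ℤ, SignEq M (wordProd p g ^ j) := by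
  have hxh : IsHyperbolicPoint p x := IsPeriodic.isHyperbolicPoint hp ⟨hx, g, hg, hne, hfix⟩
  have hgx : Fixes (wordProd p g) x := fixes_wordProd hp hg hx hfix
  obtain ⟨l₁, l₂, z, h₁, h₂, hz, hx₁, hx₂, h⟩ := exists_wordProd_of_fixes hp hxh hx hM hMx
  obtain ⟨r, hr, hrep, hzr⟩ := exists_append_eq_replicate hp h₂ hz hx₂ hx hg hne hgx
  obtain ⟨n, hn⟩ := hgen (l₁ ++ r) (admissible_append.mpr ⟨h₁, hr⟩) (by
    rw [mob_wordProd_append hp hr hx.le, ← hzr, hx₁])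
  have hpow : wordProd p l₂ * wordProd p r = wordProd p g ^ l₂.length := by
    rw [← wordProd_append, ← hrep, wordProd_replicate]
  refine ⟨n - l₂.length, h.trans (Or.inl ?_)⟩
  rw [wordProd_append] at hn
  rw [zpow_sub, zpow_natCast, zpow_natCast, ← hn, ← hpow]
  group

/-! ### Generators of stabilizers -/

lemma isPrimitiveElt_iff :
    IsPrimitiveElt p M ↔ ∀ N ∈ heckeGroup p, ∀ n : ℕ, 2 ≤ n → ¬SignEq M (N ^ n) := by
  simp only [IsPrimitiveElt, SignEq, not_or, ne_eq]

lemma isPrimitiveElt_of_stabilizer (hM : IsAttracting M x) (hc : M 1 0 ≠ 0)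
    (hstab : ∀ N ∈ heckeGroup p, Fixes N x → ∃ j : ℤ, SignEq N (M ^ j)) :
    IsPrimitiveElt p M := by
  rw [isPrimitiveElt_iff]
  intro N hN n hn hs
  obtain ⟨j, hj⟩ := hstab N hN (fixes_of_commute hM.1 hc hs.mul_comm_of_pow)
  have hNx : Fixes N x := hj.fixes (hM.1.zpow j)
  have hden := hs.abs_mobDen x
  rw [mobDen_pow_of_fixes hNx, abs_pow, hj.abs_mobDen, mobDen_zpow_of_fixes hM.1,
    abs_zpow, ← zpow_natCast, ← zpow_mul] at hden
  have hexp : (1 : ℤ) = j * n :=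
    zpow_right_injective₀ (zero_lt_one.trans hM.one_lt) hM.one_lt.ne' (by simpa using hden)
  have := Int.le_of_dvd one_pos (Dvd.intro_left j hexp.symm)
  omega

lemma IsPrimitiveElt.conj (h : IsPrimitiveElt p M) (hN : N ∈ heckeGroup p) :
    IsPrimitiveElt p (N * M * N⁻¹) := by
  rw [isPrimitiveElt_iff] at h ⊢
  intro K hK n hn hs
  refine h (N⁻¹ * K * N) (mul_mem (mul_mem (inv_mem hN) hK) hN) n hn ?_
  have hpow : (N⁻¹ * K * N) ^ n = N⁻¹ * K ^ n * N := by
    simpa only [inv_inv] using conj_pow (i := n) (a := N⁻¹) (b := K)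
  have hconj := hs.conj N⁻¹
  rw [inv_inv] at hconj
  rw [hpow]
  convert hconj using 1
  group

lemma IsGeneratorAt.isHyperbolicPoint (h : IsGeneratorAt p x M) : IsHyperbolicPoint p x :=
  ⟨M, h.1, h.2.1.trans_le (le_abs_self _), h.2.2.2.1⟩

lemma IsGeneratorAt.conj (hp : 3 ≤ p) (h : IsGeneratorAt p x M) (hN : N ∈ heckeGroup p) :
    IsGeneratorAt p (mob N x) (N * M * N⁻¹) :=
  ⟨mul_mem (mul_mem hN h.1) (inv_mem hN), by rw [slTrace_conj]; exact h.2.1,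
    h.2.2.1.conj hN, h.2.2.2.conj (h.isHyperbolicPoint.mobDen_ne hp hN)⟩

lemma IsGeneratorAt.eq_of_stabilizer (hM : IsGeneratorAt p x M) (hN : IsGeneratorAt p x N)
    (hstab : ∀ K ∈ heckeGroup p, Fixes K x → ∃ j : ℤ, SignEq K (M ^ j)) : N = M := by
  obtain ⟨hMmem, hMtr, -, hM⟩ := hM
  obtain ⟨hNmem, hNtr, hprim, hN⟩ := hN
  obtain ⟨j, hj⟩ := hstab N hNmem hN.1
  have hpos : 0 < j := by
    by_contra! hle
    have hlt := hN.one_lt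
    rw [hj.abs_mobDen, mobDen_zpow_of_fixes hM.1, abs_zpow] at hlt
    exact absurd (zpow_le_one_of_nonpos₀ hM.one_lt.le hle) (not_le.mpr hlt)
  obtain ⟨n, rfl⟩ := Int.eq_ofNat_of_zero_le hpos.le
  rw [zpow_natCast] at hj
  have hn : ¬2 ≤ n := fun hn ↦ isPrimitiveElt_iff.mp hprim M hMmem n hn hj
  obtain rfl : n = 1 := by omega
  rw [pow_one] at hj
  exact hj.eq_of_two_lt_slTrace hNtr hMtr

lemma exists_generator_of_periodic (hp : 3 ≤ p) (h : IsPeriodic p x) :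
    ∃ l, Admissible p l ∧ l ≠ [] ∧ IsGeneratorAt p x (wordProd p l) ∧
      ∀ N ∈ heckeGroup p, Fixes N x → ∃ j : ℤ, SignEq N (wordProd p l ^ j) := by
  obtain ⟨g, hg, hne, hfix, hgen⟩ := exists_shortest_word hp h
  have hatt := isAttracting_wordProd hp hg hne h.1 hfix
  have hstab : ∀ N ∈ heckeGroup p, Fixes N x → ∃ j : ℤ, SignEq N (wordProd p g ^ j) :=
    fun N hN hNx ↦ stabilizer_of_periodic hp h.1 hg hne hfix hgen hN hNx
  have hc := (wordProd_off_diag_pos_of_mob_eq hp hg hne h.1 hfix).2.ne'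
  exact ⟨g, hg, hne, ⟨wordProd_mem g, two_lt_slTrace_wordProd hp hg hne h.1 hfix,
    isPrimitiveElt_of_stabilizer hatt hc hstab, hatt⟩, hstab⟩

lemma generator_unique (hp : 3 ≤ p) {M' : SL(2, ℝ)} (h : IsGeneratorAt p x M)
    (h' : IsGeneratorAt p x M') : M = M' := by
  obtain ⟨N, hN, z, hz, rfl⟩ := exists_periodic hp h.isHyperbolicPoint
  have hd := (hz.isHyperbolicPoint hp).mobDen_ne hp hN
  obtain ⟨l, -, -, hgen, hstab⟩ := exists_generator_of_periodic hp hz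
  have hM := h.conj hp (inv_mem hN)
  have hM' := h'.conj hp (inv_mem hN)
  rw [mob_inv_mob _ hd] at hM hM'
  exact mul_left_cancel (mul_right_cancel
    ((hgen.eq_of_stabilizer hM hstab).trans (hgen.eq_of_stabilizer hM' hstab).symm))

lemma hyperbolicElt_spec (hp : 3 ≤ p) (hx : IsHyperbolicPoint p x) :
    IsGeneratorAt p x (hyperbolicElt p x) := by
  have hex : ∃ M, IsGeneratorAt p x M := by
    obtain ⟨N, hN, z, hz, rfl⟩ := exists_periodic hp hx
    obtain ⟨l, -, -, hgen, -⟩ := exists_generator_of_periodic hp hz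
    exact ⟨_, hgen.conj hp hN⟩
  rw [hyperbolicElt, dif_pos hex]
  exact hex.choose_spec

lemma IsGeneratorAt.eq_hyperbolicElt (hp : 3 ≤ p) (h : IsGeneratorAt p x M) :
    hyperbolicElt p x = M :=
  generator_unique hp (hyperbolicElt_spec hp h.isHyperbolicPoint) h

lemma hyperbolicElt_mob (hp : 3 ≤ p) (hx : IsHyperbolicPoint p x) (hN : N ∈ heckeGroup p) :
    hyperbolicElt p (mob N x) = N * hyperbolicElt p x * N⁻¹ :=
  ((hyperbolicElt_spec hp hx).conj hp hN).eq_hyperbolicElt hp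

lemma stabilizer_hyperbolic (hp : 3 ≤ p) (hx : IsHyperbolicPoint p x)
    (hN : N ∈ heckeGroup p) (hNx : Fixes N x) : ∃ j : ℤ, SignEq N (hyperbolicElt p x ^ j) := by
  obtain ⟨K, hK, z, hz, rfl⟩ := exists_periodic hp hx
  have hzh := hz.isHyperbolicPoint hp
  have hd := hzh.mobDen_ne hp hK
  obtain ⟨l, -, -, hgen, hstab⟩ := exists_generator_of_periodic hp hz
  have hfix := hNx.conj (N := K⁻¹) (mobDen_inv_mob_ne _ hd)
  rw [mob_inv_mob _ hd] at hfix
  obtain ⟨j, hj⟩ := hstab _ (mul_mem (mul_mem (inv_mem hK) hN) (inv_mem (inv_mem hK))) hfix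
  refine ⟨j, ?_⟩
  rw [hyperbolicElt_mob hp hzh hK, hgen.eq_hyperbolicElt hp, conj_zpow]
  convert hj.conj K using 1
  group

end

/-! ### Forms -/

namespace BQF

lemma act_mul (Q : BQF) (M N : SL(2, ℝ)) : Q.act (M * N) = (Q.act M).act N := by
  ext <;> simp only [act, mul_zero_zero, mul_zero_one, mul_one_zero, mul_one_one] <;> ring

@[simp] lemma act_one (Q : BQF) : Q.act 1 = Q := by
  ext <;> simp [act]

@[simp] lemma act_neg (Q : BQF) (M : SL(2, ℝ)) : Q.act (-M) = Q.act M := by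
  ext <;> simp only [act, neg_entry] <;> ring

lemma neg_act (Q : BQF) (M : SL(2, ℝ)) : Q.neg.act M = (Q.act M).neg := by
  ext <;> simp only [act, neg] <;> ring

@[simp] lemma neg_neg (Q : BQF) : Q.neg.neg = Q := by
  ext <;> simp [neg]

lemma act_inv_act (Q : BQF) (M : SL(2, ℝ)) : (Q.act M⁻¹).act M = Q := by
  rw [← act_mul, inv_mul_cancel, act_one]

lemma ofMatrix_conj (M N : SL(2, ℝ)) :
    ofMatrix (N * M * N⁻¹) = (ofMatrix M).act N⁻¹ := by
  ext <;> simp only [ofMatrix, act, mul_zero_zero, mul_zero_one, mul_one_zero, mul_one_one,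
    inv_zero_zero, inv_zero_one, inv_one_zero, inv_one_one] <;> ring

lemma ofMatrix_inv (M : SL(2, ℝ)) : ofMatrix M⁻¹ = (ofMatrix M).neg := by
  ext <;> simp only [ofMatrix, neg, inv_zero_zero, inv_zero_one, inv_one_zero, inv_one_one]
  ring

lemma disc_ofMatrix (M : SL(2, ℝ)) : (ofMatrix M).disc = slTrace M ^ 2 - 4 := by
  simp only [disc, ofMatrix, slTrace]
  linear_combination -4 * det_eq M

lemma eq_of_ofMatrix_eq {M N : SL(2, ℝ)} (h : ofMatrix M = ofMatrix N) (hM : 0 ≤ slTrace M)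
    (hN : 0 ≤ slTrace N) : M = N := by
  have ht : slTrace M = slTrace N := by
    have hdisc := congrArg disc h
    rw [disc_ofMatrix, disc_ofMatrix, sub_left_inj, sq_eq_sq₀ hM hN] at hdisc
    exact hdisc
  have hA := congrArg BQF.A h
  have hB := congrArg BQF.B h
  have hC := congrArg BQF.C h
  simp only [ofMatrix, slTrace] at hA hB hC ht
  apply ext_entries <;> linarith

end BQF

section

variable {p : ℕ} {x y : ℝ} {M : SL(2, ℝ)}

lemma heckeGroup_le_range_map_adjoin (p : ℕ) :
    heckeGroup p ≤ (Matrix.SpecialLinearGroup.map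
      (algebraMap (Algebra.adjoin ℤ {heckeLambda p}) ℝ)).range := by
  rw [heckeGroup, Subgroup.closure_le]
  rintro _ (rfl | rfl)
  · exact ⟨⟨!![1, ⟨heckeLambda p, Algebra.self_mem_adjoin_singleton ℤ _⟩; 0, 1],
      by simp [Matrix.det_fin_two]⟩, ext_entries rfl rfl rfl rfl⟩
  · exact ⟨⟨!![0, -1; 1, 0], by simp [Matrix.det_fin_two]⟩, ext_entries rfl rfl rfl rfl⟩

lemma entry_mem_adjoin (hM : M ∈ heckeGroup p) (i j : Fin 2) :
    M i j ∈ Algebra.adjoin ℤ {heckeLambda p} := by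
  obtain ⟨N, rfl⟩ := heckeGroup_le_range_map_adjoin p hM
  exact (N i j).2

lemma isLambda_hyperbolicForm (hp : 3 ≤ p) (hx : IsHyperbolicPoint p x) :
    (hyperbolicForm p x).IsLambda p := by
  have hg := hyperbolicElt_spec hp hx
  have hmem := entry_mem_adjoin hg.1
  refine ⟨hmem 1 0, sub_mem (hmem 1 1) (hmem 0 0), neg_mem (hmem 0 1), ?_⟩
  rw [hyperbolicForm, BQF.disc_ofMatrix]
  nlinarith [hg.2.1]

lemma hyperbolicForm_mob (hp : 3 ≤ p) (hx : IsHyperbolicPoint p x) (hM : M ∈ heckeGroup p) :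
    hyperbolicForm p (mob M x) = (hyperbolicForm p x).act M⁻¹ := by
  rw [hyperbolicForm, hyperbolicElt_mob hp hx hM, BQF.ofMatrix_conj, hyperbolicForm]

/-! ### Hecke conjugation -/

lemma Fixes.mobDen_mul_slTrace_sub (h : Fixes M x) :
    mobDen M x * (slTrace M - mobDen M x) = 1 := by
  rw [Fixes] at h
  rw [mobDen_real, slTrace]
  linear_combination det_eq M + M 1 0 * h

lemma IsGeneratorAt.one_lt_mobDen (h : IsGeneratorAt p x M) : 1 < mobDen M x := by
  have hprod := h.2.2.2.1.mobDen_mul_slTrace_sub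
  rcases lt_abs.mp h.2.2.2.one_lt with hpos | hneg
  · exact hpos
  · nlinarith [h.2.1]

lemma IsGeneratorAt.one_zero_ne_zero (hp : 3 ≤ p) (h : IsGeneratorAt p x M) : M 1 0 ≠ 0 :=
  _root_.one_zero_ne_zero hp h.1 (h.2.1.trans_le (le_abs_self _))

lemma IsPrimitiveElt.inv (h : IsPrimitiveElt p M) : IsPrimitiveElt p M⁻¹ := by
  rw [isPrimitiveElt_iff] at h ⊢
  intro N hN n hn hs
  refine h N⁻¹ (inv_mem hN) n hn ?_
  simpa only [SignEq, inv_pow, inv_eq_iff_eq_inv, inv_neg] using hs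

/-- The Hecke-conjugate `x'` of a hyperbolic point `x`, read off from the sum `(a - d) / c` of the
two fixed points of `M_x = (a b; c d)`. -/
def heckeConj (p : ℕ) (x : ℝ) : ℝ :=
  (hyperbolicElt p x 0 0 - hyperbolicElt p x 1 1) / hyperbolicElt p x 1 0 - x

section Conj

variable (hp : 3 ≤ p) (hx : IsHyperbolicPoint p x)
include hp hx

lemma hyperbolicElt_one_zero_ne_zero : hyperbolicElt p x 1 0 ≠ 0 :=
  (hyperbolicElt_spec hp hx).one_zero_ne_zero hp

lemma one_zero_mul_heckeConj_add : hyperbolicElt p x 1 0 * (heckeConj p x + x) =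
    hyperbolicElt p x 0 0 - hyperbolicElt p x 1 1 := by
  rw [heckeConj, sub_add_cancel, mul_div_cancel₀ _ (hyperbolicElt_one_zero_ne_zero hp hx)]

lemma one_zero_mul_heckeConj_mul :
    hyperbolicElt p x 1 0 * (x * heckeConj p x) = -hyperbolicElt p x 0 1 := by
  have hfix := (hyperbolicElt_spec hp hx).2.2.2.1
  rw [Fixes] at hfix
  linear_combination hfix + x * one_zero_mul_heckeConj_add hp hx

lemma mobDen_heckeConj : mobDen (hyperbolicElt p x) (heckeConj p x) =
    slTrace (hyperbolicElt p x) - mobDen (hyperbolicElt p x) x := by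
  rw [mobDen_real, mobDen_real, slTrace]
  linear_combination one_zero_mul_heckeConj_add hp hx

lemma fixes_heckeConj : Fixes (hyperbolicElt p x) (heckeConj p x) := by
  rw [Fixes]
  linear_combination -heckeConj p x * one_zero_mul_heckeConj_add hp hx +
    one_zero_mul_heckeConj_mul hp hx

lemma eq_heckeConj_of_fixes (hne : y ≠ x) (hy : Fixes (hyperbolicElt p x) y) :
    y = heckeConj p x := by
  have hfix := (hyperbolicElt_spec hp hx).2.2.2.1
  rw [Fixes] at hfix hy
  have hroots : (y - x) * (hyperbolicElt p x 1 0 * (y - heckeConj p x)) = 0 := by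
    linear_combination hfix - hy - (y - x) * one_zero_mul_heckeConj_add hp hx
  rw [mul_eq_zero, mul_eq_zero, sub_eq_zero, sub_eq_zero] at hroots
  exact (hroots.resolve_left hne).resolve_left (hyperbolicElt_one_zero_ne_zero hp hx)

-- With `μ = c x + d > 1` and `c x' + d = 1 / μ`, this is `μ - 1 / μ`.
lemma one_zero_mul_sub_heckeConj_pos : 0 < hyperbolicElt p x 1 0 * (x - heckeConj p x) := by
  have hg := hyperbolicElt_spec hp hx
  have hprod := hg.2.2.2.1.mobDen_mul_slTrace_sub
  have hsub : hyperbolicElt p x 1 0 * (x - heckeConj p x) =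
      mobDen (hyperbolicElt p x) x - mobDen (hyperbolicElt p x) (heckeConj p x) := by
    rw [mobDen_real, mobDen_real]
    ring
  rw [hsub, mobDen_heckeConj hp hx]
  nlinarith [hg.one_lt_mobDen]

lemma heckeConj_ne : heckeConj p x ≠ x := by
  intro h
  have hpos := one_zero_mul_sub_heckeConj_pos hp hx
  rw [h, sub_self, mul_zero] at hpos
  exact hpos.false

lemma isGeneratorAt_heckeConj : IsGeneratorAt p (heckeConj p x) (hyperbolicElt p x)⁻¹ := by
  have hg := hyperbolicElt_spec hp hx
  refine ⟨inv_mem hg.1, hg.2.1.trans_eq (slTrace_inv _).symm, hg.2.2.1.inv,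
    (fixer _).inv_mem (fixes_heckeConj hp hx), ?_⟩
  rw [← mobDen_real, mobDen_inv_of_fixes (fixes_heckeConj hp hx), mobDen_heckeConj hp hx,
    ← eq_inv_of_mul_eq_one_left hg.2.2.2.1.mobDen_mul_slTrace_sub]
  exact hg.2.2.2.one_lt

lemma IsHyperbolicPoint.heckeConj : IsHyperbolicPoint p (heckeConj p x) :=
  (isGeneratorAt_heckeConj hp hx).isHyperbolicPoint

lemma hyperbolicElt_heckeConj : hyperbolicElt p (heckeConj p x) = (hyperbolicElt p x)⁻¹ :=
  (isGeneratorAt_heckeConj hp hx).eq_hyperbolicElt hp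

lemma hyperbolicForm_heckeConj : hyperbolicForm p (heckeConj p x) = (hyperbolicForm p x).neg := by
  rw [hyperbolicForm, hyperbolicElt_heckeConj hp hx, BQF.ofMatrix_inv, hyperbolicForm]

lemma heckeConj_heckeConj : heckeConj p (heckeConj p x) = x := by
  symm
  refine eq_heckeConj_of_fixes hp (hx.heckeConj hp) (heckeConj_ne hp hx).symm ?_
  rw [hyperbolicElt_heckeConj hp hx]
  exact (fixer _).inv_mem (hyperbolicElt_spec hp hx).2.2.2.1

lemma heckeConj_mob (hM : M ∈ heckeGroup p) : heckeConj p (mob M x) = mob M (heckeConj p x) := by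
  symm
  have hd := (hx.heckeConj hp).mobDen_ne hp hM
  refine eq_heckeConj_of_fixes hp (hx.mob hp hM) ?_ ?_
  · exact fun h ↦ heckeConj_ne hp hx (mob_injective M hd (hx.mobDen_ne hp hM) h)
  · rw [hyperbolicElt_mob hp hx hM]
    exact (fixes_heckeConj hp hx).conj hd

lemma eq_of_hyperbolicForm_eq (hy : IsHyperbolicPoint p y)
    (h : hyperbolicForm p x = hyperbolicForm p y) : x = y := by
  have hgx := hyperbolicElt_spec hp hx
  have hgy := hyperbolicElt_spec hp hy
  have hM : hyperbolicElt p x = hyperbolicElt p y :=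
    BQF.eq_of_ofMatrix_eq h (zero_le_two.trans hgx.2.1.le) (zero_le_two.trans hgy.2.1.le)
  by_contra hne
  have hconj : y = heckeConj p x := eq_heckeConj_of_fixes hp hx (Ne.symm hne) (hM ▸ hgy.2.2.2.1)
  have hxpos := one_zero_mul_sub_heckeConj_pos hp hx
  have hypos := one_zero_mul_sub_heckeConj_pos hp hy
  rw [← hM, hconj, heckeConj_heckeConj hp hx] at hypos
  linarith

end Conj

lemma isHeckeConj_iff (hp : 3 ≤ p) :
    IsHeckeConj p x y ↔ IsHyperbolicPoint p x ∧ y = heckeConj p x := by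
  constructor
  · rintro ⟨hx, hne, h⟩
    have hg := hyperbolicElt_spec hp hx
    exact ⟨hx, eq_heckeConj_of_fixes hp hx hne (h _ hg.1 hg.2.2.2.1)⟩
  · rintro ⟨hx, rfl⟩
    refine ⟨hx, heckeConj_ne hp hx, fun M hM hMx ↦ ?_⟩
    obtain ⟨j, hj⟩ := stabilizer_hyperbolic hp hx hM hMx
    exact hj.fixes ((fixes_heckeConj hp hx).zpow j)

/-! ### Simple points -/

/-- A hyperbolic point whose form `[A, B, C]` satisfies `A > 0 > C`; `Z_𝒜` consists of the simple
points with form in `𝒜`. -/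
def IsSimple (p : ℕ) (x : ℝ) : Prop :=
  IsHyperbolicPoint p x ∧ 0 < (hyperbolicForm p x).A ∧ (hyperbolicForm p x).C < 0

lemma mem_simpleNumbers {𝒜 : Set BQF} :
    x ∈ simpleNumbers p 𝒜 ↔ IsSimple p x ∧ hyperbolicForm p x ∈ 𝒜 := by
  simp only [simpleNumbers, IsSimple, Set.mem_ofPred_eq]
  tauto

lemma pos_and_mul_mul_neg_iff {K : Type*} [CommRing K] [LinearOrder K] [IsStrictOrderedRing K]
    {a x y : K} (h : 0 < a * (x - y)) : 0 < a ∧ a * (x * y) < 0 ↔ 0 < x ∧ y < 0 := by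
  constructor
  · rintro ⟨ha, hxy⟩
    have hlt : y < x := sub_pos.mp ((pos_iff_pos_of_mul_pos h).mp ha)
    rcases mul_neg_iff.mp ((pos_iff_neg_of_mul_neg hxy).mp ha) with h | h
    · exact h
    · exact absurd (h.1.trans h.2) hlt.not_gt
  · rintro ⟨hx, hy⟩
    have ha : 0 < a := (pos_iff_pos_of_mul_pos h).mpr (sub_pos.mpr (hy.trans hx))
    exact ⟨ha, mul_neg_of_pos_of_neg ha (mul_neg_of_pos_of_neg hx hy)⟩

lemma isSimple_iff (hp : 3 ≤ p) :
    IsSimple p x ↔ IsHyperbolicPoint p x ∧ 0 < x ∧ heckeConj p x < 0 := by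
  refine and_congr_right fun hx ↦ ?_
  rw [hyperbolicForm, BQF.ofMatrix, ← one_zero_mul_heckeConj_mul hp hx]
  exact pos_and_mul_mul_neg_iff (one_zero_mul_sub_heckeConj_pos hp hx)

lemma IsSimple.pos (hp : 3 ≤ p) (h : IsSimple p x) : 0 < x := ((isSimple_iff hp).mp h).2.1

lemma IsSimple.heckeConj_neg (hp : 3 ≤ p) (h : IsSimple p x) : heckeConj p x < 0 :=
  ((isSimple_iff hp).mp h).2.2

lemma IsPeriodic.isSimple (hp : 3 ≤ p) (h : IsPeriodic p x) : IsSimple p x := by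
  obtain ⟨l, hl, hne, hgen, -⟩ := exists_generator_of_periodic hp h
  obtain ⟨hb, hc⟩ := wordProd_off_diag_pos_of_mob_eq hp hl hne h.1 hgen.2.2.2.1.mob_eq
  refine ⟨h.isHyperbolicPoint hp, ?_⟩
  rw [hyperbolicForm, hgen.eq_hyperbolicElt hp]
  exact ⟨hc, neg_neg_iff_pos.mpr hb⟩

lemma mobDen_ne_of_mob_neg (h : mob M x < 0) : mobDen M x ≠ 0 := by
  intro h0
  rw [mob, h0, div_zero] at h
  exact h.false

lemma mob_heckeV_neg_of_append (hp : 3 ≤ p) {l : List ℕ} {t : ℕ} (hl : Admissible p l)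
    (h : mob (wordProd p (l ++ [t])) x < 0) : mob (heckeV p t) x < 0 := by
  have hword : heckeV p t = (wordProd p l)⁻¹ * wordProd p (l ++ [t]) := by
    rw [wordProd_append, inv_mul_cancel_left, wordProd_singleton]
  rw [hword, mob_mul _ _ (mobDen_ne_of_mob_neg h)]
  exact mob_wordProd_inv_neg hp hl h

lemma wordProd_mul_inv_reduce (hp : 3 ≤ p) {l₁ l₂ : List ℕ} (h₁ : Admissible p l₁)
    (h₂ : Admissible p l₂) {z : ℝ} (hz₁ : mob (wordProd p l₁) z < 0)
    (hz₂ : mob (wordProd p l₂) z < 0) :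
    ∃ l, Admissible p l ∧ (wordProd p l₁ * (wordProd p l₂)⁻¹ = wordProd p l ∨
      wordProd p l₁ * (wordProd p l₂)⁻¹ = (wordProd p l)⁻¹) := by
  induction l₁ using List.reverseRecOn generalizing l₂ z with
  | nil => exact ⟨l₂, h₂, Or.inr (by simp)⟩
  | append_singleton l₁ r ih =>
    rcases List.eq_nil_or_concat l₂ with rfl | ⟨l₂, s, rfl⟩
    · exact ⟨_, h₁, Or.inl (by simp)⟩
    · rw [List.concat_eq_append] at h₂ hz₂ ⊢
      rw [admissible_append, admissible_singleton] at h₁ h₂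
      have hr := mob_heckeV_neg_of_append hp h₁.1 hz₁
      have hs := mob_heckeV_neg_of_append hp h₂.1 hz₂
      obtain rfl := heckeV_unique_neg hp h₁.2.2 h₂.2.2 hr hs
      have hd := mobDen_ne_of_mob_neg hr
      rw [wordProd_append, wordProd_singleton, mob_mul _ _ hd] at hz₁ hz₂
      rw [wordProd_append, wordProd_append, mul_inv_rev, mul_assoc, mul_inv_cancel_left]
      exact ih h₁.1 h₂.1 hz₁ hz₂

lemma signEq_wordProd_or_inv (hp : 3 ≤ p) (hM : M ∈ heckeGroup p) {x' : ℝ}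
    (hxh : IsHyperbolicPoint p x) (hx : 0 < x) (hx' : x' < 0) (hy : 0 < mob M x)
    (hy' : mob M x' < 0) :
    ∃ l, Admissible p l ∧ (SignEq M (wordProd p l) ∨ SignEq M (wordProd p l)⁻¹) := by
  obtain ⟨l₁, l₂, z, h₁, h₂, -, -, -, h⟩ := exists_wordProd_of_pos hp hxh hx hM hy
  have hd := mobDen_wordProd_inv_ne hp h₂ hx'
  have hback : mob (wordProd p l₂) (mob (wordProd p l₂)⁻¹ x') < 0 := by
    rwa [← mob_mul _ _ hd, mul_inv_cancel, mob_one]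
  rw [h.mob_eq, mob_mul _ _ hd] at hy'
  obtain ⟨l, hl, hl'⟩ := wordProd_mul_inv_reduce hp h₁ h₂ hy' hback
  refine ⟨l, hl, ?_⟩
  rcases hl' with hl' | hl' <;> rw [hl'] at h
  exacts [Or.inl h, Or.inr h]

lemma slTrace_one : slTrace 1 = 2 := by norm_num [slTrace]

lemma IsSimple.isPeriodic (hp : 3 ≤ p) (h : IsSimple p x) : IsPeriodic p x := by
  have hg := hyperbolicElt_spec hp h.1
  have hfix := hg.2.2.2.1
  obtain ⟨l, hl, hl'⟩ := signEq_wordProd_or_inv hp hg.1 h.1 (h.pos hp) (h.heckeConj_neg hp)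
    (hfix.mob_eq.symm ▸ h.pos hp) ((fixes_heckeConj hp h.1).mob_eq.symm ▸ h.heckeConj_neg hp)
  refine ⟨h.pos hp, l, hl, ?_, Fixes.mob_eq ?_⟩
  · rintro rfl
    have htr : slTrace (hyperbolicElt p x) ≤ 2 := by
      rw [wordProd_nil, inv_one, or_self] at hl'
      exact (le_abs_self _).trans (by rw [hl'.abs_slTrace, slTrace_one, abs_two])
    exact htr.not_gt hg.2.1
  · rcases hl' with h' | h'
    · exact h'.symm.fixes hfix
    · exact inv_inv (wordProd p l) ▸ (fixer x).inv_mem (h'.symm.fixes hfix)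

lemma IsSimple.exists_word (hp : 3 ≤ p) (hx : IsSimple p x) (hM : M ∈ heckeGroup p)
    (hy : IsSimple p (mob M x)) : ∃ l, Admissible p l ∧ x = mob (wordProd p l) (mob M x) := by
  obtain ⟨l, hl, h⟩ := signEq_wordProd_or_inv hp hM hx.1 (hx.pos hp) (hx.heckeConj_neg hp)
    (hy.pos hp) (heckeConj_mob hp hx.1 hM ▸ hy.heckeConj_neg hp)
  rcases h with h | h
  · obtain ⟨hy0, g, hg, hne, hfix⟩ := hy.isPeriodic hp
    obtain ⟨r, hr, -, hxr⟩ := exists_append_eq_replicate hp hl (hx.pos hp) (h.mob_eq x).symm hy0 hg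
      hne (fixes_wordProd hp hg hy0 hfix)
    exact ⟨r, hr, hxr⟩
  · refine ⟨l, hl, ?_⟩
    rw [h.mob_eq, ← mob_mul _ _ (hx.1.mobDen_ne hp (inv_mem (wordProd_mem l))), mul_inv_cancel,
      mob_one]

lemma IsSimple.exists_next (hp : 3 ≤ p) (hx : IsSimple p x) :
    ∃ t, (1 ≤ t ∧ t < p) ∧ IsSimple p (mob (heckeV p t) x) := by
  obtain ⟨h0, l, hl, hne, hfix⟩ := hx.isPeriodic hp
  obtain ⟨l, t, rfl⟩ := (List.eq_nil_or_concat l).resolve_left hne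
  rw [List.concat_eq_append] at hl hfix
  obtain ⟨hl, ht⟩ := admissible_append.mp hl
  have hpos := mob_wordProd_pos hp ht h0
  rw [mob_wordProd_append hp ht h0.le] at hfix
  rw [wordProd_singleton] at hpos hfix
  rw [admissible_singleton] at ht
  refine ⟨t, ht, IsPeriodic.isSimple hp ⟨hpos, t :: l, admissible_cons.mpr ⟨ht, hl⟩,
    List.cons_ne_nil _ _, ?_⟩⟩
  rw [mob_wordProd_cons hp hl hpos.le, hfix]

/-! ### Classes -/

section Classes

variable {𝒜 ℬ : Set BQF} {Q R : BQF}

lemma IsFormClass.eq_orbit (h : IsFormClass p 𝒜) (hQ : Q ∈ 𝒜) :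
    𝒜 = {R | ∃ M ∈ heckeGroup p, R = Q.act M} := by
  obtain ⟨Q₀, -, rfl⟩ := h
  obtain ⟨N, hN, rfl⟩ := hQ
  ext R
  constructor
  · rintro ⟨K, hK, rfl⟩
    exact ⟨N⁻¹ * K, mul_mem (inv_mem hN) hK, by rw [← BQF.act_mul, mul_inv_cancel_left]⟩
  · rintro ⟨K, hK, rfl⟩
    exact ⟨N * K, mul_mem hN hK, (BQF.act_mul _ _ _).symm⟩

lemma IsFormClass.act_mem (h : IsFormClass p 𝒜) (hQ : Q ∈ 𝒜) (hM : M ∈ heckeGroup p) :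
    Q.act M ∈ 𝒜 := by
  rw [h.eq_orbit hQ]
  exact ⟨M, hM, rfl⟩

lemma IsFormClass.exists_act (h : IsFormClass p 𝒜) (hQ : Q ∈ 𝒜) (hR : R ∈ 𝒜) :
    ∃ M ∈ heckeGroup p, R = Q.act M := by
  rwa [h.eq_orbit hQ] at hR

lemma IsFormClass.eq_of_mem (h : IsFormClass p 𝒜) (h' : IsFormClass p ℬ) (hQ : Q ∈ 𝒜)
    (hQ' : Q ∈ ℬ) : 𝒜 = ℬ := by
  rw [h.eq_orbit hQ, h'.eq_orbit hQ']

lemma neg_mem_negClass : Q.neg ∈ negClass 𝒜 ↔ Q ∈ 𝒜 :=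
  Function.LeftInverse.injective BQF.neg_neg |>.mem_set_image

lemma mem_negClass : Q ∈ negClass 𝒜 ↔ Q.neg ∈ 𝒜 := by
  rw [← neg_mem_negClass (Q := Q.neg), BQF.neg_neg]

lemma negClass_negClass (𝒜 : Set BQF) : negClass (negClass 𝒜) = 𝒜 := by
  ext Q
  rw [mem_negClass, neg_mem_negClass]

lemma BQF.IsLambda.neg (h : Q.IsLambda p) : Q.neg.IsLambda p := by
  obtain ⟨hA, hB, hC, hD⟩ := h
  refine ⟨neg_mem hA, neg_mem hB, neg_mem hC, hD.trans_eq ?_⟩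
  simp only [BQF.disc, BQF.neg]
  ring

lemma IsFormClass.negClass (h : IsFormClass p 𝒜) : IsFormClass p (negClass 𝒜) := by
  obtain ⟨Q, hQ, rfl⟩ := h
  refine ⟨Q.neg, hQ.neg, ?_⟩
  ext R
  rw [mem_negClass]
  refine exists_congr fun M ↦ and_congr_right fun _ ↦ ?_
  rw [BQF.neg_act, ← (Function.LeftInverse.injective BQF.neg_neg).eq_iff, BQF.neg_neg]

lemma IsHyperbolicClass.negClass (hp : 3 ≤ p) (h : IsHyperbolicClass p 𝒜) :
    IsHyperbolicClass p (negClass 𝒜) := by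
  obtain ⟨hclass, x, hx, hmem⟩ := h
  refine ⟨hclass.negClass, heckeConj p x, hx.heckeConj hp, ?_⟩
  rwa [hyperbolicForm_heckeConj hp hx, neg_mem_negClass]

/-- The class of the form of a hyperbolic point. -/
def formClass (p : ℕ) (x : ℝ) : Set BQF :=
  {R | ∃ M ∈ heckeGroup p, R = (hyperbolicForm p x).act M}

lemma hyperbolicForm_mem_formClass (x : ℝ) : hyperbolicForm p x ∈ formClass p x :=
  ⟨1, one_mem _, (BQF.act_one _).symm⟩

lemma isHyperbolicClass_formClass (hp : 3 ≤ p) (hx : IsHyperbolicPoint p x) :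
    IsHyperbolicClass p (formClass p x) :=
  ⟨⟨_, isLambda_hyperbolicForm hp hx, rfl⟩, x, hx, hyperbolicForm_mem_formClass x⟩

lemma exists_mob_of_mem_class (hp : 3 ≤ p) (h : IsFormClass p 𝒜) (hx : IsHyperbolicPoint p x)
    (hy : IsHyperbolicPoint p y) (hx' : hyperbolicForm p x ∈ 𝒜) (hy' : hyperbolicForm p y ∈ 𝒜) :
    ∃ M ∈ heckeGroup p, mob M x = y := by
  obtain ⟨M, hM, h⟩ := h.exists_act hx' hy'
  refine ⟨M⁻¹, inv_mem hM, eq_of_hyperbolicForm_eq hp (hx.mob hp (inv_mem hM)) hy ?_⟩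
  rw [hyperbolicForm_mob hp hx (inv_mem hM), inv_inv, h]

lemma hyperbolicForm_mob_mem (hp : 3 ≤ p) (h : IsFormClass p 𝒜) (hx : IsHyperbolicPoint p x)
    (hx' : hyperbolicForm p x ∈ 𝒜) (hM : M ∈ heckeGroup p) : hyperbolicForm p (mob M x) ∈ 𝒜 := by
  rw [hyperbolicForm_mob hp hx hM]
  exact h.act_mem hx' (inv_mem hM)

lemma simpleNumbers_nonempty (hp : 3 ≤ p) (h : IsHyperbolicClass p 𝒜) :
    (simpleNumbers p 𝒜).Nonempty := by
  obtain ⟨hclass, x, hx, hmem⟩ := h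
  obtain ⟨N, hN, z, hz, rfl⟩ := exists_periodic hp hx
  have hzmem := hyperbolicForm_mob_mem hp hclass hx hmem (inv_mem hN)
  rw [mob_inv_mob _ ((hz.isHyperbolicPoint hp).mobDen_ne hp hN)] at hzmem
  exact ⟨z, mem_simpleNumbers.mpr ⟨hz.isSimple hp, hzmem⟩⟩

lemma exists_word_of_mem_class (hp : 3 ≤ p) (h : IsFormClass p 𝒜) (hx : x ∈ simpleNumbers p 𝒜)
    (hy : y ∈ simpleNumbers p 𝒜) : ∃ l, Admissible p l ∧ x = mob (wordProd p l) y := by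
  rw [mem_simpleNumbers] at hx hy
  obtain ⟨M, hM, rfl⟩ := exists_mob_of_mem_class hp h hx.1.1 hy.1.1 hx.2 hy.2
  exact hx.1.exists_word hp hM hy.1

lemma exists_prefix_of_word (hp : 3 ≤ p) (hx : 0 < x) (hy : 0 < y) {g : List ℕ}
    (hg : Admissible p g) (hne : g ≠ []) (hfix : mob (wordProd p g) x = x) {l : List ℕ}
    (hl : Admissible p l) (hxy : x = mob (wordProd p l) y) :
    ∃ l', Admissible p l' ∧ l' <+: g ∧ x = mob (wordProd p l') y := by
  induction hn : l.length using Nat.strong_induction_on generalizing l with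
  | _ n ih =>
    rcases le_total l.length g.length with hle | hle
    · obtain ⟨r, -, hr, -⟩ := wordProd_prefix hp hl hg hy hx (hxy.symm.trans hfix.symm) hle
      exact ⟨l, hl, ⟨r, hr.symm⟩, hxy⟩
    · obtain ⟨r, hr, rfl, hxr⟩ := wordProd_prefix hp hg hl hx hy (hfix.trans hxy) hle
      have hgl : 0 < g.length := List.length_pos_iff.mpr hne
      rw [List.length_append] at hn
      exact ih r.length (by omega) hr hxr rfl

lemma simpleNumbers_finite (hp : 3 ≤ p) (h : IsFormClass p 𝒜) : (simpleNumbers p 𝒜).Finite := by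
  rcases (simpleNumbers p 𝒜).eq_empty_or_nonempty with h0 | ⟨x, hx⟩
  · exact h0 ▸ Set.finite_empty
  obtain ⟨hx0, g, hg, hne, hfix⟩ := (mem_simpleNumbers.mp hx).1.isPeriodic hp
  refine ((List.finite_toSet g.inits).image fun l ↦ mob (wordProd p l)⁻¹ x).subset fun y hy ↦ ?_
  have hy0 := (mem_simpleNumbers.mp hy).1.pos hp
  obtain ⟨l, hl, hxy⟩ := exists_word_of_mem_class hp h hx hy
  obtain ⟨l', hl', hpre, hxy'⟩ := exists_prefix_of_word hp hx0 hy0 hg hne hfix hl hxy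
  refine ⟨l', (List.mem_inits _ _).mpr hpre, ?_⟩
  simp only [hxy', mob_inv_mob _ (mobDen_wordProd_pos hp hl' hy0.le).ne']

end Classes

/-! ### The involution `x ↦ T x'` on simple points -/

/-- The point `T x'`; this involution maps `Z_𝒜` onto `Z_{-𝒜}`. -/
def heckeStar (p : ℕ) (x : ℝ) : ℝ := -1 / heckeConj p x

lemma heckeStar_eq_mob (x : ℝ) : heckeStar p x = mob heckeT (heckeConj p x) := by
  rw [mob_heckeT, heckeStar]

lemma heckeConj_neg_one_div (hp : 3 ≤ p) (hx : IsHyperbolicPoint p x) :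
    heckeConj p (-1 / x) = heckeStar p x := by
  rw [heckeStar_eq_mob, ← heckeConj_mob hp hx heckeT_mem, mob_heckeT]

lemma heckeConj_heckeStar (hp : 3 ≤ p) (hx : IsHyperbolicPoint p x) :
    heckeConj p (heckeStar p x) = -1 / x := by
  rw [heckeStar_eq_mob, heckeConj_mob hp (hx.heckeConj hp) heckeT_mem,
    heckeConj_heckeConj hp hx, mob_heckeT]

lemma IsHyperbolicPoint.neg_one_div (hp : 3 ≤ p) (hx : IsHyperbolicPoint p x) :
    IsHyperbolicPoint p (-1 / x) :=
  mob_heckeT x ▸ hx.mob hp heckeT_mem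

lemma IsSimple.heckeStar (hp : 3 ≤ p) (hx : IsSimple p x) : IsSimple p (heckeStar p x) := by
  rw [isSimple_iff hp, heckeConj_heckeStar hp hx.1]
  exact ⟨(hx.1.heckeConj hp).neg_one_div hp,
    div_pos_of_neg_of_neg neg_one_lt_zero (hx.heckeConj_neg hp),
    div_neg_of_neg_of_pos neg_one_lt_zero (hx.pos hp)⟩

lemma heckeStar_heckeStar (hp : 3 ≤ p) (hx : IsHyperbolicPoint p x) :
    heckeStar p (heckeStar p x) = x := by
  rw [heckeStar, heckeConj_heckeStar hp hx, neg_one_div_neg_one_div]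

lemma neg_one_div_heckeStar (x : ℝ) : -1 / heckeStar p x = heckeConj p x := by
  rw [heckeStar, neg_one_div_neg_one_div]

lemma hyperbolicForm_act_heckeT (hp : 3 ≤ p) (hx : IsHyperbolicPoint p x) :
    (hyperbolicForm p x).act heckeT = (hyperbolicForm p (heckeStar p x)).neg := by
  rw [heckeStar_eq_mob, hyperbolicForm_mob hp (hx.heckeConj hp) heckeT_mem,
    hyperbolicForm_heckeConj hp hx, heckeT_inv, BQF.act_neg, BQF.neg_act, BQF.neg_neg]

lemma heckeStar_mem_negClass (hp : 3 ≤ p) {𝒜 : Set BQF} (h : IsFormClass p 𝒜)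
    (hx : x ∈ simpleNumbers p 𝒜) : heckeStar p x ∈ simpleNumbers p (negClass 𝒜) := by
  rw [mem_simpleNumbers] at hx ⊢
  refine ⟨hx.1.heckeStar hp, ?_⟩
  rw [mem_negClass, ← hyperbolicForm_act_heckeT hp hx.1.1]
  exact h.act_mem hx.2 heckeT_mem

lemma mem_simpleNumbers_next (hp : 3 ≤ p) {𝒜 : Set BQF} (h : IsFormClass p 𝒜)
    (hx : x ∈ simpleNumbers p 𝒜) :
    ∃ t, (1 ≤ t ∧ t < p) ∧ mob (heckeV p t) x ∈ simpleNumbers p 𝒜 := by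
  rw [mem_simpleNumbers] at hx
  obtain ⟨t, ht, hs⟩ := hx.1.exists_next hp
  exact ⟨t, ht, mem_simpleNumbers.mpr
    ⟨hs, hyperbolicForm_mob_mem hp h hx.1.1 hx.2 (heckeV_mem t)⟩⟩

/-! ### Hecke-symmetric sets -/

lemma mem_heckeConjSet_iff (hp : 3 ≤ p) {P : Set ℂ} {w : ℂ} :
    w ∈ heckeConjSet p P ↔
      ∃ x : ℝ, IsHyperbolicPoint p x ∧ (x : ℂ) ∈ P ∧ w = (heckeConj p x : ℝ) := by
  constructor
  · rintro ⟨x, y, hx, hxy, rfl⟩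
    obtain ⟨hxh, rfl⟩ := (isHeckeConj_iff hp).mp hxy
    exact ⟨x, hxh, hx, rfl⟩
  · rintro ⟨x, hxh, hx, rfl⟩
    exact ⟨x, _, hx, (isHeckeConj_iff hp).mpr ⟨hxh, rfl⟩, rfl⟩

lemma heckeSymmetric_of_forall_heckeConj_mem (hp : 3 ≤ p) {P : Set ℂ}
    (hyp : ∀ w ∈ P, ∃ x : ℝ, IsHyperbolicPoint p x ∧ w = x)
    (hconj : ∀ x : ℝ, (x : ℂ) ∈ P → ((heckeConj p x : ℝ) : ℂ) ∈ P) : HeckeSymmetric p P := by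
  refine ⟨hyp, ?_⟩
  ext w
  rw [mem_heckeConjSet_iff hp]
  constructor
  · intro hw
    obtain ⟨x, hx, rfl⟩ := hyp w hw
    exact ⟨heckeConj p x, hx.heckeConj hp, hconj x hw, by rw [heckeConj_heckeConj hp hx]⟩
  · rintro ⟨x, -, hx, rfl⟩
    exact hconj x hx

lemma heckeSymmetric_of_heckeStar_mem (hp : 3 ≤ p) {Z : Set ℝ} (hZ : ∀ x ∈ Z, IsSimple p x)
    (hstar : ∀ x ∈ Z, heckeStar p x ∈ Z) :
    HeckeSymmetric p {w | ∃ x ∈ Z, w = (x : ℂ) ∨ w = ((-1 / x : ℝ) : ℂ)} := by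
  refine heckeSymmetric_of_forall_heckeConj_mem hp ?_ ?_
  · rintro w ⟨x, hx, rfl | rfl⟩
    · exact ⟨x, (hZ x hx).1, rfl⟩
    · exact ⟨_, (hZ x hx).1.neg_one_div hp, rfl⟩
  · rintro u ⟨x, hx, hu | hu⟩ <;> rw [Complex.ofReal_inj.mp hu] <;>
      refine ⟨heckeStar p x, hstar x hx, ?_⟩
    · exact Or.inr (by rw [neg_one_div_heckeStar])
    · exact Or.inl (by rw [heckeConj_neg_one_div hp (hZ x hx).1])

lemma negClass_eq_of_heckeSymmetric (hp : 3 ≤ p) {𝒜 : Set BQF} (h : IsHyperbolicClass p 𝒜)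
    (hs : HeckeSymmetric p (poleSystem p 𝒜)) : negClass 𝒜 = 𝒜 := by
  obtain ⟨x, hx⟩ := simpleNumbers_nonempty hp h
  have hxs := (mem_simpleNumbers.mp hx).1
  have hmem : ((heckeConj p x : ℝ) : ℂ) ∈ poleSystem p 𝒜 := by
    rw [hs.2, mem_heckeConjSet_iff hp]
    exact ⟨x, hxs.1, ⟨x, hx, Or.inl rfl⟩, rfl⟩
  have hstar : heckeStar p x ∈ simpleNumbers p 𝒜 := by
    obtain ⟨y, hy, hxy | hxy⟩ := hmem <;> rw [Complex.ofReal_inj] at hxy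
    · exact absurd (hxy ▸ hxs.heckeConj_neg hp) ((mem_simpleNumbers.mp hy).1.pos hp).not_gt
    · rwa [heckeStar, hxy, neg_one_div_neg_one_div]
  exact h.1.negClass.eq_of_mem h.1
    (mem_simpleNumbers.mp (heckeStar_mem_negClass hp h.1 hx)).2 (mem_simpleNumbers.mp hstar).2

end

/-! ### Values of rational functions -/

section Values

variable {K : Type*} [Field K]

/-- The rational function `f` is regular at `w` with value `v`. Unlike `RatFunc.eval`, this
relation does not depend on a choice of numerator and denominator and has no junk values. -/
def HasValueAt (w : K) (f : RatFunc K) (v : K) : Prop :=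
  ∃ P Q : Polynomial K, Q.eval w ≠ 0 ∧
    f = algebraMap (Polynomial K) (RatFunc K) P / algebraMap (Polynomial K) (RatFunc K) Q ∧
    v = P.eval w / Q.eval w

/-- The rational function `f` is regular at `w`: it has no pole there. -/
def RegularAt (w : K) (f : RatFunc K) : Prop := ∃ v, HasValueAt w f v

lemma ratFunc_algebraMap_ne_zero {Q : Polynomial K} {w : K} (h : Q.eval w ≠ 0) :
    algebraMap (Polynomial K) (RatFunc K) Q ≠ 0 := by
  refine RatFunc.algebraMap_ne_zero ?_
  rintro rfl
  exact h Polynomial.eval_zero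

namespace HasValueAt

variable {w v v' : K} {f g : RatFunc K}

lemma unique (h : HasValueAt w f v) (h' : HasValueAt w f v') : v = v' := by
  obtain ⟨P, Q, hQ, rfl, rfl⟩ := h
  obtain ⟨P', Q', hQ', h, rfl⟩ := h'
  rw [div_eq_div_iff (ratFunc_algebraMap_ne_zero hQ) (ratFunc_algebraMap_ne_zero hQ'),
    ← map_mul, ← map_mul] at h
  rw [div_eq_div_iff hQ hQ', ← Polynomial.eval_mul, RatFunc.algebraMap_injective K h,
    Polynomial.eval_mul]

lemma of_polynomial (w : K) (P : Polynomial K) :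
    HasValueAt w (algebraMap (Polynomial K) (RatFunc K) P) (P.eval w) :=
  ⟨P, 1, by simp, by simp, by simp⟩

lemma const (w c : K) : HasValueAt w (RatFunc.C c) c := by
  simpa using of_polynomial w (Polynomial.C c)

lemma X (w : K) : HasValueAt w RatFunc.X w := by
  simpa using of_polynomial w Polynomial.X

lemma zero (w : K) : HasValueAt w 0 0 := by simpa using const w 0

lemma one (w : K) : HasValueAt w 1 1 := by simpa using const w 1

lemma add (h : HasValueAt w f v) (h' : HasValueAt w g v') : HasValueAt w (f + g) (v + v') := by
  obtain ⟨P, Q, hQ, rfl, rfl⟩ := h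
  obtain ⟨P', Q', hQ', rfl, rfl⟩ := h'
  refine ⟨P * Q' + Q * P', Q * Q', by simp [hQ, hQ'], ?_, ?_⟩
  · rw [div_add_div _ _ (ratFunc_algebraMap_ne_zero hQ) (ratFunc_algebraMap_ne_zero hQ')]
    simp only [map_add, map_mul]
  · rw [div_add_div _ _ hQ hQ']
    simp only [Polynomial.eval_add, Polynomial.eval_mul]

lemma mul (h : HasValueAt w f v) (h' : HasValueAt w g v') : HasValueAt w (f * g) (v * v') := by
  obtain ⟨P, Q, hQ, rfl, rfl⟩ := h
  obtain ⟨P', Q', hQ', rfl, rfl⟩ := h'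
  refine ⟨P * P', Q * Q', by simp [hQ, hQ'], ?_, ?_⟩ <;>
    simp only [div_mul_div_comm, map_mul, Polynomial.eval_mul]

lemma neg (h : HasValueAt w f v) : HasValueAt w (-f) (-v) := by
  simpa using (const w (-1)).mul h

lemma sub (h : HasValueAt w f v) (h' : HasValueAt w g v') : HasValueAt w (f - g) (v - v') := by
  simpa only [sub_eq_add_neg] using h.add h'.neg

lemma inv (h : HasValueAt w f v) (hv : v ≠ 0) : HasValueAt w f⁻¹ v⁻¹ := by
  obtain ⟨P, Q, -, rfl, rfl⟩ := h
  exact ⟨Q, P, (div_ne_zero_iff.mp hv).1, inv_div _ _, inv_div _ _⟩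

lemma div (h : HasValueAt w f v) (h' : HasValueAt w g v') (hv : v' ≠ 0) :
    HasValueAt w (f / g) (v / v') := by
  simpa only [div_eq_mul_inv] using h.mul (h'.inv hv)

lemma pow (h : HasValueAt w f v) (n : ℕ) : HasValueAt w (f ^ n) (v ^ n) := by
  induction n with
  | zero => simpa using one w
  | succ n ih => simpa only [pow_succ] using ih.mul h

lemma aeval (h : HasValueAt w f v) (P : Polynomial K) :
    HasValueAt w (P.aeval f) (P.eval v) := by
  induction P using Polynomial.induction_on' with
  | add P Q hP hQ => simpa only [map_add, Polynomial.eval_add] using hP.add hQ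
  | monomial n a =>
    rw [Polynomial.aeval_monomial, Polynomial.eval_monomial]
    exact (const w a).mul (h.pow n)

end HasValueAt

namespace RegularAt

variable {w : K} {f g : RatFunc K}

lemma zero (w : K) : RegularAt w 0 := ⟨_, .zero w⟩

lemma const (w c : K) : RegularAt w (RatFunc.C c) := ⟨_, .const w c⟩

lemma add (h : RegularAt w f) (h' : RegularAt w g) : RegularAt w (f + g) :=
  ⟨_, h.choose_spec.add h'.choose_spec⟩

lemma sub (h : RegularAt w f) (h' : RegularAt w g) : RegularAt w (f - g) :=
  ⟨_, h.choose_spec.sub h'.choose_spec⟩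

lemma mul (h : RegularAt w f) (h' : RegularAt w g) : RegularAt w (f * g) :=
  ⟨_, h.choose_spec.mul h'.choose_spec⟩

lemma neg (h : RegularAt w f) : RegularAt w (-f) := ⟨_, h.choose_spec.neg⟩

lemma sum {ι : Type*} (s : Finset ι) {F : ι → RatFunc K} (h : ∀ i ∈ s, RegularAt w (F i)) :
    RegularAt w (∑ i ∈ s, F i) :=
  Finset.sum_induction F (RegularAt w) (fun _ _ ↦ add) (zero w) h

end RegularAt

lemma regularAt_iff {w : K} {f : RatFunc K} : RegularAt w f ↔ ¬ f.denom.IsRoot w := by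
  constructor
  · rintro ⟨v, P, Q, hQ, rfl, rfl⟩ h
    exact hQ (h.dvd (RatFunc.denom_div_dvd P Q))
  · exact fun h ↦ ⟨_, f.num, f.denom, h, (RatFunc.num_div_denom f).symm, rfl⟩

end Values

lemma mem_nonzeroPoles {w : ℂ} {q : RatFunc ℂ} :
    w ∈ nonzeroPoles q ↔ w ≠ 0 ∧ ¬ RegularAt w q := by
  rw [regularAt_iff, not_not]
  rfl

lemma nonzeroPoles_finite (q : RatFunc ℂ) : (nonzeroPoles q).Finite :=
  (Polynomial.finite_setOfPred_isRoot (RatFunc.denom_ne_zero q)).subset fun _ h ↦ h.2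

/-! ### Composition with Möbius transformations and the slash operator -/

section MobComp

variable {R K : Type*} [CommRing R] [Field K] [Algebra R K] (M N : SL(2, R))

lemma algebraMap_ratFunc (r : R) : algebraMap R (RatFunc K) r = RatFunc.C (algebraMap R K r) :=
  rfl

lemma mobNum_C (c : K) : mobNum M (RatFunc.C c) = RatFunc.C (mobNum M c) := by
  simp only [mobNum, algebraMap_ratFunc, map_add, map_mul]

lemma mobDen_C (c : K) : mobDen M (RatFunc.C c) = RatFunc.C (mobDen M c) := by
  simp only [mobDen, algebraMap_ratFunc, map_add, map_mul]

lemma mob_C (c : K) : mob M (RatFunc.C c) = RatFunc.C (mob M c) := by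
  rw [mob, mobNum_C, mobDen_C, ← map_div₀, mob]

lemma ratFunc_X_ne_C (c : K) : RatFunc.X ≠ RatFunc.C c := by
  rw [← RatFunc.algebraMap_X, ← RatFunc.algebraMap_C]
  exact fun h ↦ Polynomial.X_ne_C c (RatFunc.algebraMap_injective K h)

lemma mobDen_X_ne_zero : mobDen M (RatFunc.X : RatFunc K) ≠ 0 := by
  intro h
  have hdet := algebraMap_det (K := K) M
  rw [mobDen, algebraMap_ratFunc, algebraMap_ratFunc] at h
  by_cases hc : algebraMap R K (M 1 0) = 0
  · rw [hc, map_zero, zero_mul, zero_add, map_eq_zero] at h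
    simp [hc, h] at hdet
  · refine ratFunc_X_ne_C (-algebraMap R K (M 1 1) / algebraMap R K (M 1 0)) ?_
    rw [map_div₀, eq_div_iff ((map_ne_zero _).mpr hc), map_neg]
    linear_combination h

lemma transcendental_mob_X : Transcendental K (mob M (RatFunc.X : RatFunc K)) := by
  refine RatFunc.transcendental_of_ne_C _ fun ⟨c, hc⟩ ↦ ratFunc_X_ne_C (mob M⁻¹ c) ?_
  rw [← mob_C, ← hc, mob_inv_mob M (mobDen_X_ne_zero M)]

/-- The substitution `X ↦ (a X + b) / (c X + d)` in rational functions. -/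
def mobComp : RatFunc K →ₐ[K] RatFunc K :=
  RatFunc.liftAlgHom (Polynomial.aeval (mob M RatFunc.X))
    (nonZeroDivisors_le_comap_nonZeroDivisors_of_injective _
      (transcendental_iff_injective.mp (transcendental_mob_X M)))

lemma mobComp_algebraMap (P : Polynomial K) :
    mobComp M (algebraMap (Polynomial K) (RatFunc K) P) = P.aeval (mob M RatFunc.X) := by
  simpa only [mobComp, map_one, div_one] using RatFunc.liftAlgHom_apply_div
    (Polynomial.aeval (mob M (RatFunc.X : RatFunc K))) _ P 1

@[simp] lemma mobComp_C (c : K) : mobComp M (RatFunc.C c) = RatFunc.C c :=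
  (mobComp M).commutes c

@[simp] lemma mobComp_X : mobComp M (RatFunc.X : RatFunc K) = mob M RatFunc.X := by
  rw [← RatFunc.algebraMap_X, mobComp_algebraMap, Polynomial.aeval_X, RatFunc.algebraMap_X]

lemma mobComp_eq_algHom (φ : RatFunc K →ₐ[K] RatFunc K) (h : φ RatFunc.X = mob M RatFunc.X) :
    mobComp M = φ := by
  ext q
  rw [← RatFunc.num_div_denom q]
  simp only [map_div₀, mobComp_algebraMap, ← h, Polynomial.aeval_algHom_apply,
    RatFunc.aeval_X_left_eq_algebraMap]

lemma mobComp_mobDen (x : RatFunc K) : mobComp N (mobDen M x) = mobDen M (mobComp N x) := by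
  simp only [mobDen, algebraMap_ratFunc, map_add, map_mul, mobComp_C]

lemma mobComp_mobNum (x : RatFunc K) : mobComp N (mobNum M x) = mobNum M (mobComp N x) := by
  simp only [mobNum, algebraMap_ratFunc, map_add, map_mul, mobComp_C]

lemma mobComp_mobDen_X :
    mobComp N (mobDen M (RatFunc.X : RatFunc K)) =
      mobDen (M * N) RatFunc.X / mobDen N RatFunc.X := by
  have hN := mobDen_X_ne_zero (K := K) N
  rw [mobComp_mobDen, mobComp_X, eq_div_iff hN, mobDen_mul M N hN]

lemma mobComp_mobComp (q : RatFunc K) : mobComp N (mobComp M q) = mobComp (M * N) q := by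
  have h : mobComp (K := K) (M * N) = (mobComp N).comp (mobComp M) := by
    refine mobComp_eq_algHom _ _ ?_
    rw [AlgHom.comp_apply, mobComp_X, mob, map_div₀, mobComp_mobNum, mobComp_mobDen, ← mob,
      mobComp_X, mob_mul M N (mobDen_X_ne_zero N)]
  rw [h, AlgHom.comp_apply]

@[simp] lemma mobComp_one (q : RatFunc K) : mobComp (1 : SL(2, R)) q = q := by
  rw [mobComp_eq_algHom (1 : SL(2, R)) (.id K (RatFunc K)) (by simp), AlgHom.id_apply]

@[simp] lemma mobComp_neg (q : RatFunc K) : mobComp (-M) q = mobComp M q := by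
  rw [mobComp_eq_algHom (-M) (mobComp M) (by simp)]

variable {M} {w v : K} {f : RatFunc K}

lemma hasValueAt_mobDen_X (M : SL(2, R)) (w : K) :
    HasValueAt w (mobDen M RatFunc.X) (mobDen M w) :=
  ((HasValueAt.const _ _).mul (HasValueAt.X w)).add (HasValueAt.const _ _)

lemma hasValueAt_mob_X (h : mobDen M w ≠ 0) : HasValueAt w (mob M RatFunc.X) (mob M w) :=
  (((HasValueAt.const _ _).mul (HasValueAt.X w)).add (HasValueAt.const _ _)).div
    (hasValueAt_mobDen_X M w) h

protected lemma HasValueAt.mobComp (hd : mobDen M w ≠ 0) (h : HasValueAt (mob M w) f v) :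
    HasValueAt w (mobComp M f) v := by
  obtain ⟨P, Q, hQ, rfl, rfl⟩ := h
  rw [map_div₀, mobComp_algebraMap, mobComp_algebraMap]
  exact ((hasValueAt_mob_X hd).aeval P).div ((hasValueAt_mob_X hd).aeval Q) hQ

end MobComp

section Slash

variable (k : ℕ) (q r : RatFunc ℂ) (M N : SL(2, ℝ))

lemma slash_eq : slash k q M = (mobDen M RatFunc.X ^ (2 * k))⁻¹ * mobComp M q := by
  conv_rhs => rw [← RatFunc.num_div_denom q, map_div₀, mobComp_algebraMap, mobComp_algebraMap]
  rfl

lemma slash_slash : slash k (slash k q M) N = slash k q (M * N) := by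
  have hN := mobDen_X_ne_zero (K := ℂ) N
  have hMN := mobDen_X_ne_zero (K := ℂ) (M * N)
  simp only [slash_eq, map_mul, map_inv₀, map_pow, mobComp_mobComp, mobComp_mobDen_X, div_pow]
  field_simp

lemma slash_add : slash k (q + r) M = slash k q M + slash k r M := by
  simp only [slash_eq, map_add, mul_add]

lemma slash_sub : slash k (q - r) M = slash k q M - slash k r M := by
  simp only [slash_eq, map_sub, mul_sub]

lemma slash_neg : slash k (-q) M = -slash k q M := by
  simp only [slash_eq, map_neg, mul_neg]

@[simp] lemma slash_zero : slash k 0 M = 0 := by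
  simp only [slash_eq, map_zero, mul_zero]

lemma slash_C_mul (c : ℂ) : slash k (RatFunc.C c * q) M = RatFunc.C c * slash k q M := by
  simp only [slash_eq, map_mul, mobComp_C, mul_left_comm]

lemma slash_sum {ι : Type*} (s : Finset ι) (F : ι → RatFunc ℂ) :
    slash k (∑ i ∈ s, F i) M = ∑ i ∈ s, slash k (F i) M := by
  simp only [slash_eq, map_sum, Finset.mul_sum]

lemma slash_neg_matrix : slash k q (-M) = slash k q M := by
  rw [slash_eq, slash_eq, mobComp_neg, mobDen_neg, (even_two_mul k).neg_pow]

@[simp] lemma slash_one : slash k q 1 = q := by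
  rw [slash_eq, mobDen_one, one_pow, inv_one, one_mul, mobComp_one]

variable {M q} in
lemma RegularAt.slash {w : ℂ} (hd : mobDen M w ≠ 0) (h : RegularAt (mob M w) q) :
    RegularAt w (slash k q M) := by
  obtain ⟨v, h⟩ := h
  rw [slash_eq]
  exact ⟨_, (((hasValueAt_mobDen_X M w).pow (2 * k)).inv (pow_ne_zero _ hd)).mul (h.mobComp hd)⟩

end Slash

/-! ### Powers of forms -/

lemma mobComp_toRatFunc (Q : BQF) (M : SL(2, ℝ)) :
    mobComp M Q.toRatFunc = (Q.act M).toRatFunc / mobDen M RatFunc.X ^ 2 := by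
  have h := mobDen_X_ne_zero (K := ℂ) M
  rw [eq_div_iff (pow_ne_zero 2 h)]
  simp only [BQF.toRatFunc, map_add, map_mul, map_pow, mobComp_C, mobComp_X, mob]
  field_simp
  simp only [mobNum, mobDen, algebraMap_ratFunc, BQF.act, Complex.coe_algebraMap,
    Complex.ofReal_add, Complex.ofReal_mul, Complex.ofReal_pow, map_add, map_mul, map_pow,
    Complex.ofReal_ofNat, map_ofNat]
  ring

lemma slash_toRatFunc (k : ℕ) (Q : BQF) (M : SL(2, ℝ)) :
    slash k (Q.toRatFunc ^ k)⁻¹ M = ((Q.act M).toRatFunc ^ k)⁻¹ := by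
  rw [slash_eq, map_inv₀, map_pow, mobComp_toRatFunc, div_pow, inv_div, ← pow_mul,
    div_eq_mul_inv, inv_mul_cancel_left₀ (pow_ne_zero _ (mobDen_X_ne_zero M))]

lemma toRatFunc_neg (Q : BQF) : Q.neg.toRatFunc = -Q.toRatFunc := by
  simp only [BQF.toRatFunc, BQF.neg, Complex.ofReal_neg, map_neg]
  ring

lemma inv_pow_toRatFunc_neg {k : ℕ} (hk : Odd k) (Q : BQF) :
    (Q.neg.toRatFunc ^ k)⁻¹ = -(Q.toRatFunc ^ k)⁻¹ := by
  rw [toRatFunc_neg, hk.neg_pow, inv_neg]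

/-! ### Poles of rational period functions -/

section Poles

variable {p k : ℕ} {q : RatFunc ℂ}

lemma IsRPF.slash_heckeT (h : IsRPF p k q) : slash k q heckeT = -q :=
  (neg_eq_of_add_eq_zero_right h.1).symm

lemma sum_slash_heckeU_slash_heckeT_inv (hp : 0 < p) (q : RatFunc ℂ) :
    slash k (∑ t ∈ Finset.range p, slash k q (heckeU p ^ t)) heckeT⁻¹ =
      slash k q heckeT + ∑ t ∈ Finset.Ico 1 p, slash k q (heckeV p t) := by
  rw [slash_sum, Finset.range_eq_Ico, Finset.sum_eq_sum_Ico_succ_bot hp, pow_zero, slash_one,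
    heckeT_inv, slash_neg_matrix, ← heckeT_inv]
  simp only [slash_slash, heckeV, zero_add]

-- Applying `T⁻¹` to the relation for `U` and cancelling `q|T = -q` leaves only the
-- matrices `V_t`, which have nonnegative entries and preserve the right half plane.
lemma IsRPF.eq_sum_heckeV (hp : 0 < p) (h : IsRPF p k q) :
    q = ∑ t ∈ Finset.Ico 1 p, slash k q (heckeV p t) := by
  have hsum := sum_slash_heckeU_slash_heckeT_inv (k := k) hp q
  rwa [h.2, slash_zero, h.slash_heckeT, eq_comm, neg_add_eq_zero] at hsum

lemma IsRPF.neg_one_div_mem (h : IsRPF p k q) {w : ℂ} (hw : w ∈ nonzeroPoles q) :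
    -1 / w ∈ nonzeroPoles q := by
  rw [mem_nonzeroPoles] at hw ⊢
  refine ⟨div_ne_zero (by norm_num) hw.1, fun hr ↦ hw.2 ?_⟩
  rw [← mob_heckeT] at hr
  have hT := (hr.slash k (by rw [mobDen_heckeT]; exact hw.1)).neg
  rwa [h.slash_heckeT, neg_neg] at hT

lemma regularAt_slash_heckeV (hp : 3 ≤ p) {t : ℕ} (ht : 1 ≤ t ∧ t < p) {w : ℂ}
    (hr : RightHalf w) (hw : mob (heckeV p t) w ∉ nonzeroPoles q) :
    RegularAt w (slash k q (heckeV p t)) := by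
  rw [mem_nonzeroPoles, not_and, not_not] at hw
  exact (hw (hr.mob_heckeV hp ht).2).slash k (mobDen_heckeV_ne hp ht hr.1)

lemma IsRPF.exists_next_pole (hp : 3 ≤ p) (h : IsRPF p k q) {w : ℂ} (hw : w ∈ nonzeroPoles q)
    (hr : RightHalf w) : ∃ t, (1 ≤ t ∧ t < p) ∧ mob (heckeV p t) w ∈ nonzeroPoles q := by
  by_contra! hcon
  refine (mem_nonzeroPoles.mp hw).2 ?_
  rw [h.eq_sum_heckeV (by omega)]
  refine RegularAt.sum _ fun t ht ↦ ?_
  rw [Finset.mem_Ico] at ht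
  exact regularAt_slash_heckeV hp ht hr (hcon t ht)

/-- The nonzero poles of `q` in the closed right half plane. They form a subtype because the
relation between them is studied as a self-map of a finite type. -/
abbrev RightPole (q : RatFunc ℂ) : Type := {w : ℂ // w ∈ nonzeroPoles q ∧ RightHalf w}

instance (q : RatFunc ℂ) : Finite (RightPole q) :=
  ((nonzeroPoles_finite q).subset fun _ hw ↦ hw.1 :
    {w | w ∈ nonzeroPoles q ∧ RightHalf w}.Finite)

-- `σ` is injective because the sets `V_t (RightHalf)` are disjoint, hence bijective because `q`
-- has finitely many poles.
lemma IsRPF.exists_shift (hp : 3 ≤ p) (h : IsRPF p k q) :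
    ∃ (σ : RightPole q → RightPole q) (τ : RightPole q → ℕ), Function.Injective σ ∧
      (∀ x, (1 ≤ τ x ∧ τ x < p) ∧ (σ x : ℂ) = mob (heckeV p (τ x)) (x : ℂ)) ∧
      ∀ z t, RightHalf z → 1 ≤ t ∧ t < p → mob (heckeV p t) z ∈ nonzeroPoles q →
        ∃ x : RightPole q, (x : ℂ) = z ∧ τ x = t := by
  choose τ hτ hpole using fun x : RightPole q ↦ h.exists_next_pole hp x.2.1 x.2.2
  let σ (x : RightPole q) : RightPole q :=
    ⟨mob (heckeV p (τ x)) (x : ℂ), hpole x, x.2.2.mob_heckeV hp (hτ x)⟩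
  have hinj : Function.Injective σ := fun x y hxy ↦ Subtype.ext
    (heckeV_unique hp (hτ x) (hτ y) x.2.2 y.2.2 (congrArg Subtype.val hxy)).2
  refine ⟨σ, τ, hinj, fun x ↦ ⟨hτ x, rfl⟩, fun z t hz ht hmem ↦ ?_⟩
  obtain ⟨x, hx⟩ := Finite.surjective_of_injective hinj ⟨_, hmem, hz.mob_heckeV hp ht⟩
  obtain ⟨htx, hzx⟩ := heckeV_unique hp (hτ x) ht x.2.2 hz (congrArg Subtype.val hx)
  exact ⟨x, hzx, htx⟩

lemma IsRPF.mem_of_heckeV_mem (hp : 3 ≤ p) (h : IsRPF p k q) {w : ℂ} (hr : RightHalf w) {t : ℕ}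
    (ht : 1 ≤ t ∧ t < p) (hw : mob (heckeV p t) w ∈ nonzeroPoles q) : w ∈ nonzeroPoles q := by
  obtain ⟨_, _, -, -, hpre⟩ := h.exists_shift hp
  obtain ⟨x, rfl, -⟩ := hpre w t hr ht hw
  exact x.2.1

lemma IsRPF.regularAt_sub_slash_heckeV (hp : 3 ≤ p) (h : IsRPF p k q) {w : ℂ} (hr : RightHalf w)
    {t : ℕ} (ht : 1 ≤ t ∧ t < p) (hw : mob (heckeV p t) w ∈ nonzeroPoles q) :
    RegularAt w (q - slash k q (heckeV p t)) := by
  obtain ⟨_, τ, -, -, hpre⟩ := h.exists_shift hp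
  have hsum := h.eq_sum_heckeV (by omega)
  rw [← Finset.add_sum_erase _ _ (Finset.mem_Ico.mpr ht)] at hsum
  rw [sub_eq_of_eq_add' hsum]
  refine RegularAt.sum _ fun s hs ↦ ?_
  rw [Finset.mem_erase, Finset.mem_Ico] at hs
  refine regularAt_slash_heckeV hp hs.2 hr fun hmem ↦ hs.1 ?_
  obtain ⟨x, hxw, rfl⟩ := hpre w s hr hs.2 hmem
  obtain ⟨y, hyw, rfl⟩ := hpre w t hr ht hw
  rw [Subtype.ext (hxw.trans hyw.symm)]

lemma IsRPF.exists_word_fixing_pole (hp : 3 ≤ p) (h : IsRPF p k q) {w : ℂ}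
    (hw : w ∈ nonzeroPoles q) (hr : RightHalf w) :
    ∃ l, Admissible p l ∧ l ≠ [] ∧ mob (wordProd p l) w = w ∧
      RegularAt w (q - slash k q (wordProd p l)) := by
  obtain ⟨σ, τ, hinj, hστ, -⟩ := h.exists_shift hp
  have hiter (n : ℕ) (x : RightPole q) : ∃ l, Admissible p l ∧ l.length = n ∧
      (σ^[n] x : ℂ) = mob (wordProd p l) (x : ℂ) ∧
      RegularAt (x : ℂ) (q - slash k q (wordProd p l)) := by
    induction n with
    | zero => exact ⟨[], admissible_nil, rfl, by simp, by simpa using RegularAt.zero _⟩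
    | succ n ih =>
      obtain ⟨l, hl, hlen, hval, hreg⟩ := ih
      have hd := mobDen_wordProd_ne hp hl x.2.2.1
      obtain ⟨ht, hnext⟩ := hστ (σ^[n] x)
      refine ⟨τ (σ^[n] x) :: l, admissible_cons.mpr ⟨ht, hl⟩, by simp [hlen], ?_, ?_⟩
      · rw [Function.iterate_succ_apply', hnext, hval, wordProd_cons, mob_mul _ _ hd]
      · have hstep := h.regularAt_sub_slash_heckeV hp (σ^[n] x).2.2 ht
          (hnext ▸ (σ (σ^[n] x)).2.1)
        rw [hval] at hstep
        have hsum := hreg.add (hstep.slash k hd)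
        rwa [slash_sub, slash_slash, ← wordProd_cons, sub_add_sub_cancel] at hsum
  obtain ⟨n, hn, hper⟩ := hinj.mem_periodicPts ⟨w, hw, hr⟩
  obtain ⟨l, hl, rfl, hval, hreg⟩ := hiter n ⟨w, hw, hr⟩
  refine ⟨l, hl, List.ne_nil_of_length_pos hn, ?_, hreg⟩
  rw [← hval, hper.eq]

lemma IsRPF.mem_of_wordProd_mem (hp : 3 ≤ p) (h : IsRPF p k q) {x : ℝ} (hx : 0 < x)
    {l : List ℕ} (hl : Admissible p l)
    (hw : ((mob (wordProd p l) x : ℝ) : ℂ) ∈ nonzeroPoles q) : (x : ℂ) ∈ nonzeroPoles q := by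
  induction l with
  | nil => simpa using hw
  | cons t l ih =>
    rw [admissible_cons] at hl
    rw [mob_wordProd_cons hp hl.2 hx.le, ← mob_ofReal] at hw
    exact ih hl.2 (h.mem_of_heckeV_mem hp
      (rightHalf_ofReal.mpr (mob_wordProd_pos hp hl.2 hx)) hl.1 hw)

lemma IsRPF.pole_of_rightHalf (hp : 3 ≤ p) (h : IsRPF p k q) {w : ℂ} (hw : w ∈ nonzeroPoles q)
    (hr : RightHalf w) : ∃ x : ℝ, IsSimple p x ∧ w = x := by
  obtain ⟨l, hl, hne, hfix, -⟩ := h.exists_word_fixing_pole hp hw hr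
  obtain ⟨x, hx, rfl⟩ := exists_real_of_mob_wordProd_eq hp hl hne hr hfix
  rw [mob_ofReal, Complex.ofReal_inj] at hfix
  exact ⟨x, IsPeriodic.isSimple hp ⟨hx, l, hl, hne, hfix⟩, rfl⟩

lemma IsRPF.exists_simple_pole (hp : 3 ≤ p) (h : IsRPF p k q) {w : ℂ}
    (hw : w ∈ nonzeroPoles q) :
    ∃ x : ℝ, IsSimple p x ∧ (x : ℂ) ∈ nonzeroPoles q ∧ (w = x ∨ w = ((-1 / x : ℝ) : ℂ)) := by
  have hw0 : w ≠ 0 := (mem_nonzeroPoles.mp hw).1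
  rcases le_total 0 w.re with hre | hre
  · obtain ⟨x, hx, rfl⟩ := h.pole_of_rightHalf hp hw ⟨hre, hw0⟩
    exact ⟨x, hx, hw, Or.inl rfl⟩
  · have hw' := h.neg_one_div_mem hw
    have hre' : 0 ≤ (-1 / w).re := by
      rw [neg_div, one_div, Complex.neg_re, Complex.inv_re, ← neg_div]
      exact div_nonneg (neg_nonneg.mpr hre) (Complex.normSq_nonneg w)
    obtain ⟨x, hx, hwx⟩ := h.pole_of_rightHalf hp hw' ⟨hre', (mem_nonzeroPoles.mp hw').1⟩
    refine ⟨x, hx, hwx ▸ hw', Or.inr ?_⟩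
    push_cast
    rw [← hwx]
    field_simp

lemma IsRPF.poleSystem_subset (hp : 3 ≤ p) (h : IsRPF p k q) {𝒜 : Set BQF}
    (h𝒜 : IsFormClass p 𝒜) {x : ℝ} (hx : x ∈ simpleNumbers p 𝒜)
    (hmem : (x : ℂ) ∈ nonzeroPoles q) : poleSystem p 𝒜 ⊆ nonzeroPoles q := by
  rintro w ⟨y, hy, hw⟩
  obtain ⟨l, hl, rfl⟩ := exists_word_of_mem_class hp h𝒜 hx hy
  have hy' := h.mem_of_wordProd_mem hp ((mem_simpleNumbers.mp hy).1.pos hp) hl hmem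
  rcases hw with rfl | rfl
  · exact hy'
  · push_cast
    exact h.neg_one_div_mem hy'

end Poles

/-! ### The principal part at a pole -/

section PrincipalPart

variable {K : Type*} [Field K]

lemma X_sub_C_ne_zero (a : K) : (RatFunc.X - RatFunc.C a : RatFunc K) ≠ 0 :=
  sub_ne_zero.mpr (ratFunc_X_ne_C a)

lemma hasValueAt_X_sub_C_self (w : K) : HasValueAt w (RatFunc.X - RatFunc.C w) 0 := by
  simpa using (HasValueAt.X w).sub (HasValueAt.const w w)

lemma HasValueAt.exists_eq_X_sub_C_mul {w : K} {f : RatFunc K} (h : HasValueAt w f 0) :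
    ∃ g, RegularAt w g ∧ f = (RatFunc.X - RatFunc.C w) * g := by
  obtain ⟨P, Q, hQ, rfl, h0⟩ := h
  have hP : P.IsRoot w := (div_eq_zero_iff.mp h0.symm).resolve_right hQ
  obtain ⟨R, rfl⟩ := Polynomial.dvd_iff_isRoot.mpr hP
  refine ⟨_, ⟨_, R, Q, hQ, rfl, rfl⟩, ?_⟩
  rw [map_mul, mul_div_assoc, map_sub, RatFunc.algebraMap_X, RatFunc.algebraMap_C]

lemma HasValueAt.regularAt_X_sub_C_pow_mul {w : K} {f : RatFunc K} {n : ℕ}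
    (h : HasValueAt w ((RatFunc.X - RatFunc.C w) ^ (n + 1) * f) 0) :
    RegularAt w ((RatFunc.X - RatFunc.C w) ^ n * f) := by
  obtain ⟨g, hg, hfg⟩ := h.exists_eq_X_sub_C_mul
  rw [pow_succ', mul_assoc] at hfg
  rwa [mul_left_cancel₀ (X_sub_C_ne_zero w) hfg]

lemma RegularAt.hasValueAt_X_sub_C_pow_mul {w : K} {f : RatFunc K} (h : RegularAt w f) {n : ℕ}
    (hn : n ≠ 0) : HasValueAt w ((RatFunc.X - RatFunc.C w) ^ n * f) 0 := by
  obtain ⟨v, hv⟩ := h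
  simpa [hn] using ((hasValueAt_X_sub_C_self w).pow n).mul hv

lemma exists_regularAt_X_sub_C_pow_mul (w : K) (f : RatFunc K) :
    ∃ n : ℕ, RegularAt w ((RatFunc.X - RatFunc.C w) ^ n * f) := by
  obtain ⟨R, hR, hnd⟩ := Polynomial.exists_eq_pow_rootMultiplicity_mul_and_not_dvd f.denom
    (RatFunc.denom_ne_zero f) w
  have hRw : R.eval w ≠ 0 := by rwa [Polynomial.dvd_iff_isRoot] at hnd
  refine ⟨f.denom.rootMultiplicity w, _, f.num, R, hRw, ?_, rfl⟩
  have hX := pow_ne_zero (f.denom.rootMultiplicity w) (X_sub_C_ne_zero w)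
  have hdenom := congrArg (algebraMap (Polynomial K) (RatFunc K)) hR
  rw [map_mul, map_pow, map_sub, RatFunc.algebraMap_X, RatFunc.algebraMap_C] at hdenom
  rw [← mul_div_mul_left _ (algebraMap _ (RatFunc K) R) hX, ← hdenom, mul_div_assoc,
    RatFunc.num_div_denom]

-- Lower the order of the pole one step at a time: the leading coefficient vanishes, except in
-- order `m`, where a multiple of `e` removes it.
lemma exists_regularAt_X_sub_C_pow_mul_sub {w u : K} {f e : RatFunc K} {b m : ℕ}
    {S : RatFunc K → Prop} (hS : ∀ c g, S g → S (g - RatFunc.C c * e)) (hu : u ≠ 0)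
    (he : HasValueAt w ((RatFunc.X - RatFunc.C w) ^ m * e) u)
    (hlead : ∀ n g v, b < n → n ≠ m → S g →
      HasValueAt w ((RatFunc.X - RatFunc.C w) ^ n * g) v → v = 0) (hf : S f) :
    ∃ c : K, RegularAt w ((RatFunc.X - RatFunc.C w) ^ b * (f - RatFunc.C c * e)) := by
  obtain ⟨n, hn⟩ := exists_regularAt_X_sub_C_pow_mul w f
  induction n generalizing f with
  | zero =>
    have hb : RegularAt w ((RatFunc.X - RatFunc.C w) ^ b) :=
      ⟨_, (hasValueAt_X_sub_C_self w).pow b⟩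
    exact ⟨0, by simpa using hb.mul hn⟩
  | succ n ih =>
    rcases le_or_gt (n + 1) b with hnb | hnb
    · obtain ⟨j, rfl⟩ := Nat.exists_eq_add_of_le' hnb
      have hj : RegularAt w ((RatFunc.X - RatFunc.C w) ^ j) :=
        ⟨_, (hasValueAt_X_sub_C_self w).pow j⟩
      refine ⟨0, ?_⟩
      rw [map_zero, zero_mul, sub_zero, pow_add, mul_assoc]
      exact hj.mul hn
    obtain ⟨v, hv⟩ := hn
    rcases ne_or_eq (n + 1) m with hnm | rfl
    · rw [hlead _ _ v hnb hnm hf hv] at hv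
      exact ih hf hv.regularAt_X_sub_C_pow_mul
    · have hlower := hv.sub ((HasValueAt.const w (v / u)).mul he)
      rw [div_mul_cancel₀ _ hu, sub_self, mul_left_comm, ← mul_sub] at hlower
      obtain ⟨c, hc⟩ := ih (hS _ _ hf) hlower.regularAt_X_sub_C_pow_mul
      exact ⟨v / u + c, by rwa [map_add, add_mul, ← sub_sub]⟩

variable {R : Type*} [CommRing R] [Algebra R K]

lemma mob_sub_mob (M : SL(2, R)) {x y : K} (hx : mobDen M x ≠ 0) (hy : mobDen M y ≠ 0) :
    mob M x - mob M y = (x - y) / (mobDen M x * mobDen M y) := by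
  rw [mob, mob, div_sub_div _ _ hx hy]
  congr 1
  simp only [mobNum, mobDen]
  linear_combination (x - y) * algebraMap_det (K := K) M

lemma mobComp_X_sub_C {M : SL(2, R)} {w : K} (hd : mobDen M w ≠ 0) (hw : mob M w = w) :
    mobComp M (RatFunc.X - RatFunc.C w) =
      (RatFunc.X - RatFunc.C w) / (mobDen M RatFunc.X * RatFunc.C (mobDen M w)) := by
  have hC : mobDen M (RatFunc.C w) ≠ 0 := by rwa [mobDen_C, Ne, map_eq_zero]
  rw [map_sub, mobComp_X, mobComp_C, ← mobDen_C, ← mob_sub_mob M (mobDen_X_ne_zero M) hC, mob_C,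
    hw]

variable {k n : ℕ} {M : SL(2, ℝ)} {w v : ℂ} {f : RatFunc ℂ}

lemma X_sub_C_pow_mul_slash (k n : ℕ) (f : RatFunc ℂ) (hd : mobDen M w ≠ 0) (hw : mob M w = w) :
    (RatFunc.X - RatFunc.C w) ^ n * slash k f M =
      (mobDen M RatFunc.X ^ (2 * k))⁻¹ * (mobDen M RatFunc.X * RatFunc.C (mobDen M w)) ^ n *
        mobComp M ((RatFunc.X - RatFunc.C w) ^ n * f) := by
  have hX := mobDen_X_ne_zero (K := ℂ) M
  have hC : RatFunc.C (mobDen M w) ≠ 0 := (map_ne_zero _).mpr hd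
  rw [map_mul, map_pow, mobComp_X_sub_C hd hw, slash_eq, div_pow]
  field_simp

protected lemma HasValueAt.X_sub_C_pow_mul_slash (hd : mobDen M w ≠ 0) (hw : mob M w = w)
    (h : HasValueAt w ((RatFunc.X - RatFunc.C w) ^ n * f) v) :
    HasValueAt w ((RatFunc.X - RatFunc.C w) ^ n * slash k f M)
      ((mobDen M w ^ (2 * k))⁻¹ * mobDen M w ^ (2 * n) * v) := by
  have hden := hasValueAt_mobDen_X M w
  rw [X_sub_C_pow_mul_slash k n f hd hw, pow_mul _ 2 n, sq]
  exact (((hden.pow _).inv (pow_ne_zero _ hd)).mul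
    ((hden.mul (HasValueAt.const w _)).pow n)).mul (HasValueAt.mobComp hd (hw.symm ▸ h))

-- `M` scales a leading coefficient of order `n` by `(c w + d) ^ (2 n - 2 k)`, which is not `1`.
lemma HasValueAt.eq_zero_of_regularAt_slash_sub (hd : 1 < ‖mobDen M w‖) (hw : mob M w = w)
    (hnk : n ≠ k) (hn : n ≠ 0) (h : HasValueAt w ((RatFunc.X - RatFunc.C w) ^ n * f) v)
    (hf : RegularAt w (slash k f M - f)) : v = 0 := by
  have hd0 : mobDen M w ≠ 0 := norm_pos_iff.mp (zero_lt_one.trans hd)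
  have hsub := (h.X_sub_C_pow_mul_slash (k := k) hd0 hw).sub h
  rw [← mul_sub] at hsub
  have hscale := hsub.unique (hf.hasValueAt_X_sub_C_pow_mul hn)
  by_contra hv
  have hone : (mobDen M w ^ (2 * k))⁻¹ * mobDen M w ^ (2 * n) = 1 :=
    mul_right_cancel₀ hv (by linear_combination hscale)
  rw [inv_mul_eq_one₀ (pow_ne_zero _ hd0)] at hone
  have hnorm := congrArg norm hone
  rw [norm_pow, norm_pow] at hnorm
  have := pow_right_injective₀ (zero_lt_one.trans hd) hd.ne' hnorm
  omega

lemma exists_regularAt_sub_C_mul (hd : 1 < ‖mobDen M w‖) (hw : mob M w = w) {e : RatFunc ℂ}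
    (he : slash k e M = e) {u : ℂ} (hu : u ≠ 0)
    (heu : HasValueAt w ((RatFunc.X - RatFunc.C w) ^ k * e) u)
    (hf : RegularAt w (slash k f M - f)) : ∃ c : ℂ, RegularAt w (f - RatFunc.C c * e) := by
  obtain ⟨c, hc⟩ := exists_regularAt_X_sub_C_pow_mul_sub (b := 0)
    (S := fun g ↦ RegularAt w (slash k g M - g))
    (fun c g hg ↦ by rwa [slash_sub, slash_C_mul, he, sub_sub_sub_cancel_right]) hu heu
    (fun n g v hn hnk hg hv ↦ hv.eq_zero_of_regularAt_slash_sub hd hw hnk hn.ne' hg) hf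
  exact ⟨c, by simpa using hc⟩

end PrincipalPart

/-! ### Linear combinations of rational period functions -/

namespace IsRPF

variable {p k : ℕ} {q r : RatFunc ℂ}

lemma zero : IsRPF p k 0 := by simp [IsRPF]

lemma add (hq : IsRPF p k q) (hr : IsRPF p k r) : IsRPF p k (q + r) := by
  constructor
  · rw [slash_add, add_add_add_comm, hq.1, hr.1, add_zero]
  · simp only [slash_add, Finset.sum_add_distrib, hq.2, hr.2, add_zero]

lemma C_mul (c : ℂ) (hq : IsRPF p k q) : IsRPF p k (RatFunc.C c * q) := by
  constructor
  · rw [slash_C_mul, ← mul_add, hq.1, mul_zero]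
  · simp only [slash_C_mul, ← Finset.mul_sum, hq.2, mul_zero]

lemma sub (hq : IsRPF p k q) (hr : IsRPF p k r) : IsRPF p k (q - r) := by
  simpa [sub_eq_add_neg] using hq.add (hr.C_mul (-1))

lemma sum {ι : Type*} (s : Finset ι) {F : ι → RatFunc ℂ} (h : ∀ i ∈ s, IsRPF p k (F i)) :
    IsRPF p k (∑ i ∈ s, F i) :=
  Finset.sum_induction F (IsRPF p k) (fun _ _ ↦ add) zero h

end IsRPF

/-! ### Inverse powers of the form of a hyperbolic point -/

section InversePowers

variable {p k : ℕ} (hp : 3 ≤ p) {x : ℝ} (hx : IsHyperbolicPoint p x)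

include hp hx

lemma toRatFunc_hyperbolicForm :
    (hyperbolicForm p x).toRatFunc = RatFunc.C ((hyperbolicElt p x 1 0 : ℝ) : ℂ) *
      ((RatFunc.X - RatFunc.C (x : ℂ)) * (RatFunc.X - RatFunc.C ((heckeConj p x : ℝ) : ℂ))) := by
  have hB : hyperbolicElt p x 1 1 - hyperbolicElt p x 0 0 =
      -(hyperbolicElt p x 1 0 * (heckeConj p x + x)) := by
    rw [one_zero_mul_heckeConj_add hp hx, neg_sub]
  rw [BQF.toRatFunc, hyperbolicForm, BQF.ofMatrix, hB, ← one_zero_mul_heckeConj_mul hp hx]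
  simp only [Complex.ofReal_neg, Complex.ofReal_mul, Complex.ofReal_add, map_neg, map_mul, map_add]
  ring

lemma regularAt_inv_pow_hyperbolicForm {w : ℂ} (hwx : w ≠ x) (hwx' : w ≠ (heckeConj p x : ℝ)) :
    RegularAt w ((hyperbolicForm p x).toRatFunc ^ k)⁻¹ := by
  have hc := Complex.ofReal_ne_zero.mpr (hyperbolicElt_one_zero_ne_zero hp hx)
  have hfactor (a : ℂ) : HasValueAt w (RatFunc.X - RatFunc.C a) (w - a) :=
    (HasValueAt.X w).sub (HasValueAt.const w a)
  rw [toRatFunc_hyperbolicForm hp hx]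
  exact ⟨_, (((HasValueAt.const _ _).mul ((hfactor _).mul (hfactor _))).pow k).inv
    (pow_ne_zero _ (mul_ne_zero hc (mul_ne_zero (sub_ne_zero.mpr hwx) (sub_ne_zero.mpr hwx'))))⟩

variable (k) in
lemma exists_hasValueAt_inv_pow_hyperbolicForm :
    ∃ u : ℂ, u ≠ 0 ∧ HasValueAt (x : ℂ) ((RatFunc.X - RatFunc.C (x : ℂ)) ^ k *
      ((hyperbolicForm p x).toRatFunc ^ k)⁻¹) u := by
  have hc := Complex.ofReal_ne_zero.mpr (hyperbolicElt_one_zero_ne_zero hp hx)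
  have hconj : (x : ℂ) - (heckeConj p x : ℝ) ≠ 0 :=
    sub_ne_zero.mpr (Complex.ofReal_injective.ne (heckeConj_ne hp hx).symm)
  have hvalue := pow_ne_zero k (mul_ne_zero hc hconj)
  refine ⟨_, inv_ne_zero hvalue, ?_⟩
  rw [toRatFunc_hyperbolicForm hp hx, mul_left_comm, mul_pow, mul_inv,
    mul_inv_cancel_left₀ (pow_ne_zero k (X_sub_C_ne_zero _))]
  exact (((HasValueAt.const _ _).mul
    ((HasValueAt.X _).sub (HasValueAt.const _ _))).pow k).inv hvalue

lemma not_regularAt_inv_pow_hyperbolicForm (hk : k ≠ 0) :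
    ¬ RegularAt (x : ℂ) ((hyperbolicForm p x).toRatFunc ^ k)⁻¹ := by
  intro h
  obtain ⟨u, hu, hval⟩ := exists_hasValueAt_inv_pow_hyperbolicForm k hp hx
  exact hu (hval.unique (h.hasValueAt_X_sub_C_pow_mul hk))

lemma hyperbolicForm_mob_heckeV_act (t : ℕ) :
    (hyperbolicForm p (mob (heckeV p t) x)).act (heckeU p ^ t) =
      (hyperbolicForm p (heckeStar p x)).neg := by
  rw [hyperbolicForm_mob hp hx (heckeV_mem t), ← BQF.act_mul, heckeV, mul_inv_rev, inv_inv,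
    inv_mul_cancel_right, hyperbolicForm_act_heckeT hp hx]

end InversePowers

/-! ### Sums over sets of simple points -/

lemma sum_slash_heckeU_pow {p : ℕ} (hp : 3 ≤ p) (k : ℕ) (q : RatFunc ℂ) (r : ℕ) :
    ∑ t ∈ Finset.range p, slash k (slash k q (heckeU p ^ r)) (heckeU p ^ t) =
      ∑ t ∈ Finset.range p, slash k q (heckeU p ^ t) := by
  induction r with
  | zero => simp only [pow_zero, slash_one]
  | succ r ih =>
    simp only [slash_slash, ← pow_add] at ih ⊢
    rw [← ih, ← sub_eq_zero, ← Finset.sum_sub_distrib]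
    simp only [add_right_comm r 1, add_assoc r _ 1]
    rw [Finset.sum_range_sub (fun t ↦ slash k q (heckeU p ^ (r + t))), pow_add, heckeU_pow_self hp,
      mul_neg_one, slash_neg_matrix, add_zero, sub_self]

/-- The sum `∑_{x ∈ Z} Q_x(z, 1)^(-k)` over a finite set of points, which need not come from a
single class. -/
def formSum (p k : ℕ) (Z : Finset ℝ) : RatFunc ℂ :=
  ∑ x ∈ Z, ((hyperbolicForm p x).toRatFunc ^ k)⁻¹

section FormSum

variable {p k : ℕ} (hp : 3 ≤ p) {Z : Finset ℝ} (hZ : ∀ x ∈ Z, IsSimple p x)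

include hp hZ

lemma sum_heckeStar {A : Type*} [AddCommMonoid A] (hstar : ∀ x ∈ Z, heckeStar p x ∈ Z)
    (f : ℝ → A) : ∑ x ∈ Z, f (heckeStar p x) = ∑ x ∈ Z, f x := by
  have hinv (x : ℝ) (hx : x ∈ Z) : heckeStar p (heckeStar p x) = x :=
    heckeStar_heckeStar hp (hZ x hx).1
  exact Finset.sum_nbij' (heckeStar p) (heckeStar p) hstar hstar hinv hinv fun _ _ ↦ rfl

lemma sum_mob_heckeV {A : Type*} [AddCommMonoid A] {τ : ℝ → ℕ}
    (hτ : ∀ x ∈ Z, 1 ≤ τ x ∧ τ x < p) (hnext : ∀ x ∈ Z, mob (heckeV p (τ x)) x ∈ Z) (f : ℝ → A) :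
    ∑ x ∈ Z, f (mob (heckeV p (τ x)) x) = ∑ x ∈ Z, f x := by
  have hinj : Set.InjOn (fun x ↦ mob (heckeV p (τ x)) x) Z := fun x hx y hy hxy ↦
    (heckeV_unique_real hp (hτ x hx) (hτ y hy) ((hZ x hx).pos hp) ((hZ y hy).pos hp) hxy).2
  exact Finset.sum_nbij _ hnext hinj
    (Finset.surjOn_of_injOn_of_card_le _ hnext hinj le_rfl) fun _ _ ↦ rfl

lemma slash_formSum_heckeT (hk : Odd k) (hstar : ∀ x ∈ Z, heckeStar p x ∈ Z) :
    slash k (formSum p k Z) heckeT = -formSum p k Z := by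
  rw [formSum, slash_sum, ← Finset.sum_neg_distrib,
    ← sum_heckeStar hp hZ hstar fun x ↦ -((hyperbolicForm p x).toRatFunc ^ k)⁻¹]
  refine Finset.sum_congr rfl fun x hx ↦ ?_
  rw [slash_toRatFunc, hyperbolicForm_act_heckeT hp (hZ x hx).1, inv_pow_toRatFunc_neg hk]

-- The `U`-orbit sums of the terms at `V_t x` and at `x*` are opposite, and both `x ↦ V_t x` and
-- `x ↦ x*` permute `Z`; hence the total is its own negative.
lemma sum_slash_heckeU_formSum (hk : Odd k)
    (hnext : ∀ x ∈ Z, ∃ t, (1 ≤ t ∧ t < p) ∧ mob (heckeV p t) x ∈ Z)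
    (hstar : ∀ x ∈ Z, heckeStar p x ∈ Z) :
    ∑ t ∈ Finset.range p, slash k (formSum p k Z) (heckeU p ^ t) = 0 := by
  choose! τ hτ hmem using hnext
  let u (x : ℝ) : RatFunc ℂ :=
    ∑ t ∈ Finset.range p, slash k ((hyperbolicForm p x).toRatFunc ^ k)⁻¹ (heckeU p ^ t)
  have hu (x : ℝ) (hx : x ∈ Z) : u (mob (heckeV p (τ x)) x) = -u (heckeStar p x) := by
    simp only [u]
    rw [← sum_slash_heckeU_pow hp k _ (τ x), ← Finset.sum_neg_distrib]
    simp only [slash_toRatFunc _ (hyperbolicForm p (mob _ x)),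
      hyperbolicForm_mob_heckeV_act hp (hZ x hx).1, inv_pow_toRatFunc_neg hk, slash_neg]
  have htotal : ∑ x ∈ Z, u x = -∑ x ∈ Z, u x := calc
    ∑ x ∈ Z, u x = ∑ x ∈ Z, u (mob (heckeV p (τ x)) x) := (sum_mob_heckeV hp hZ hτ hmem u).symm
    _ = -∑ x ∈ Z, u (heckeStar p x) := by rw [Finset.sum_congr rfl hu, Finset.sum_neg_distrib]
    _ = -∑ x ∈ Z, u x := by rw [sum_heckeStar hp hZ hstar u]
  simp only [formSum, slash_sum]
  rw [Finset.sum_comm]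
  exact self_eq_neg.mp htotal

lemma isRPF_formSum (hk : Odd k)
    (hnext : ∀ x ∈ Z, ∃ t, (1 ≤ t ∧ t < p) ∧ mob (heckeV p t) x ∈ Z)
    (hstar : ∀ x ∈ Z, heckeStar p x ∈ Z) : IsRPF p k (formSum p k Z) :=
  ⟨by rw [slash_formSum_heckeT hp hZ hk hstar, add_neg_cancel],
    sum_slash_heckeU_formSum hp hZ hk hnext hstar⟩

lemma regularAt_formSum {w : ℂ} (h : ∀ x ∈ Z, w ≠ x ∧ w ≠ (heckeConj p x : ℝ)) :
    RegularAt w (formSum p k Z) :=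
  RegularAt.sum _ fun x hx ↦
    regularAt_inv_pow_hyperbolicForm hp (hZ x hx).1 (h x hx).1 (h x hx).2

lemma regularAt_formSum_sub {x : ℝ} (hx : x ∈ Z) :
    RegularAt (x : ℂ) (formSum p k Z - ((hyperbolicForm p x).toRatFunc ^ k)⁻¹) := by
  rw [formSum, ← Finset.add_sum_erase _ _ hx, add_sub_cancel_left]
  refine RegularAt.sum _ fun y hy ↦ ?_
  rw [Finset.mem_erase] at hy
  have hconj := ((hZ y hy.2).heckeConj_neg hp).trans ((hZ x hx).pos hp)
  exact regularAt_inv_pow_hyperbolicForm hp (hZ y hy.2).1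
    (Complex.ofReal_injective.ne hy.1.symm) (Complex.ofReal_injective.ne hconj.ne')

lemma mem_nonzeroPoles_formSum (hk : k ≠ 0) {x : ℝ} (hx : x ∈ Z) :
    (x : ℂ) ∈ nonzeroPoles (formSum p k Z) := by
  rw [mem_nonzeroPoles]
  refine ⟨Complex.ofReal_ne_zero.mpr ((hZ x hx).pos hp).ne', fun h ↦ ?_⟩
  have hterm := h.sub (regularAt_formSum_sub (k := k) hp hZ hx)
  rw [sub_sub_cancel] at hterm
  exact not_regularAt_inv_pow_hyperbolicForm hp (hZ x hx).1 hk hterm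

end FormSum

/-! ### The functions `q_{k,0}` -/

section ZeroPole

variable {p k : ℕ}

lemma slash_one_heckeT (k : ℕ) : slash k 1 heckeT = (RatFunc.X ^ (2 * k))⁻¹ := by
  rw [slash_eq, map_one, mul_one, mobDen_heckeT]

lemma slash_one_heckeU (p k : ℕ) : slash k 1 (heckeU p) = (RatFunc.X ^ (2 * k))⁻¹ := by
  have hS : slash k 1 (heckeS p) = 1 := by
    rw [slash_eq, map_one, mobDen]
    simp [heckeS]
  rw [heckeU, ← slash_slash, hS, slash_one_heckeT]

lemma isRPF_one_sub_inv_X_pow (hp : 3 ≤ p) (k : ℕ) : IsRPF p k (1 - (RatFunc.X ^ (2 * k))⁻¹) := by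
  constructor
  · rw [← slash_one_heckeT, slash_sub, slash_slash, heckeT_mul_self, slash_neg_matrix, slash_one]
    ring
  · rw [← slash_one_heckeU p]
    simp only [slash_sub, slash_slash, ← pow_succ']
    rw [Finset.sum_range_sub' (fun t ↦ slash k 1 (heckeU p ^ t)), heckeU_pow_self hp,
      slash_neg_matrix, pow_zero, sub_self]

lemma slash_inv_X (M : SL(2, ℝ)) :
    slash 1 RatFunc.X⁻¹ M = (mobDen M RatFunc.X * mobNum M RatFunc.X)⁻¹ := by
  have hM := mobDen_X_ne_zero (K := ℂ) M
  rw [slash_eq, map_inv₀, mobComp_X, mob]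
  field_simp

section HeckeU

variable {K : Type*} [Field K] [Algebra ℝ K] (hp : 3 ≤ p) (t : ℕ) (x : K)

include hp

lemma mobNum_heckeU_pow : mobNum (heckeU p ^ t) x = mobDen (heckeU p ^ (t + 1)) x := by
  obtain ⟨h00, h01, -, -⟩ := heckeU_pow_entries hp t
  obtain ⟨-, -, h10, h11⟩ := heckeU_pow_entries hp (t + 1)
  rw [mobNum, mobDen, h00, h01, h10, h11]
  push_cast
  rw [add_sub_cancel_right]

lemma sinRatio_mul_mobDen_sub :
    algebraMap ℝ K (sinRatio p (t + 1)) * mobDen (heckeU p ^ t) x -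
      algebraMap ℝ K (sinRatio p t) * mobDen (heckeU p ^ (t + 1)) x = 1 := by
  obtain ⟨-, -, h10, h11⟩ := heckeU_pow_entries hp t
  have hdet := congrArg (algebraMap ℝ K) (sinRatio_det hp t)
  simp only [map_sub, map_mul, map_one] at hdet
  rw [← mobNum_heckeU_pow hp]
  obtain ⟨h00, h01, -, -⟩ := heckeU_pow_entries hp t
  rw [mobNum, mobDen, h00, h01, h10, h11, map_neg, map_neg]
  linear_combination hdet

end HeckeU

lemma isRPF_inv_X (hp : 3 ≤ p) : IsRPF p 1 RatFunc.X⁻¹ := by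
  constructor
  · have hnum : mobNum heckeT (RatFunc.X : RatFunc ℂ) = -1 := by simp [mobNum, heckeT]
    rw [slash_inv_X, mobDen_heckeT, hnum, mul_neg_one, inv_neg, add_neg_cancel]
  · let F (t : ℕ) : RatFunc ℂ :=
      algebraMap ℝ (RatFunc ℂ) (sinRatio p t) / mobDen (heckeU p ^ t) RatFunc.X
    have hterm (t : ℕ) : slash 1 RatFunc.X⁻¹ (heckeU p ^ t) = F (t + 1) - F t := by
      simp only [F]
      rw [slash_inv_X, mobNum_heckeU_pow hp, div_sub_div _ _ (mobDen_X_ne_zero _)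
        (mobDen_X_ne_zero _), mul_comm (mobDen (heckeU p ^ (t + 1)) _), Nat.cast_succ,
        mul_comm (mobDen (heckeU p ^ (t + 1)) _), sinRatio_mul_mobDen_sub hp, one_div, mul_comm]
    simp only [hterm]
    rw [Finset.sum_range_sub]
    simp [F, sinRatio_self hp]

lemma IsZeroPoleRPF.isRPF (hp : 3 ≤ p) {r : RatFunc ℂ} (h : IsZeroPoleRPF k r) :
    IsRPF p k r := by
  obtain ⟨a₀, b₁, rfl⟩ := h
  refine ((isRPF_one_sub_inv_X_pow hp k).C_mul a₀).add ?_
  split_ifs with hk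
  · exact hk ▸ (isRPF_inv_X hp).C_mul b₁
  · exact IsRPF.zero

lemma regularAt_one_sub_inv_X_pow {w : ℂ} (hw : w ≠ 0) (k : ℕ) :
    RegularAt w (1 - (RatFunc.X ^ (2 * k))⁻¹) :=
  ⟨_, (HasValueAt.one w).sub (((HasValueAt.X w).pow _).inv (pow_ne_zero _ hw))⟩

lemma IsZeroPoleRPF.regularAt {r : RatFunc ℂ} (h : IsZeroPoleRPF k r) {w : ℂ} (hw : w ≠ 0) :
    RegularAt w r := by
  obtain ⟨a₀, b₁, rfl⟩ := h
  refine ((RegularAt.const w a₀).mul (regularAt_one_sub_inv_X_pow hw k)).add ?_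
  split_ifs with hk
  · exact ⟨_, (HasValueAt.const w b₁).mul ((HasValueAt.X w).inv hw)⟩
  · exact RegularAt.zero w

end ZeroPole

/-! ### Rational period functions without nonzero poles -/

section PolynomialPart

variable {K : Type*} [Field K]

lemma exists_polynomial_of_regularAt [IsAlgClosed K] {f : RatFunc K} (h : ∀ w, RegularAt w f) :
    ∃ P : Polynomial K, f = algebraMap (Polynomial K) (RatFunc K) P := by
  have hdeg : f.denom.degree = 0 := by
    by_contra hd
    obtain ⟨w, hw⟩ := IsAlgClosed.exists_root f.denom hd
    exact regularAt_iff.mp (h w) hw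
  have hone : f.denom = 1 :=
    (RatFunc.monic_denom f : f.denom.Monic).degree_le_zero_iff_eq_one.mp hdeg.le
  refine ⟨f.num, ?_⟩
  conv_lhs => rw [← RatFunc.num_div_denom f, hone, map_one, div_one]

lemma add_natDegree_eq_zero_of_aeval_neg_inv_X {P : Polynomial K} {j : ℕ} (hP : P ≠ 0)
    (h : P.aeval (-1 / RatFunc.X : RatFunc K) =
      RatFunc.X ^ j * algebraMap (Polynomial K) (RatFunc K) P) : j + P.natDegree = 0 := by
  have hX : (RatFunc.X : RatFunc K) ≠ 0 := RatFunc.X_ne_zero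
  let _ : Invertible (-1 / RatFunc.X : RatFunc K) :=
    ⟨-RatFunc.X, by field_simp, by field_simp⟩
  have hrev : (-Polynomial.X) ^ P.natDegree * (Polynomial.X ^ j * P) =
      P.reverse.comp (-Polynomial.X) := by
    refine RatFunc.algebraMap_injective K ?_
    have hcomp : algebraMap (Polynomial K) (RatFunc K) (P.reverse.comp (-Polynomial.X)) =
        Polynomial.aeval (-RatFunc.X) P.reverse := by
      rw [Polynomial.comp_eq_aeval, ← Polynomial.aeval_algebraMap_apply, map_neg,
        RatFunc.algebraMap_X]
    have heval : P.reverse.aeval (-RatFunc.X : RatFunc K) * (-1 / RatFunc.X) ^ P.natDegree =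
        P.aeval (-1 / RatFunc.X) :=
      Polynomial.eval₂_reverse_mul_pow (algebraMap K (RatFunc K)) (-1 / RatFunc.X) P
    simp only [map_mul, map_pow, map_neg, RatFunc.algebraMap_X]
    rw [hcomp, ← h, ← heval, mul_left_comm, ← mul_pow]
    field_simp
    simp
  have hdeg := congrArg Polynomial.natDegree hrev
  rw [Polynomial.natDegree_mul (by simp) (by simp [hP]),
    Polynomial.natDegree_mul (by simp) hP, Polynomial.natDegree_pow,
    Polynomial.natDegree_X_pow, Polynomial.natDegree_comp, Polynomial.natDegree_neg,
    Polynomial.natDegree_X] at hdeg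
  have := P.reverse_natDegree_le
  omega

end PolynomialPart

section Parabolic

lemma HasValueAt.exists_eq_C_add_X_sub_C_mul {K : Type*} [Field K] {w v : K} {f : RatFunc K}
    (h : HasValueAt w f v) :
    ∃ g, RegularAt w g ∧ f = RatFunc.C v + (RatFunc.X - RatFunc.C w) * g := by
  have hsub := h.sub (.const w v)
  rw [sub_self] at hsub
  obtain ⟨g, hg, hfg⟩ := hsub.exists_eq_X_sub_C_mul
  exact ⟨g, hg, by rw [← hfg, add_sub_cancel]⟩

lemma exists_pow_sub_pow_eq_X_sub_C_mul {K : Type*} [Field K] {w a : K} {E : RatFunc K}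
    (hE : E - 1 = (RatFunc.X - RatFunc.C w) * RatFunc.C a) (m n : ℕ) :
    ∃ G, HasValueAt w G (a * (m - n)) ∧ E ^ m - E ^ n = (RatFunc.X - RatFunc.C w) * G := by
  have hEw : HasValueAt w E 1 := by
    rw [sub_eq_iff_eq_add.mp hE]
    simpa using ((hasValueAt_X_sub_C_self w).mul (.const w a)).add (.one w)
  have hgeom (i : ℕ) : HasValueAt w (∑ j ∈ Finset.range i, E ^ j) i := by
    induction i with
    | zero => simpa using HasValueAt.zero w
    | succ i ih => simpa [Finset.sum_range_succ] using ih.add (hEw.pow i)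
  refine ⟨_, (HasValueAt.const w a).mul ((hgeom m).sub (hgeom n)), ?_⟩
  linear_combination (∑ j ∈ Finset.range m, E ^ j - ∑ j ∈ Finset.range n, E ^ j) * hE -
    geom_sum_mul E m + geom_sum_mul E n

lemma mobDen_X_mul_mobDen_sub_one {R K : Type*} [CommRing R] [Field K] [Algebra R K]
    {M : SL(2, R)} {w : K} (hd : mobDen M w ^ 2 = 1) :
    mobDen M RatFunc.X * RatFunc.C (mobDen M w) - 1 =
      (RatFunc.X - RatFunc.C w) * RatFunc.C (algebraMap R K (M 1 0) * mobDen M w) := by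
  rw [← map_one RatFunc.C, ← hd, sq, map_mul, ← sub_mul, map_mul, ← mul_assoc]
  congr 1
  rw [← mobDen_C]
  simp only [mobDen, algebraMap_ratFunc]
  ring

variable {k n : ℕ} {M : SL(2, ℝ)} {w v : ℂ} {f : RatFunc ℂ}

-- With `E = ε (c X + d)`, where `ε = c w + d = ±1`, the leading coefficient of `f ∣ M - f` is that
-- of `E ^ n - E ^ (2 k)`, which vanishes at `w` to first order only.
lemma HasValueAt.eq_zero_of_parabolic (hd : mobDen M w ^ 2 = 1) (hw : mob M w = w)
    (hc : M 1 0 ≠ 0) (hn : 1 < n) (hnk : n ≠ 2 * k)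
    (h : HasValueAt w ((RatFunc.X - RatFunc.C w) ^ n * f) v)
    (hf : RegularAt w (slash k f M - f)) : v = 0 := by
  obtain ⟨n, rfl⟩ := Nat.exists_eq_add_of_le' hn.le
  have hd0 : mobDen M w ≠ 0 := ne_zero_pow two_ne_zero (hd ▸ one_ne_zero)
  set E : RatFunc ℂ := mobDen M RatFunc.X * RatFunc.C (mobDen M w) with hE
  have hE0 : E ≠ 0 := mul_ne_zero (mobDen_X_ne_zero M) ((map_ne_zero _).mpr hd0)
  have hEw : HasValueAt w E 1 := by
    simpa only [← hd, sq] using (hasValueAt_mobDen_X M w).mul (.const w (mobDen M w))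
  have hEk : E ^ (2 * k) = mobDen M RatFunc.X ^ (2 * k) := by
    rw [hE, mul_pow, ← map_pow, pow_mul (mobDen M w), hd, one_pow, map_one, mul_one]
  obtain ⟨g, ⟨u, hg⟩, hfg⟩ := h.exists_eq_C_add_X_sub_C_mul
  obtain ⟨G, hG, hGE⟩ := exists_pow_sub_pow_eq_X_sub_C_mul
    (mobDen_X_mul_mobDen_sub_one hd) (n + 1) (2 * k)
  have hkey : E ^ (2 * k) * ((RatFunc.X - RatFunc.C w) ^ n * (slash k f M - f)) =
      RatFunc.C v * G + (E ^ n * mobComp M g - E ^ (2 * k) * g) := by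
    refine mul_left_cancel₀ (X_sub_C_ne_zero w) ?_
    have hslash := X_sub_C_pow_mul_slash k (n + 1) f hd0 hw
    rw [hfg, map_add, mobComp_C, map_mul, mobComp_X_sub_C hd0 hw, ← hE, ← hEk, mul_assoc,
      eq_inv_mul_iff_mul_eq₀ (pow_ne_zero _ hE0)] at hslash
    have hcancel : E ^ (n + 1) * ((RatFunc.X - RatFunc.C w) / E) =
        E ^ n * (RatFunc.X - RatFunc.C w) := by
      rw [pow_succ]
      field_simp
    linear_combination hslash - E ^ (2 * k) * hfg + RatFunc.C v * hGE + mobComp M g * hcancel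
  have hleft := (hEw.pow (2 * k)).mul (hf.hasValueAt_X_sub_C_pow_mul (n := n) (by omega))
  have hright := ((HasValueAt.const w v).mul hG).add (((hEw.pow n).mul
    (HasValueAt.mobComp hd0 (hw.symm ▸ hg))).sub ((hEw.pow (2 * k)).mul hg))
  have hval := (hkey ▸ hleft).unique hright
  rw [mul_zero, one_pow, one_pow, sub_self, add_zero, eq_comm] at hval
  exact (mul_eq_zero.mp hval).resolve_right (mul_ne_zero (mul_ne_zero
    (Complex.ofReal_ne_zero.mpr hc) hd0) (sub_ne_zero.mpr (Nat.cast_injective.ne hnk)))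

end Parabolic

section ZeroPole

variable {p k : ℕ}

lemma regularAt_of_nonzeroPoles_eq_empty {q : RatFunc ℂ} (h0 : nonzeroPoles q = ∅) {w : ℂ}
    (hw : w ≠ 0) : RegularAt w q := by
  by_contra hq
  exact h0.subset (mem_nonzeroPoles.mpr ⟨hw, hq⟩)

lemma heckeT_mul_heckeU_entries (p : ℕ) :
    (heckeT * heckeU p) 0 0 = -1 ∧ (heckeT * heckeU p) 0 1 = 0 ∧
      (heckeT * heckeU p) 1 0 = heckeLambda p ∧ (heckeT * heckeU p) 1 1 = -1 := by
  obtain ⟨h00, h01, h10, h11⟩ := heckeU_entries p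
  simp only [mul_zero_zero, mul_zero_one, mul_one_zero, mul_one_one, h00, h01, h10, h11]
  simp [heckeT]

lemma IsRPF.regularAt_slash_heckeT_mul_heckeU_sub (hp : 3 ≤ p) {q : RatFunc ℂ} (h : IsRPF p k q)
    (h0 : nonzeroPoles q = ∅) : RegularAt 0 (slash k q (heckeT * heckeU p) - q) := by
  have hsum := h.2
  rw [Finset.range_eq_Ico, Finset.sum_eq_sum_Ico_succ_bot (by omega),
    Finset.sum_eq_sum_Ico_succ_bot (by omega), pow_zero, slash_one, pow_one,
    ← add_assoc, add_comm q] at hsum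
  rw [← slash_slash, h.slash_heckeT, slash_neg, ← neg_add', eq_neg_of_add_eq_zero_left hsum,
    neg_neg]
  refine RegularAt.sum _ fun t ht ↦ ?_
  rw [Finset.mem_Ico] at ht
  obtain ⟨-, h01, -, h11⟩ := heckeU_pow_entries hp t
  have ht1 : (2 : ℝ) ≤ t := by exact_mod_cast ht.1
  have ht2 : (t : ℝ) < p := by exact_mod_cast ht.2
  have hnum : mobNum (heckeU p ^ t) (0 : ℂ) ≠ 0 := by
    simpa [mobNum, h01] using (sinRatio_pos hp (t := t) (by linarith) (by linarith)).ne'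
  have hden : mobDen (heckeU p ^ t) (0 : ℂ) ≠ 0 := by
    simpa [mobDen, h11] using (sinRatio_pos hp (t := t - 1) (by linarith) (by linarith)).ne'
  exact RegularAt.slash k hden (regularAt_of_nonzeroPoles_eq_empty h0
    (div_ne_zero hnum hden))

lemma IsRPF.exists_regularAt_X_mul_sub (hp : 3 ≤ p) (hk : k ≠ 0) {q : RatFunc ℂ}
    (h : IsRPF p k q) (h0 : nonzeroPoles q = ∅) :
    ∃ c : ℂ, RegularAt 0 (RatFunc.X * (q - RatFunc.C c * (1 - (RatFunc.X ^ (2 * k))⁻¹))) := by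
  set e : RatFunc ℂ := 1 - (RatFunc.X ^ (2 * k))⁻¹ with he
  have heRPF : IsRPF p k e := isRPF_one_sub_inv_X_pow hp k
  have he0 : nonzeroPoles e = ∅ := Set.eq_empty_iff_forall_notMem.mpr fun w hw ↦
    (mem_nonzeroPoles.mp hw).2 (regularAt_one_sub_inv_X_pow hw.1 k)
  have hX0 : (RatFunc.X : RatFunc ℂ) - RatFunc.C 0 = RatFunc.X := by rw [map_zero, sub_zero]
  have heval : HasValueAt 0 ((RatFunc.X - RatFunc.C 0) ^ (2 * k) * e) (-1) := by
    have hval := ((HasValueAt.X (0 : ℂ)).pow (2 * k)).sub (.one 0)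
    rw [zero_pow (by omega), zero_sub] at hval
    rwa [hX0, he, mul_sub, mul_one, mul_inv_cancel₀ (pow_ne_zero _ RatFunc.X_ne_zero)]
  obtain ⟨-, h01, h10, h11⟩ := heckeT_mul_heckeU_entries p
  have hden : mobDen (heckeT * heckeU p) (0 : ℂ) ^ 2 = 1 := by simp [mobDen, h11]
  have hmob : mob (heckeT * heckeU p) (0 : ℂ) = 0 := by simp [mob, mobNum, h01]
  have hc : (heckeT * heckeU p) 1 0 ≠ 0 := h10 ▸ (heckeLambda_pos hp).ne'
  obtain ⟨c, hc⟩ := exists_regularAt_X_sub_C_pow_mul_sub (b := 1)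
    (S := fun g ↦ RegularAt 0 (slash k g (heckeT * heckeU p) - g))
    (fun c g hg ↦ by
      rw [slash_sub, slash_C_mul, sub_sub_sub_comm, ← mul_sub]
      exact hg.sub ((RegularAt.const 0 c).mul
        (heRPF.regularAt_slash_heckeT_mul_heckeU_sub hp he0)))
    (neg_ne_zero.mpr one_ne_zero) heval
    (fun n g v hn hnk hg hv ↦ hv.eq_zero_of_parabolic hden hmob hc hn hnk hg)
    (h.regularAt_slash_heckeT_mul_heckeU_sub hp h0)
  exact ⟨c, by rwa [pow_one, hX0] at hc⟩

lemma IsRPF.eq_of_regularAt_X_mul (hk : k ≠ 0) {f : RatFunc ℂ} (h : IsRPF p k f)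
    (hf : ∀ w, RegularAt w (RatFunc.X * f)) :
    ∃ b : ℂ, f = if k = 1 then RatFunc.C b * RatFunc.X⁻¹ else 0 := by
  obtain ⟨P, hP⟩ := exists_polynomial_of_regularAt hf
  have hX : (RatFunc.X : RatFunc ℂ) ≠ 0 := RatFunc.X_ne_zero
  obtain rfl : f = RatFunc.X⁻¹ * algebraMap (Polynomial ℂ) (RatFunc ℂ) P := by
    rw [← hP, inv_mul_cancel_left₀ hX]
  have heval : P.aeval (-1 / RatFunc.X : RatFunc ℂ) =
      RatFunc.X ^ (2 * (k - 1)) * algebraMap (Polynomial ℂ) (RatFunc ℂ) P := by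
    have hT := h.slash_heckeT
    obtain ⟨k, rfl⟩ := Nat.exists_eq_succ_of_ne_zero hk
    rw [slash_eq, mobDen_heckeT, map_mul, map_inv₀, mobComp_algebraMap, mobComp_X, mob_heckeT,
      inv_mul_eq_iff_eq_mul₀ (pow_ne_zero _ hX)] at hT
    refine mul_left_cancel₀ (pow_ne_zero 2 hX) ?_
    rw [Nat.succ_sub_one, ← mul_assoc, ← pow_add, add_comm 2, ← Nat.mul_succ]
    generalize P.aeval (-1 / RatFunc.X : RatFunc ℂ) = A at hT ⊢
    field_simp at hT
    linear_combination -hT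
  rcases eq_or_ne P 0 with rfl | hP0
  · exact ⟨0, by simp⟩
  · have hdeg := add_natDegree_eq_zero_of_aeval_neg_inv_X hP0 heval
    obtain rfl : k = 1 := by omega
    refine ⟨P.coeff 0, ?_⟩
    rw [Polynomial.eq_C_of_natDegree_eq_zero (p := P) (by omega)]
    simp [mul_comm]

lemma IsRPF.isZeroPoleRPF (hp : 3 ≤ p) (hk : k ≠ 0) {q : RatFunc ℂ} (h : IsRPF p k q)
    (h0 : nonzeroPoles q = ∅) : IsZeroPoleRPF k q := by
  obtain ⟨c, hc⟩ := h.exists_regularAt_X_mul_sub hp hk h0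
  obtain ⟨b, hb⟩ := (h.sub ((isRPF_one_sub_inv_X_pow hp k).C_mul c)).eq_of_regularAt_X_mul hk
    fun w ↦ by
      rcases eq_or_ne w 0 with rfl | hw
      · exact hc
      · exact RegularAt.mul ⟨_, .X w⟩ ((regularAt_of_nonzeroPoles_eq_empty h0 hw).sub
          ((RegularAt.const w c).mul (regularAt_one_sub_inv_X_pow hw k)))
  exact ⟨c, b, by rw [← hb, add_sub_cancel]⟩

end ZeroPole

/-! ### Sums over classes -/

section FormSumPoles

variable {p k : ℕ} (hp : 3 ≤ p) {Z : Finset ℝ} (hZ : ∀ x ∈ Z, IsSimple p x)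
  (hstar : ∀ x ∈ Z, heckeStar p x ∈ Z)

include hp hZ hstar

lemma exists_mem_of_not_regularAt_formSum {w : ℂ} (h : ¬ RegularAt w (formSum p k Z)) :
    ∃ x ∈ Z, w = (x : ℂ) ∨ w = ((-1 / x : ℝ) : ℂ) := by
  by_contra! hw
  refine h (regularAt_formSum hp hZ fun x hx ↦ ⟨(hw x hx).1, ?_⟩)
  rw [← neg_one_div_heckeStar]
  exact (hw _ (hstar x hx)).2

lemma nonzeroPoles_formSum (hk : Odd k)
    (hnext : ∀ x ∈ Z, ∃ t, (1 ≤ t ∧ t < p) ∧ mob (heckeV p t) x ∈ Z) :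
    nonzeroPoles (formSum p k Z) = {w | ∃ x ∈ Z, w = (x : ℂ) ∨ w = ((-1 / x : ℝ) : ℂ)} := by
  refine Set.Subset.antisymm
    (fun w hw ↦ exists_mem_of_not_regularAt_formSum hp hZ hstar (mem_nonzeroPoles.mp hw).2) ?_
  rintro w ⟨x, hx, rfl | rfl⟩
  · exact mem_nonzeroPoles_formSum hp hZ hk.pos.ne' hx
  · simpa using (isRPF_formSum hp hZ hk hnext hstar).neg_one_div_mem
      (mem_nonzeroPoles_formSum hp hZ hk.pos.ne' hx)

end FormSumPoles

section ClassSum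

variable {p k : ℕ} (hp : 3 ≤ p) (hk : Odd k) {𝒜 : Set BQF} (h : IsFormClass p 𝒜)

open Classical in
/-- The finite set `Z_𝒜 ∪ Z_{-𝒜}`, on which `x ↦ -1 / x'` acts. When `-𝒜 = 𝒜` it is `Z_𝒜`, so both
kinds of sums over classes in the theorem are sums over such sets. -/
def symmetricNumbers : Finset ℝ :=
  (simpleNumbers_finite hp h).toFinset ∪ (simpleNumbers_finite hp h.negClass).toFinset

variable {x : ℝ}

lemma coe_symmetricNumbers :
    (symmetricNumbers hp h : Set ℝ) = simpleNumbers p 𝒜 ∪ simpleNumbers p (negClass 𝒜) := by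
  rw [symmetricNumbers, Finset.coe_union, Set.Finite.coe_toFinset, Set.Finite.coe_toFinset]

lemma mem_symmetricNumbers :
    x ∈ symmetricNumbers hp h ↔ x ∈ simpleNumbers p 𝒜 ∨ x ∈ simpleNumbers p (negClass 𝒜) := by
  rw [← Finset.mem_coe, coe_symmetricNumbers, Set.mem_union]

lemma mem_symmetricNumbers_of_negClass_eq (hneg : negClass 𝒜 = 𝒜) :
    x ∈ symmetricNumbers hp h ↔ x ∈ simpleNumbers p 𝒜 := by
  rw [mem_symmetricNumbers, hneg, or_self]

lemma isSimple_of_mem_symmetricNumbers (hx : x ∈ symmetricNumbers hp h) : IsSimple p x := by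
  rcases (mem_symmetricNumbers hp h).mp hx with hx | hx <;> exact (mem_simpleNumbers.mp hx).1

lemma heckeStar_mem_symmetricNumbers (hx : x ∈ symmetricNumbers hp h) :
    heckeStar p x ∈ symmetricNumbers hp h := by
  rw [mem_symmetricNumbers] at hx ⊢
  rcases hx with hx | hx
  · exact Or.inr (heckeStar_mem_negClass hp h hx)
  · exact Or.inl (negClass_negClass 𝒜 ▸ heckeStar_mem_negClass hp h.negClass hx)

lemma exists_mob_heckeV_mem_symmetricNumbers (hx : x ∈ symmetricNumbers hp h) :
    ∃ t, (1 ≤ t ∧ t < p) ∧ mob (heckeV p t) x ∈ symmetricNumbers hp h := by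
  simp only [mem_symmetricNumbers] at hx ⊢
  rcases hx with hx | hx
  · obtain ⟨t, ht, hx⟩ := mem_simpleNumbers_next hp h hx
    exact ⟨t, ht, Or.inl hx⟩
  · obtain ⟨t, ht, hx⟩ := mem_simpleNumbers_next hp h.negClass hx
    exact ⟨t, ht, Or.inr hx⟩

lemma classSum_eq_formSum_symmetricNumbers (hneg : negClass 𝒜 = 𝒜) :
    classSum p k 𝒜 = formSum p k (symmetricNumbers hp h) := by
  rw [classSum, formSum, ← finsum_mem_coe_finset, coe_symmetricNumbers, hneg, Set.union_self]

lemma classSum_add_classSum_negClass (hneg : negClass 𝒜 ≠ 𝒜) :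
    classSum p k 𝒜 + classSum p k (negClass 𝒜) = formSum p k (symmetricNumbers hp h) := by
  have hdisj : Disjoint (simpleNumbers p 𝒜) (simpleNumbers p (negClass 𝒜)) := by
    refine Set.disjoint_left.mpr fun x hx hx' ↦ hneg ?_
    exact h.negClass.eq_of_mem h (mem_simpleNumbers.mp hx').2 (mem_simpleNumbers.mp hx).2
  rw [formSum, ← finsum_mem_coe_finset, coe_symmetricNumbers]
  exact (finsum_mem_union hdisj (simpleNumbers_finite hp h)
    (simpleNumbers_finite hp h.negClass)).symm

include hk in
lemma isRPF_formSum_symmetricNumbers : IsRPF p k (formSum p k (symmetricNumbers hp h)) :=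
  isRPF_formSum hp (fun _ ↦ isSimple_of_mem_symmetricNumbers hp h) hk
    (fun _ ↦ exists_mob_heckeV_mem_symmetricNumbers hp h)
    fun _ ↦ heckeStar_mem_symmetricNumbers hp h

include hk in
lemma nonzeroPoles_formSum_symmetricNumbers : nonzeroPoles (formSum p k (symmetricNumbers hp h)) =
    {w | ∃ x ∈ symmetricNumbers hp h, w = (x : ℂ) ∨ w = ((-1 / x : ℝ) : ℂ)} :=
  nonzeroPoles_formSum hp (fun _ ↦ isSimple_of_mem_symmetricNumbers hp h)
    (fun _ ↦ heckeStar_mem_symmetricNumbers hp h) hk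
    fun _ ↦ exists_mob_heckeV_mem_symmetricNumbers hp h

include hp h

lemma heckeStar_mem_simpleNumbers (hneg : negClass 𝒜 = 𝒜) (hx : x ∈ simpleNumbers p 𝒜) :
    heckeStar p x ∈ simpleNumbers p 𝒜 := by
  have hstar := heckeStar_mem_negClass hp h hx
  rwa [hneg] at hstar

lemma isRPF_classSum (hk : Odd k) (hneg : negClass 𝒜 = 𝒜) : IsRPF p k (classSum p k 𝒜) :=
  classSum_eq_formSum_symmetricNumbers hp h hneg ▸ isRPF_formSum_symmetricNumbers hp hk h

lemma regularAt_classSum (hneg : negClass 𝒜 = 𝒜) {w : ℂ} (hw : w ∉ poleSystem p 𝒜) :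
    RegularAt w (classSum p k 𝒜) := by
  rw [classSum_eq_formSum_symmetricNumbers hp h hneg]
  by_contra hreg
  obtain ⟨x, hx, hwx⟩ := exists_mem_of_not_regularAt_formSum hp
    (fun _ ↦ isSimple_of_mem_symmetricNumbers hp h)
    (fun _ ↦ heckeStar_mem_symmetricNumbers hp h) hreg
  exact hw ⟨x, (mem_symmetricNumbers_of_negClass_eq hp h hneg).mp hx, hwx⟩

lemma regularAt_classSum_sub (hneg : negClass 𝒜 = 𝒜) (hx : x ∈ simpleNumbers p 𝒜) :
    RegularAt (x : ℂ) (classSum p k 𝒜 - ((hyperbolicForm p x).toRatFunc ^ k)⁻¹) := by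
  rw [classSum_eq_formSum_symmetricNumbers hp h hneg]
  exact regularAt_formSum_sub hp (fun _ ↦ isSimple_of_mem_symmetricNumbers hp h)
    ((mem_symmetricNumbers_of_negClass_eq hp h hneg).mpr hx)

lemma isRPF_classSum_add (hk : Odd k) (hneg : negClass 𝒜 ≠ 𝒜) :
    IsRPF p k (classSum p k 𝒜 + classSum p k (negClass 𝒜)) :=
  classSum_add_classSum_negClass hp h hneg ▸ isRPF_formSum_symmetricNumbers hp hk h

lemma heckeSymmetric_nonzeroPoles_classSum_add (hk : Odd k) (hneg : negClass 𝒜 ≠ 𝒜) :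
    HeckeSymmetric p (nonzeroPoles (classSum p k 𝒜 + classSum p k (negClass 𝒜))) := by
  rw [classSum_add_classSum_negClass hp h hneg, nonzeroPoles_formSum_symmetricNumbers hp hk h]
  exact heckeSymmetric_of_heckeStar_mem hp (Z := symmetricNumbers hp h)
    (fun _ ↦ isSimple_of_mem_symmetricNumbers hp h)
    fun _ ↦ heckeStar_mem_symmetricNumbers hp h

lemma poleSystem_subset_nonzeroPoles_classSum_add (hk : Odd k) (hneg : negClass 𝒜 ≠ 𝒜) :
    poleSystem p 𝒜 ⊆ nonzeroPoles (classSum p k 𝒜 + classSum p k (negClass 𝒜)) := by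
  rw [classSum_add_classSum_negClass hp h hneg, nonzeroPoles_formSum_symmetricNumbers hp hk h]
  rintro w ⟨x, hx, hwx⟩
  exact ⟨x, (mem_symmetricNumbers hp h).mpr (Or.inl hx), hwx⟩

end ClassSum

/-! ### Hecke-symmetric irreducible systems of poles -/

section HasSymmetricForm

variable {p k : ℕ} {q : RatFunc ℂ} {𝒜 : Set BQF} {x : ℝ}

lemma HasSymmetricForm.add_C_mul_classSum (hq : HasSymmetricForm p k q) (c : ℂ)
    (h : IsHyperbolicClass p 𝒜) (hneg : negClass 𝒜 = 𝒜) :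
    HasSymmetricForm p k (q + RatFunc.C c * classSum p k 𝒜) := by
  obtain ⟨L, d, ℬ, c₀, r, hℬ, hr, rfl⟩ := hq
  refine ⟨L + 1, Fin.cons c d, Fin.cons 𝒜 ℬ, c₀, r, Fin.cases ⟨h, hneg⟩ hℬ, hr, ?_⟩
  rw [Fin.sum_univ_succ]
  simp only [Fin.cons_zero, Fin.cons_succ]
  ring

lemma IsRPF.exists_regularAt_sub_C_mul_inv_pow (hp : 3 ≤ p) (h : IsRPF p k q)
    (hx : IsSimple p x) (hmem : (x : ℂ) ∈ nonzeroPoles q) :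
    ∃ c : ℂ, RegularAt (x : ℂ)
      (q - RatFunc.C c * ((hyperbolicForm p x).toRatFunc ^ k)⁻¹) := by
  have hpos := hx.pos hp
  obtain ⟨l, hl, hne, hfix, hreg⟩ :=
    h.exists_word_fixing_pole hp hmem (rightHalf_ofReal.mpr hpos)
  have hfix' : mob (wordProd p l) x = x := by
    rwa [mob_ofReal, Complex.ofReal_inj] at hfix
  have hact : (hyperbolicForm p x).act (wordProd p l) = hyperbolicForm p x := by
    have hmob := hyperbolicForm_mob hp hx.1 (wordProd_mem (p := p) l)
    rw [hfix'] at hmob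
    conv_lhs => rw [hmob, BQF.act_inv_act]
  obtain ⟨u, hu, hval⟩ := exists_hasValueAt_inv_pow_hyperbolicForm k hp hx.1
  have hnorm : 1 < ‖mobDen (wordProd p l) (x : ℂ)‖ := by
    rw [mobDen_ofReal, Complex.norm_real]
    exact (isAttracting_wordProd hp hl hne hpos hfix').2
  exact exists_regularAt_sub_C_mul hnorm hfix (by rw [slash_toRatFunc, hact]) hu hval
    (by simpa using hreg.neg)

lemma IsRPF.exists_nonzeroPoles_sub_ssubset (hp : 3 ≤ p) (h : IsRPF p k q)
    (h𝒜 : IsFormClass p 𝒜) (hneg : negClass 𝒜 = 𝒜) (hx : x ∈ simpleNumbers p 𝒜)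
    (hmem : (x : ℂ) ∈ nonzeroPoles q) :
    ∃ c : ℂ, nonzeroPoles (q - RatFunc.C c * classSum p k 𝒜) ⊂ nonzeroPoles q := by
  obtain ⟨c, hc⟩ := h.exists_regularAt_sub_C_mul_inv_pow hp (mem_simpleNumbers.mp hx).1 hmem
  have hregular : RegularAt (x : ℂ) (q - RatFunc.C c * classSum p k 𝒜) := by
    convert hc.sub ((RegularAt.const (x : ℂ) c).mul (regularAt_classSum_sub hp h𝒜 hneg hx))
      using 1
    ring
  refine ⟨c, fun v hv ↦ ?_, fun hle ↦ (mem_nonzeroPoles.mp (hle hmem)).2 hregular⟩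
  rw [mem_nonzeroPoles] at hv
  by_contra hvq
  have hvreg : RegularAt v q := by
    by_contra hvreg
    exact hvq (mem_nonzeroPoles.mpr ⟨hv.1, hvreg⟩)
  exact hv.2 (hvreg.sub ((RegularAt.const v c).mul (regularAt_classSum hp h𝒜 hneg
    fun hvP ↦ hvq (h.poleSystem_subset hp h𝒜 hx hmem hvP))))

lemma IsRPF.hasSymmetricForm (hp : 3 ≤ p) (hk : Odd k) (h : IsRPF p k q)
    (hs : ∀ P, IsISPOf p q P → HeckeSymmetric p P) : HasSymmetricForm p k q := by
  induction hn : (nonzeroPoles q).ncard using Nat.strong_induction_on generalizing q with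
  | _ n ih =>
    rcases (nonzeroPoles q).eq_empty_or_nonempty with h0 | ⟨w, hw⟩
    · exact ⟨0, Fin.elim0, Fin.elim0, 1, q, fun l ↦ l.elim0,
        h.isZeroPoleRPF hp hk.pos.ne' h0, by simp⟩
    obtain ⟨x, hx, hmem, -⟩ := h.exists_simple_pole hp hw
    have h𝒜 := isHyperbolicClass_formClass hp hx.1
    have hxZ : x ∈ simpleNumbers p (formClass p x) :=
      mem_simpleNumbers.mpr ⟨hx, hyperbolicForm_mem_formClass x⟩
    have hneg := negClass_eq_of_heckeSymmetric hp h𝒜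
      (hs _ ⟨_, h𝒜, rfl, h.poleSystem_subset hp h𝒜.1 hxZ hmem⟩)
    obtain ⟨c, hss⟩ := h.exists_nonzeroPoles_sub_ssubset hp h𝒜.1 hneg hxZ hmem
    have hrest : HasSymmetricForm p k (q - RatFunc.C c * classSum p k (formClass p x)) := by
      refine ih _ (hn ▸ Set.ncard_lt_ncard hss (nonzeroPoles_finite q))
        (h.sub ((isRPF_classSum hp h𝒜.1 hk hneg).C_mul c)) ?_ rfl
      rintro P ⟨ℬ, hℬ, hP, hsub⟩
      exact hs P ⟨ℬ, hℬ, hP, hsub.trans hss.subset⟩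
    simpa only [sub_add_cancel] using hrest.add_C_mul_classSum c h𝒜 hneg

/-! ### The converse -/

lemma IsRPF.heckeSymmetric_nonzeroPoles (hp : 3 ≤ p) (h : IsRPF p k q)
    (hstar : ∀ x, IsSimple p x → (x : ℂ) ∈ nonzeroPoles q →
      ((heckeStar p x : ℝ) : ℂ) ∈ nonzeroPoles q) : HeckeSymmetric p (nonzeroPoles q) := by
  have hpoles : nonzeroPoles q =
      {w | ∃ x ∈ {x : ℝ | IsSimple p x ∧ (x : ℂ) ∈ nonzeroPoles q},
        w = (x : ℂ) ∨ w = ((-1 / x : ℝ) : ℂ)} := by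
    ext w
    constructor
    · intro hw
      obtain ⟨x, hx, hmem, hwx⟩ := h.exists_simple_pole hp hw
      exact ⟨x, ⟨hx, hmem⟩, hwx⟩
    · rintro ⟨x, ⟨-, hmem⟩, rfl | rfl⟩
      · exact hmem
      · simpa using h.neg_one_div_mem hmem
  rw [hpoles]
  exact heckeSymmetric_of_heckeStar_mem hp (fun x hx ↦ hx.1)
    fun x hx ↦ ⟨hx.1.heckeStar hp, hstar x hx.1 hx.2⟩

lemma mem_simpleNumbers_of_mem_poleSystem (hp : 3 ≤ p) (hx : 0 < x)
    (h : (x : ℂ) ∈ poleSystem p 𝒜) : x ∈ simpleNumbers p 𝒜 := by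
  obtain ⟨y, hy, hxy | hxy⟩ := h <;> rw [Complex.ofReal_inj] at hxy
  · rwa [hxy]
  · have hy0 : -1 / y < 0 :=
      div_neg_of_neg_of_pos (by norm_num) ((mem_simpleNumbers.mp hy).1.pos hp)
    exact absurd hx (hxy ▸ hy0).not_gt

lemma HasSymmetricForm.isRPF (hp : 3 ≤ p) (hk : Odd k) (h : HasSymmetricForm p k q) :
    IsRPF p k q := by
  obtain ⟨L, d, 𝒜, c₀, r, h𝒜, hr, rfl⟩ := h
  exact (IsRPF.sum _ fun l _ ↦ (isRPF_classSum hp (h𝒜 l).1.1 hk (h𝒜 l).2).C_mul (d l)).add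
    ((hr.isRPF hp).C_mul c₀)

lemma HasSymmetricForm.exists_mem_poleSystem (hp : 3 ≤ p) (h : HasSymmetricForm p k q) {w : ℂ}
    (hw : w ∈ nonzeroPoles q) :
    ∃ 𝒜, IsHyperbolicClass p 𝒜 ∧ negClass 𝒜 = 𝒜 ∧ w ∈ poleSystem p 𝒜 := by
  obtain ⟨L, d, 𝒜, c₀, r, h𝒜, hr, rfl⟩ := h
  rw [mem_nonzeroPoles] at hw
  by_contra! hcon
  exact hw.2 ((RegularAt.sum _ fun l _ ↦ (RegularAt.const _ (d l)).mul
    (regularAt_classSum hp (h𝒜 l).1.1 (h𝒜 l).2 (hcon _ (h𝒜 l).1 (h𝒜 l).2))).add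
    ((RegularAt.const _ c₀).mul (hr.regularAt hw.1)))

lemma HasSymmetricForm.heckeSymmetric_nonzeroPoles (hp : 3 ≤ p) (hk : Odd k)
    (h : HasSymmetricForm p k q) : HeckeSymmetric p (nonzeroPoles q) := by
  have hq := h.isRPF hp hk
  refine hq.heckeSymmetric_nonzeroPoles hp fun x hx hmem ↦ ?_
  obtain ⟨𝒜, h𝒜, hneg, hxP⟩ := h.exists_mem_poleSystem hp hmem
  have hxZ := mem_simpleNumbers_of_mem_poleSystem hp (hx.pos hp) hxP
  exact hq.poleSystem_subset hp h𝒜.1 hxZ hmem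
    ⟨_, heckeStar_mem_simpleNumbers hp h𝒜.1 hneg hxZ, Or.inl rfl⟩

end HasSymmetricForm

/-! ### The modular group and the class of `√3` -/

lemma heckeLambda_three : heckeLambda 3 = 1 := by
  rw [heckeLambda, Nat.cast_ofNat, Real.cos_pi_div_three, mul_one_div_cancel two_ne_zero]

lemma exists_intCast_eq_of_mem_heckeGroup_three {M : SL(2, ℝ)} (hM : M ∈ heckeGroup 3)
    (i j : Fin 2) : ∃ n : ℤ, M i j = n := by
  have hmem := entry_mem_adjoin hM i j
  rw [heckeLambda_three, Algebra.adjoin_singleton_one, Algebra.mem_bot] at hmem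
  obtain ⟨n, hn⟩ := hmem
  exact ⟨n, by rw [← hn, eq_intCast]⟩

lemma wordProd_three_entries : wordProd 3 [1, 2, 1] 0 0 = 2 ∧ wordProd 3 [1, 2, 1] 0 1 = 3 ∧
    wordProd 3 [1, 2, 1] 1 0 = 1 ∧ wordProd 3 [1, 2, 1] 1 1 = 2 := by
  have s2 : sinRatio 3 2 = 1 := by
    simpa [show (3 : ℝ) - 1 = 2 by norm_num] using sinRatio_sub_one (p := 3) le_rfl
  have s3 : sinRatio 3 3 = 0 := by simpa using sinRatio_self (p := 3) le_rfl
  have s1 := sinRatio_one (p := 3) le_rfl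
  obtain ⟨a, b, c, d⟩ := heckeV_entries le_rfl 1
  obtain ⟨e, f, g, h⟩ := heckeV_entries le_rfl 2
  norm_num [s1, s2, s3] at a b c d e f g h
  simp only [wordProd_cons, wordProd_nil, mul_one, mul_zero_zero, mul_zero_one, mul_one_zero,
    mul_one_one, a, b, c, d, e, f, g, h]
  norm_num

lemma fixes_wordProd_three {x : ℝ} : Fixes (wordProd 3 [1, 2, 1]) x ↔ x ^ 2 = 3 := by
  obtain ⟨a, b, c, d⟩ := wordProd_three_entries
  rw [Fixes, a, b, c, d]
  constructor <;> intro h <;> linarith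

lemma isSimple_sqrt_three : IsSimple 3 √3 :=
  IsPeriodic.isSimple le_rfl ⟨by positivity, [1, 2, 1], by simp [Admissible], by simp,
    (fixes_wordProd_three.mpr (Real.sq_sqrt zero_le_three)).mob_eq⟩

lemma heckeConj_sqrt_three : heckeConj 3 √3 = -√3 := by
  have hsq : √3 ^ 2 = 3 := Real.sq_sqrt zero_le_three
  obtain ⟨-, hne, hfix⟩ := (isHeckeConj_iff (p := 3) le_rfl).mpr ⟨isSimple_sqrt_three.1, rfl⟩
  have hsq' := fixes_wordProd_three.mp
    (hfix _ (wordProd_mem [1, 2, 1]) (fixes_wordProd_three.mpr hsq))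
  exact (sq_eq_sq_iff_eq_or_eq_neg.mp (hsq'.trans hsq.symm)).resolve_left hne

lemma exists_hyperbolicForm_sqrt_three : ∃ c : ℝ, c ≠ 0 ∧
    hyperbolicForm 3 √3 = ⟨c, 0, -(3 * c)⟩ := by
  have hx := isSimple_sqrt_three.1
  have hsum := one_zero_mul_heckeConj_add le_rfl hx
  have hprod := one_zero_mul_heckeConj_mul le_rfl hx
  rw [heckeConj_sqrt_three, neg_add_cancel, mul_zero] at hsum
  rw [heckeConj_sqrt_three, mul_neg, Real.mul_self_sqrt zero_le_three] at hprod
  refine ⟨_, hyperbolicElt_one_zero_ne_zero le_rfl hx, ?_⟩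
  ext <;> simp only [hyperbolicForm, BQF.ofMatrix] <;> linarith

lemma int_sq_sub_three_mul_sq_ne_neg_one (m n : ℤ) : m ^ 2 - 3 * n ^ 2 ≠ -1 := by
  have hmod : ∀ a b : ZMod 4, a ^ 2 - 3 * b ^ 2 ≠ -1 := by decide
  exact fun h ↦ hmod m n (mod_cast congrArg (Int.cast : ℤ → ZMod 4) h)

lemma negClass_formClass_sqrt_three_ne : negClass (formClass 3 √3) ≠ formClass 3 √3 := by
  intro h
  have hmem : (hyperbolicForm 3 √3).neg ∈ formClass 3 √3 := by
    rw [← h, neg_mem_negClass]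
    exact hyperbolicForm_mem_formClass _
  obtain ⟨M, hM, hact⟩ := hmem
  obtain ⟨c, hc, hQ⟩ := exists_hyperbolicForm_sqrt_three
  obtain ⟨m, hm⟩ := exists_intCast_eq_of_mem_heckeGroup_three hM 0 0
  obtain ⟨n, hn⟩ := exists_intCast_eq_of_mem_heckeGroup_three hM 1 0
  have hA := congrArg BQF.A hact
  simp only [hQ, BQF.neg, BQF.act, hm, hn] at hA
  have hsub : (m : ℝ) ^ 2 - 3 * (n : ℝ) ^ 2 = -1 :=
    mul_left_cancel₀ hc (by linear_combination -hA)
  exact int_sq_sub_three_mul_sq_ne_neg_one m n (mod_cast hsub)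

end

theorem theorem2 (k : ℕ) (hk : Odd k) :
    (∀ p : ℕ, 3 ≤ p →
      -- the sums over `Z_𝒜` are finite sums
      (∀ 𝒜 : Set BQF, IsHyperbolicClass p 𝒜 → (simpleNumbers p 𝒜).Finite) ∧
      -- Hecke-symmetric irreducible systems of poles force the special form
      (∀ q : RatFunc ℂ, IsRPF p k q → (∀ P : Set ℂ, IsISPOf p q P → HeckeSymmetric p P) →
        HasSymmetricForm p k q) ∧
      -- the converse
      (∀ q : RatFunc ℂ, HasSymmetricForm p k q →
        IsRPF p k q ∧ HeckeSymmetric p (nonzeroPoles q))) ∧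
    -- a Hecke-symmetric set of nonzero poles does not force Hecke-symmetric irreducible systems
    (∃ p : ℕ, 3 ≤ p ∧ ∃ 𝒜 : Set BQF, IsHyperbolicClass p 𝒜 ∧ IsHyperbolicClass p (negClass 𝒜) ∧
      ∃ q : RatFunc ℂ, q = classSum p k 𝒜 + classSum p k (negClass 𝒜) ∧
        IsRPF p k q ∧ HeckeSymmetric p (nonzeroPoles q) ∧
        ∃ P : Set ℂ, IsISPOf p q P ∧ ¬ HeckeSymmetric p P) := by
  refine ⟨fun p hp ↦ ⟨fun 𝒜 h ↦ simpleNumbers_finite hp h.1,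
    fun q hq hs ↦ hq.hasSymmetricForm hp hk hs,
    fun q hq ↦ ⟨hq.isRPF hp hk, hq.heckeSymmetric_nonzeroPoles hp hk⟩⟩, 3, le_rfl, ?_⟩
  have h := isHyperbolicClass_formClass le_rfl isSimple_sqrt_three.1
  have hneg := negClass_formClass_sqrt_three_ne
  exact ⟨_, h, h.negClass le_rfl, _, rfl, isRPF_classSum_add le_rfl h.1 hk hneg,
    heckeSymmetric_nonzeroPoles_classSum_add le_rfl h.1 hk hneg,
    _, ⟨_, h, rfl, poleSystem_subset_nonzeroPoles_classSum_add le_rfl h.1 hk hneg⟩,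
    fun hs ↦ hneg (negClass_eq_of_heckeSymmetric le_rfl h hs)⟩
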